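/- **Complexes.** An $r$-dimensional based cochain complex $\mathcal C^*=(\mathbb F_2^{C^0}\xrightarrow{\delta_0}\mathbb F_2^{C^1}\xrightarrow{\delta_1}\cdots\xrightarrow{\delta_{r-1}}\mathbb F_2^{C^r})$ has finite bases $C^j$ and satisfies $\delta^2=0$; put $\partial=\delta^\top$. For $c\in C^j$, $c'\in C^{j+1}$ write $c\triangleleft c'$ if $c'\in\operatorname{supp}\delta(\mathbb 1_c)$, and let $\preceq$ be the partial order on $C=\bigsqcup_jC^j$ generated by $\triangleleft$. Locality $w$ means that every $c\in C$ is comparable to at most $w$ elements of $C$. For a cochain $a$, $c^0\preceq a$ means $c^0\preceq c$ for all $c\in\operatorname{supp}a$; $|\cdot|$ is the Hamming weight. The chain complex $\mathcal C_*$ is regarded as a cochain complex with coboundary map $\partial$ by relabelling level $j$ as level $r-j$ (so that $C^r$ plays the role of $C^0$). For $I\subseteq\{0,\dots,r\}$ the connectivity graph $G^{\mathcal C}_I$ has vertex set $\bigsqcup_{j\in I}C^j$, two distinct vertices being adjacent iff both lie above a common element of $C^0$ or both lie below a common element of $C^r$. $\mathcal C^*$ has an $(m,\gamma)$-small-set flip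 decoder at level $i$ if 1. for every nonzero $e\in\mathbb F_2^{C^i}$ with $|e|\le m$ there is $c^0\in C^0$ such that $|e+\delta(b)|<|e|$ for some $b\in\mathbb F_2^{C^{i-1}}$ with $c^0\preceq b$, or $|\delta(e+a)|<|\delta(e)|$ for some $a\in\mathbb F_2^{C^i}$ with $c^0\preceq a$; and 2. for every $e\in\mathbb F_2^{C^i}$ with $\delta(e)\ne0$, $|e|\le m$ and every $f\in\mathbb F_2^{C^{i+1}}$ with $|f|\le\gamma|\delta(e)|$ there are $c^0\in C^0$ and $a\in\mathbb F_2^{C^i}$ with $c^0\preceq a$ and $|\delta(e+a)+f|<|\delta(e)+f|$. **Circuits and gadgets.** An adaptive Clifford circuit with quantum space $N$ and time $T$ performs in each of $T$ timesteps a noiseless classical computation on a classical register of $M\ge N$ bits, and then a layer of gates on disjoint sets of qubits, taken from $I,X,Y,Z,H,S$, CNOT, single-qubit Pauli measurements, and resets to $|0\rangle$ and $|+\rangle$. The $j$-th gate of a layer is applied iff the classical bit $x_j=1$, except that measurements are always performed and write their outcome to $x_j$. A Pauli fault $\mathcal F=(\mathcal F_1,\dots,\mathcal F_T)$ applies a Pauli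 superoperator $\mathcal F_t:\rho\mapsto F_t\rho F_t'$ ($F_t,F_t'$ Paulis) on the $N$ qubits after each timestep $t$; $\operatorname{supp}\mathcal F\subseteq[N]\times[T]$ is the set of locations where it acts nontrivially, and $\mathcal Q[\mathcal F]$ is the corrupted circuit. For a finite graph $G$ and $\eta,\gamma>0$, $\mathcal E(G,\eta,\gamma)$ is the family of all $S\subseteq V(G)$ that lie in a connected subgraph $G'\subseteq G$ with $|V(G')|\ge\eta$ and $|S|/|V(G')|\ge\gamma$. A set is $\mathcal E$-avoiding if it contains no member of $\mathcal E$; $\mathcal E^{\sqcup T}$ is the union of $T$ disjoint copies of $\mathcal E$, one per timestep. A decorated code $(Q,\operatorname{Enc},\mathcal E)$ is a code with an encoding isometry and a family $\mathcal E$ of subsets of a superset of its physical qubits. An operator $\sigma$ on qubits including those of $Q$, together with a reference system, is a Pauli $\mathcal E$-deviation of $\operatorname{Enc}(\rho)$ if, after tracing out all other qubits and classical bits, it is a scalar multiple (possibly $0$) of $\mathcal P(\operatorname{Enc}(\rho))$ for a Pauli superoperator $\mathcal P$ with $\mathcal E$-avoiding support. $((\mathcal Q,\mathcal E),D_{\rm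 in},D_{\rm out})$ is a Pauli fault-tolerant gadget for a channel $\bar{\mathcal O}$ if for every $\ell$, every density operator $\rho$ on the logical qubits and an $\ell$-qubit reference system, every Pauli $\mathcal E_{\rm in}$-deviation $\sigma$ of $\operatorname{Enc}_{\rm in}(\rho)$ whose classical register is in a computational basis state, and every Pauli fault $\mathcal F$ with $\mathcal E$-avoiding support, $\mathcal Q[\mathcal F](\sigma)$ is a Pauli $\mathcal E_{\rm out}$-deviation of $\operatorname{Enc}_{\rm out}(\bar{\mathcal O}(\rho))$. **Proposition.** There are an absolute constant $K$ and a function $w\mapsto T=T(w)$ with $1\le T(w)\le Kw$ for all $w\ge1$ such that the following holds. Let $1\le i\le r-1$, $w\ge1$, $\gamma_{\rm dec}>0$, and let $\mathcal C^*$ be an $r$-dimensional based cochain complex of locality $w$ such that both $\mathcal C^*$ and $\mathcal C_*$ have an $(m,\gamma_{\rm dec})$-small-set flip decoder at level $i$ (for $\mathcal C_*$: at relabelled level $r-i$). Let $Q=(\ker\partial_i,\ker\delta_i)$ be the $[[n,k]]$ CSS code of level $i$, $n=|C^i|$, let $\mathbb F_2^k\cong H^i(\mathcal C)$ be a linear isomorphism,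 and let $\operatorname{Enc}$ be the induced isometry, sending $|x\rangle$ to the uniform superposition over the cohomology class of $x$. Let $G_{\rm run}$ be a finite graph that contains $G^{\mathcal C}_{\{i-1,i,i+1\}}$ as a subgraph and in which any $c\triangleleft c'$ with $c,c'\in C^{i-1}\sqcup C^i\sqcup C^{i+1}$ are adjacent. Let $$0<\eta_{\rm run}\le\eta_{\rm in}\le m,\qquad 0<\gamma_{\rm run}\le\gamma_{\rm in}\le\frac1{50\,w^7\,T\,2^{T+1}},\qquad \gamma_{\rm out}=\frac{(w+1)\,T\,2^{T+6}\,\gamma_{\rm run}}{\gamma_{\rm dec}},$$ $\mathcal E_{\rm in}=\mathcal E(G_{\rm run},\eta_{\rm in},\gamma_{\rm in})$, $\mathcal E_{\rm run}=\mathcal E(G_{\rm run},\eta_{\rm run},\gamma_{\rm run})$, $\mathcal E_{\rm out}=\mathcal E(G_{\rm run},\eta_{\rm run},\gamma_{\rm out})$, $D_{\rm in}=(Q,\operatorname{Enc},\mathcal E_{\rm in})$ and $D_{\rm out}=(Q,\operatorname{Enc},\mathcal E_{\rm out})$. Then there is an adaptive Clifford circuit $\mathcal Q$ with quantum space $N\le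 Knw$ and time $T$, whose qubits are distinct vertices of $G_{\rm run}$ and include $C^i$, such that $((\mathcal Q,\mathcal E_{\rm run}^{\sqcup T}),D_{\rm in},D_{\rm out})$, with input and output code both on the qubits $C^i$, is a Pauli fault-tolerant gadget for the identity channel on $k$ qubits. -/

import Mathlib

open scoped Matrix Kronecker ComplexOrder

noncomputable section

namespace FaultTol

/-! ### Based cochain complexes over the field with two elements -/

/-- An `r`-dimensional based cochain complex over `ZMod 2`. The type `X` is the disjoint union of
the bases of all levels `0, ..., r`; `δ c' c` is the coefficient of `c'` in the coboundary of the
basis element `c`. The boundary map is the transpose of `δ`. -/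
structure BasedComplex (r : ℕ) (X : Type*) [Fintype X] where
  level : X → ℕ
  level_le : ∀ c, level c ≤ r
  δ : Matrix X X (ZMod 2)
  level_of_δ : ∀ c c', δ c' c ≠ 0 → level c' = level c + 1
  δ_sq : δ * δ = 0

namespace BasedComplex

variable {r : ℕ} {X : Type*} [Fintype X]

/-- The associated chain complex, regarded as a cochain complex: the coboundary map is replaced
by the boundary map, and level `i` becomes level `r - i`. -/
def dual (C : BasedComplex r X) : BasedComplex r X where
  level := fun c => r - C.level c
  level_le := fun c => Nat.sub_le r (C.level c)
  δ := (C.δ)ᵀ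
  level_of_δ := by
    intro c c' h
    have h1 := C.level_of_δ c' c h
    have h2 := C.level_le c
    omega
  δ_sq := by rw [← Matrix.transpose_mul, C.δ_sq, Matrix.transpose_zero]

/-- The basis of level `i`. -/
abbrev Cell (C : BasedComplex r X) (i : ℕ) : Type _ := {c : X // C.level c = i}

instance (C : BasedComplex r X) (i : ℕ) : Fintype (C.Cell i) := Fintype.ofFinite _

instance (C : BasedComplex r X) (i : ℕ) : DecidableEq (C.Cell i) := Classical.decEq _

/-- Cochains (equivalently chains) of level `i`. -/
abbrev Cochain (C : BasedComplex r X) (i : ℕ) : Type _ := C.Cell i → ZMod 2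

/-- `c` and `c'` are incident: `c'` occurs in the coboundary of `c`. -/
def Incident (C : BasedComplex r X) (c c' : X) : Prop := C.δ c' c ≠ 0

/-- The partial order generated by incidence. -/
def Below (C : BasedComplex r X) (c c' : X) : Prop := Relation.ReflTransGen C.Incident c c'

/-- Every basis element is comparable to at most `w` basis elements (itself included). -/
def HasLocality (C : BasedComplex r X) (w : ℕ) : Prop :=
  ∀ c : X, {c' : X | C.Below c' c ∨ C.Below c c'}.ncard ≤ w

/-- The block of `δ` from level `i` to level `j`. It is the coboundary map `δ_i` for `j = i + 1`,
and it vanishes for `j ≠ i + 1`. -/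
def block (C : BasedComplex r X) (i j : ℕ) : Matrix (C.Cell j) (C.Cell i) (ZMod 2) :=
  C.δ.submatrix Subtype.val Subtype.val

/-- The coboundary map out of level `i`. -/
def cob (C : BasedComplex r X) (i : ℕ) : C.Cochain i →ₗ[ZMod 2] C.Cochain (i + 1) :=
  (C.block i (i + 1)).mulVecLin

/-- The coboundary map into level `i` (zero if `i = 0`). -/
def cobInto (C : BasedComplex r X) (i : ℕ) : C.Cochain (i - 1) →ₗ[ZMod 2] C.Cochain i :=
  (C.block (i - 1) i).mulVecLin

/-- The boundary map out of level `i` (zero if `i = 0`). -/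
def bdry (C : BasedComplex r X) (i : ℕ) : C.Cochain i →ₗ[ZMod 2] C.Cochain (i - 1) :=
  ((C.block (i - 1) i)ᵀ).mulVecLin

/-- `i`-cocycles. -/
def cocycles (C : BasedComplex r X) (i : ℕ) : Submodule (ZMod 2) (C.Cochain i) :=
  LinearMap.ker (C.cob i)

/-- `i`-coboundaries. -/
def coboundaries (C : BasedComplex r X) (i : ℕ) : Submodule (ZMod 2) (C.Cochain i) :=
  LinearMap.range (C.cobInto i)

/-- `i`-cohomology. -/
abbrev Cohomology (C : BasedComplex r X) (i : ℕ) : Type _ :=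
  C.cocycles i ⧸ (C.coboundaries i).submoduleOf (C.cocycles i)

/-- All basis elements in the support of the cochain `a` lie above `c₀`. -/
def SupportedAbove (C : BasedComplex r X) {i : ℕ} (c₀ : X) (a : C.Cochain i) : Prop :=
  ∀ c : C.Cell i, a c ≠ 0 → C.Below c₀ c

/-- `m`-small-set error-flip decoder at level `i`. -/
def HasErrorFlipDecoder (C : BasedComplex r X) (m i : ℕ) : Prop :=
  ∀ e : C.Cochain i, e ≠ 0 → hammingNorm e ≤ m →
    ∃ c₀ : C.Cell 0,
      (∃ b : C.Cochain (i - 1), C.SupportedAbove c₀ b ∧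
        hammingNorm (e + C.cobInto i b) < hammingNorm e) ∨
      (∃ a : C.Cochain i, C.SupportedAbove c₀ a ∧
        hammingNorm (C.cob i (e + a)) < hammingNorm (C.cob i e))

/-- `(m, γ)`-small-set syndrome-flip decoder at level `i`. Only errors with a nonzero syndrome
are considered: the weight of a zero syndrome cannot be reduced. -/
def HasSyndromeFlipDecoder (C : BasedComplex r X) (m : ℕ) (γ : ℝ) (i : ℕ) : Prop :=
  ∀ e : C.Cochain i, C.cob i e ≠ 0 → hammingNorm e ≤ m →
    ∀ f : C.Cochain (i + 1), (hammingNorm f : ℝ) ≤ γ * hammingNorm (C.cob i e) →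
      ∃ (c₀ : C.Cell 0) (a : C.Cochain i), C.SupportedAbove c₀ a ∧
        hammingNorm (C.cob i (e + a) + f) < hammingNorm (C.cob i e + f)

/-- `(m, γ)`-small-set flip decoder at level `i`. -/
def HasFlipDecoder (C : BasedComplex r X) (m : ℕ) (γ : ℝ) (i : ℕ) : Prop :=
  C.HasErrorFlipDecoder m i ∧ C.HasSyndromeFlipDecoder m γ i

/-- The vertices of the level-`I` connectivity graph. -/
abbrev LevelVertex (C : BasedComplex r X) (I : Set ℕ) : Type _ := {c : X // C.level c ∈ I}

/-- The level-`I` connectivity graph: distinct vertices are adjacent when they lie above a common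
basis element of level `0` or below a common basis element of level `r`. -/
def connectivityGraph (C : BasedComplex r X) (I : Set ℕ) : SimpleGraph (C.LevelVertex I) where
  Adj := fun a b => a ≠ b ∧
    ((∃ z : C.Cell 0, C.Below z a ∧ C.Below z b) ∨ (∃ z : C.Cell r, C.Below a z ∧ C.Below b z))
  symm := ⟨by
    rintro a b ⟨hab, h⟩
    refine ⟨hab.symm, ?_⟩
    rcases h with ⟨z, h1, h2⟩ | ⟨z, h1, h2⟩
    · exact Or.inl ⟨z, h2, h1⟩
    · exact Or.inr ⟨z, h2, h1⟩⟩
  loopless := ⟨fun _ h => h.1 rfl⟩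

end BasedComplex

/-! ### CSS codes and their encoding maps -/

/-- A CSS code on the qubit set `n`, given by its two classical codes. -/
structure CSSCode (n : Type*) where
  codeX : Submodule (ZMod 2) (n → ZMod 2)
  codeZ : Submodule (ZMod 2) (n → ZMod 2)

/-- The CSS code associated to level `i` of a cochain complex. -/
def BasedComplex.cssCode {r : ℕ} {X : Type*} [Fintype X] (C : BasedComplex r X) (i : ℕ) :
    CSSCode (C.Cell i) where
  codeX := LinearMap.ker (C.bdry i)
  codeZ := LinearMap.ker (C.cob i)

/-- A CSS encoding map for the code at level `i`, with `k` logical qubits. -/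
abbrev BasedComplex.CSSEncoding {r : ℕ} {X : Type*} [Fintype X] (C : BasedComplex r X) (i k : ℕ) :
    Type _ :=
  (Fin k → ZMod 2) ≃ₗ[ZMod 2] C.Cohomology i

open scoped Classical in
/-- The encoding isometry: the basis state labelled `x` is sent to the uniform superposition of
the basis states labelled by the elements of the cohomology class of `x`, which is a coset of the
space of coboundaries. -/
def BasedComplex.encodingIsometry {r : ℕ} {X : Type*} [Fintype X] (C : BasedComplex r X)
    {i k : ℕ} (enc : C.CSSEncoding i k) : Matrix (C.Cochain i) (Fin k → ZMod 2) ℂ :=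
  fun z x =>
    if ∃ h : z ∈ C.cocycles i, (Submodule.Quotient.mk ⟨z, h⟩ : C.Cohomology i) = enc x
    then (((Real.sqrt (Nat.card (C.coboundaries i)))⁻¹ : ℝ) : ℂ) else 0

/-! ### Pauli operators

The computational basis of the qubits `q` is indexed by `q → ZMod 2`. -/

/-- Single-qubit Pauli operators. -/
inductive Pauli
  | I
  | X
  | Y
  | Z

/-- The matrix of a single-qubit Pauli operator. -/
def Pauli.mat : Pauli → Matrix (ZMod 2) (ZMod 2) ℂ
  | .I => !![1, 0; 0, 1]
  | .X => !![0, 1; 1, 0]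
  | .Y => !![0, -Complex.I; Complex.I, 0]
  | .Z => !![1, 0; 0, -1]

/-- The tensor product of the single-qubit Pauli operators `P a`. -/
def pauliMat {q : Type*} [Fintype q] (P : q → Pauli) :
    Matrix (q → ZMod 2) (q → ZMod 2) ℂ :=
  fun x y => ∏ a, (P a).mat (x a) (y a)

/-- A Pauli superoperator `ρ ↦ A ρ B` with Pauli operators `A`, `B`. -/
structure PauliSuperop (q : Type*) where
  left : q → Pauli
  right : q → Pauli

/-- The qubits on which a Pauli superoperator acts nontrivially. -/
def PauliSuperop.support {q : Type*} (F : PauliSuperop q) : Set q :=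
  {a | F.left a ≠ Pauli.I ∨ F.right a ≠ Pauli.I}

/-- The action of a Pauli superoperator, tensored with the identity on a reference system with
basis `R`. -/
def PauliSuperop.apply {q : Type*} [Fintype q] [DecidableEq q] {R : Type*} [Fintype R] [DecidableEq R]
    (F : PauliSuperop q) (ρ : Matrix ((q → ZMod 2) × R) ((q → ZMod 2) × R) ℂ) :
    Matrix ((q → ZMod 2) × R) ((q → ZMod 2) × R) ℂ :=
  (pauliMat F.left ⊗ₖ (1 : Matrix R R ℂ)) * ρ * (pauliMat F.right ⊗ₖ (1 : Matrix R R ℂ))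

/-! ### Adaptive Clifford circuits -/

/-- A gate of the Clifford gate set on `N` qubits: the one-qubit unitaries `I, X, Y, Z, H, S`,
the two-qubit unitary `CNOT`, the one-qubit Pauli `X, Y, Z` measurements, and the one-qubit
resets to `|0⟩` and `|+⟩`. -/
inductive CliffordGate (N : ℕ)
  | pauli (P : Pauli) (a : Fin N)
  | hadamard (a : Fin N)
  | phase (a : Fin N)
  | cnot (control target : Fin N) (h : control ≠ target)
  | measure (P : Pauli) (hP : P ≠ Pauli.I) (a : Fin N)
  | resetZero (a : Fin N)
  | resetPlus (a : Fin N)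

/-- The qubits on which a gate acts. -/
def CliffordGate.qubits {N : ℕ} : CliffordGate N → Set (Fin N)
  | .pauli _ a => {a}
  | .hadamard a => {a}
  | .phase a => {a}
  | .cnot a b _ => {a, b}
  | .measure _ _ a => {a}
  | .resetZero a => {a}
  | .resetPlus a => {a}

open scoped Classical in
/-- The operator acting as `U` on qubit `a` and as the identity on the other qubits. -/
def onQubit {N : ℕ} (a : Fin N) (U : Matrix (ZMod 2) (ZMod 2) ℂ) :
    Matrix (Fin N → ZMod 2) (Fin N → ZMod 2) ℂ :=
  fun x y => if ∀ b, b ≠ a → x b = y b then U (x a) (y a) else 0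

/-- `CNOT`: the target bit is replaced by its sum with the control bit. -/
def cnotMat {N : ℕ} (control target : Fin N) : Matrix (Fin N → ZMod 2) (Fin N → ZMod 2) ℂ :=
  fun x y => if x = Function.update y target (y target + y control) then 1 else 0

/-- The projector onto the eigenspace of the Pauli operator `P` with eigenvalue `(-1)^b`. -/
def Pauli.proj (P : Pauli) (b : ZMod 2) : Matrix (ZMod 2) (ZMod 2) ℂ :=
  (1 / 2 : ℂ) • (1 + (if b = 0 then (1 : ℂ) else -1) • P.mat)

/-- Kraus operators of the channel of a gate. For a measurement these are listed only for
completeness, since `CliffordGate.act` also records the outcome. -/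
def CliffordGate.kraus {N : ℕ} :
    CliffordGate N → ZMod 2 → Matrix (Fin N → ZMod 2) (Fin N → ZMod 2) ℂ
  | .pauli P a, b => if b = 0 then onQubit a P.mat else 0
  | .hadamard a, b =>
      if b = 0 then onQubit a ((((Real.sqrt 2)⁻¹ : ℝ) : ℂ) • !![1, 1; 1, -1]) else 0
  | .phase a, b => if b = 0 then onQubit a !![1, 0; 0, Complex.I] else 0
  | .cnot c t _, b => if b = 0 then cnotMat c t else 0
  | .measure P _ a, b => onQubit a (P.proj b)
  | .resetZero a, b => onQubit a (fun x y => if x = 0 ∧ y = b then 1 else 0)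
  | .resetPlus a, b =>
      onQubit a (fun _ y => if y = b then (((Real.sqrt 2)⁻¹ : ℝ) : ℂ) else 0)

/-- A joint operator on `N` qubits, a reference system with basis `R`, and a classical `M`-bit
register in a computational basis state: `∑ x, τ x ⊗ |x⟩⟨x|` is represented by the family `τ`. -/
abbrev HybridState (N M : ℕ) (R : Type*) : Type _ :=
  (Fin M → ZMod 2) → Matrix ((Fin N → ZMod 2) × R) ((Fin N → ZMod 2) × R) ℂ

/-- `K ρ K†`, with `K` acting trivially on the reference system. -/
def conjBy {N : ℕ} {R : Type*} [Fintype R] [DecidableEq R]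
    (K : Matrix (Fin N → ZMod 2) (Fin N → ZMod 2) ℂ)
    (ρ : Matrix ((Fin N → ZMod 2) × R) ((Fin N → ZMod 2) × R) ℂ) :
    Matrix ((Fin N → ZMod 2) × R) ((Fin N → ZMod 2) × R) ℂ :=
  (K ⊗ₖ (1 : Matrix R R ℂ)) * ρ * (K ⊗ₖ (1 : Matrix R R ℂ))ᴴ

/-- The action of a gate attached to the classical bit `j`. A measurement is always performed and
overwrites bit `j` with its outcome; every other gate is applied exactly when bit `j` is `1`. -/
def CliffordGate.act {N M : ℕ} {R : Type*} [Fintype R] [DecidableEq R]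
    (g : CliffordGate N) (j : Fin M) (τ : HybridState N M R) : HybridState N M R :=
  match g with
  | .measure P hP a => fun x =>
      ∑ b : ZMod 2, conjBy ((CliffordGate.measure P hP a).kraus (x j)) (τ (Function.update x j b))
  | g => fun x => if x j = 1 then ∑ b : ZMod 2, conjBy (g.kraus b) (τ x) else τ x

/-- One timestep of gates on disjoint sets of qubits; gate number `j` is attached to the classical
bit `j`. -/
structure CliffordLayer (N M : ℕ) where
  numGates : ℕ
  numGates_le : numGates ≤ M
  gate : Fin numGates → CliffordGate N
  disjoint : Pairwise fun j j' => Disjoint (gate j).qubits (gate j').qubits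

/-- The action of a layer. The order of the gates is irrelevant, since they act on disjoint sets
of qubits and are attached to distinct classical bits. -/
def CliffordLayer.act {N M : ℕ} {R : Type*} [Fintype R] [DecidableEq R]
    (L : CliffordLayer N M) (τ : HybridState N M R) : HybridState N M R :=
  (List.finRange L.numGates).foldl
    (fun τ j => (L.gate j).act (Fin.castLE L.numGates_le j) τ) τ

open scoped Classical in
/-- The action of a classical circuit, computing the function `f`, on the classical register. -/
def classicalAct {N M : ℕ} {R : Type*} (f : (Fin M → ZMod 2) → (Fin M → ZMod 2))
    (τ : HybridState N M R) : HybridState N M R :=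
  fun x => ∑ y : Fin M → ZMod 2, if f y = x then τ y else 0

/-- An adaptive Clifford circuit with quantum space `N`, classical space `M` and time `T`. Each
timestep consists of a noiseless classical circuit on the classical register followed by a layer
of Clifford gates controlled by that register. -/
structure AdaptiveCliffordCircuit (N M T : ℕ) where
  space_le : N ≤ M
  classical : Fin T → (Fin M → ZMod 2) → (Fin M → ZMod 2)
  layer : Fin T → CliffordLayer N M

/-- A Pauli fault: a Pauli superoperator on the `N` qubits after each timestep. -/
abbrev PauliFault (N T : ℕ) : Type := Fin T → PauliSuperop (Fin N)

/-- The fault path: the space-time locations on which the fault acts nontrivially. -/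
def PauliFault.support {N T : ℕ} (F : PauliFault N T) : Set (Fin N × Fin T) :=
  {p | p.1 ∈ (F p.2).support}

/-- The superoperator of the `F`-corrupted circuit, tensored with the identity on a reference
system. -/
def AdaptiveCliffordCircuit.runFaulty {N M T : ℕ} {R : Type*} [Fintype R] [DecidableEq R]
    (Q : AdaptiveCliffordCircuit N M T) (F : PauliFault N T) (τ : HybridState N M R) :
    HybridState N M R :=
  (List.finRange T).foldl
    (fun τ t => fun x => (F t).apply ((Q.layer t).act (classicalAct (Q.classical t) τ) x)) τ

/-! ### Bad sets, decorated codes and fault-tolerant gadgets -/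

/-- `S` is avoiding for the family `E` of bad sets if it contains no bad set. -/
def IsAvoiding {V : Type*} (E : Set (Set V)) (S : Set V) : Prop :=
  ∀ B ∈ E, ¬ B ⊆ S

/-- The disjoint union of `T` copies of a family of bad sets. -/
def disjointCopies {V : Type*} (E : Set (Set V)) (T : ℕ) : Set (Set (V × Fin T)) :=
  {S | ∃ t : Fin T, ∃ B ∈ E, S = B ×ˢ {t}}

/-- The sets that lie in a connected subgraph `H` of `G` with at least `η` vertices and that have
density at least `γ` in `H`. -/
def graphBadSets {V : Type*} (G : SimpleGraph V) (η γ : ℝ) : Set (Set V) :=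
  {S | ∃ H : G.Subgraph, H.Connected ∧ S ⊆ H.verts ∧
    η ≤ (H.verts.ncard : ℝ) ∧ γ ≤ (S.ncard : ℝ) / (H.verts.ncard : ℝ)}

/-- A decorated code with physical qubits `n`: a CSS code, the matrix of its encoding isometry on
`k` logical qubits, and a family of bad sets on a superset `V` of the physical qubits. -/
structure DecoratedCode (n V : Type*) where
  code : CSSCode n
  k : ℕ
  enc : Matrix (n → ZMod 2) (Fin k → ZMod 2) ℂ
  site : n ↪ V
  bad : Set (Set V)

/-- The encoding channel, tensored with the identity on a reference system. -/
def DecoratedCode.encode {n V : Type*} (D : DecoratedCode n V)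
    {R : Type*} [Fintype R] [DecidableEq R]
    (ρ : Matrix ((Fin D.k → ZMod 2) × R) ((Fin D.k → ZMod 2) × R) ℂ) :
    Matrix ((n → ZMod 2) × R) ((n → ZMod 2) × R) ℂ :=
  (D.enc ⊗ₖ (1 : Matrix R R ℂ)) * ρ * (D.enc ⊗ₖ (1 : Matrix R R ℂ))ᴴ

open scoped Classical in
/-- Discard the classical register and all qubits outside the range of `pos`. -/
def partialTrace {n : Type*} {N M : ℕ} {R : Type*} (pos : n ↪ Fin N) (τ : HybridState N M R) :
    Matrix ((n → ZMod 2) × R) ((n → ZMod 2) × R) ℂ :=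
  fun p p' => ∑ x : Fin M → ZMod 2, ∑ u : Fin N → ZMod 2, ∑ u' : Fin N → ZMod 2,
    if (∀ c, u (pos c) = p.1 c) ∧ (∀ c, u' (pos c) = p'.1 c) ∧
        (∀ a, a ∉ Set.range pos → u a = u' a)
    then τ x (u, p.2) (u', p'.2) else 0

/-- `τ` is a Pauli deviation, for the bad sets of `D`, of the encoding of `ρ`; the code sits on
the qubits in the range of `pos`. The proportionality constant may be any complex number. -/
def IsPauliDeviation {n V : Type*} [Fintype n] [DecidableEq n] {N M : ℕ}
    {R : Type*} [Fintype R] [DecidableEq R]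
    (D : DecoratedCode n V) (pos : n ↪ Fin N) (τ : HybridState N M R)
    (ρ : Matrix ((Fin D.k → ZMod 2) × R) ((Fin D.k → ZMod 2) × R) ℂ) : Prop :=
  ∃ (F : PauliSuperop n) (z : ℂ), IsAvoiding D.bad (D.site '' F.support) ∧
    partialTrace pos τ = z • F.apply (D.encode ρ)

/-- A superoperator tensored with the identity on a reference system. -/
def withReference {α β R : Type*} (O : Matrix α α ℂ →ₗ[ℂ] Matrix β β ℂ)
    (ρ : Matrix (α × R) (α × R) ℂ) : Matrix (β × R) (β × R) ℂ :=
  fun p p' => O (fun a a' => ρ (a, p.2) (a', p'.2)) p.1 p'.1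

/-- Pauli fault-tolerant gadget for the logical operation `O`, without classical input or output.
The `N` physical qubits of the circuit are placed in `V` by `site`, the input and output codes sit
on the qubits `posIn` and `posOut`, and `bad` is the family of bad sets of fault locations. -/
def IsPauliFaultTolerantGadget {nIn nOut V : Type*} [Fintype nIn] [DecidableEq nIn]
    [Fintype nOut] [DecidableEq nOut] {N M T : ℕ}
    (Q : AdaptiveCliffordCircuit N M T) (bad : Set (Set (V × Fin T))) (site : Fin N ↪ V)
    (Din : DecoratedCode nIn V) (posIn : nIn ↪ Fin N)
    (Dout : DecoratedCode nOut V) (posOut : nOut ↪ Fin N)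
    (O : Matrix (Fin Din.k → ZMod 2) (Fin Din.k → ZMod 2) ℂ →ₗ[ℂ]
      Matrix (Fin Dout.k → ZMod 2) (Fin Dout.k → ZMod 2) ℂ) : Prop :=
  (∀ c, site (posIn c) = Din.site c) ∧ (∀ c, site (posOut c) = Dout.site c) ∧
  ∀ (l : ℕ) (ρ : Matrix ((Fin Din.k → ZMod 2) × (Fin l → ZMod 2))
      ((Fin Din.k → ZMod 2) × (Fin l → ZMod 2)) ℂ),
    ρ.PosSemidef → ρ.trace = 1 →
    ∀ σ : HybridState N M (Fin l → ZMod 2), IsPauliDeviation Din posIn σ ρ →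
    ∀ F : PauliFault N T, IsAvoiding bad (Prod.map site id '' F.support) →
      IsPauliDeviation Dout posOut (Q.runFaulty F σ) (withReference O ρ)

/-- The decorated code given by level `i` of a cochain complex, an encoding map, and the bad sets
of a graph containing the basis elements of level `i` among its vertices. -/
def decoratedLevel {r : ℕ} {X V : Type*} [Fintype X] (C : BasedComplex r X) {i k : ℕ}
    (enc : C.CSSEncoding i k) (site : C.Cell i ↪ V) (G : SimpleGraph V) (η γ : ℝ) :
    DecoratedCode (C.Cell i) V where
  code := C.cssCode i
  k := k
  enc := C.encodingIsometry enc
  site := site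
  bad := graphBadSets G η γ

/-- The inclusion of the basis elements of level `i` in the vertices of the level-`I` connectivity
graph, for `i ∈ I`. -/
def cellToVertex {r : ℕ} {X : Type*} [Fintype X] (C : BasedComplex r X) {i : ℕ} {I : Set ℕ}
    (hi : i ∈ I) : C.Cell i ↪ C.LevelVertex I where
  toFun := fun c => ⟨c.1, by rw [c.2]; exact hi⟩
  inj' := by
    intro a b h
    exact Subtype.ext (congrArg (fun v : C.LevelVertex I => v.1) h)

end FaultTol

end

/-! The circuit performs one round of syndrome extraction and correction. Every check that meets a
data qubit gets an ancilla at its own vertex. All ancillas are reset, coupled to the data by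
controlled-not gates along edge colourings of the two incidence graphs, and measured; one layer of
`X` and one of `Z` corrections follows. Each colouring uses `2w` colours, so the time is `2(2w) +
4`.

Propagation: all noise is Pauli, so states keep the form `z (A ⊗ 1) ρ (B ⊗ 1)†` with Weyl operators
`X^a Z^b` acting on the left and on the right factor separately. A controlled-not gate carries `X`
from control to target and `Z` from target to control. Ancillas of `X`-checks are only controls and
ancillas of `Z`-checks only targets, so a fault travels along at most two incidences, however many
layers there are. After the coupling the ancillas are eigenvectors of the measured operators on both
sides (`coupled_apply`, `measure_coupled`): each side has a definite outcome, and the state vanishes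
unless the two outcomes agree. Hence one classical register value survives and both sides receive
the same correction.

Decoding: the classical computation is unrestricted, so the decoder may pick any avoiding error that
explains the syndrome up to an avoiding measurement error. The sum of the true and the guessed error
is then sparse and has a sparse syndrome. By `exists_reduced` such an error is equivalent, modulo
stabilizers, to a residual controlled by its syndrome. The proof applies condition 1 of the flip
decoder cluster by cluster. Each flip lives in the clique above some `c⁰`, and this clique must meet
the current cluster, so the cluster stays connected; if it outgrew `m`, it would be a connected set
in which the error is too dense. Only syndrome-lowering flips enter the residual, and each of them
is paid for by a unit of syndrome.

Sparsity is transported by `Dominated`: each adjacency-closed part of the new set carries a fixed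
fraction of elements of the old one. By `IsAvoiding.of_dominated` this preserves avoidance at the
cost of a constant factor in density. It controls both the spread of faults (neighbourhoods) and the
decoder residual. Condition 2 is used to get `γdec < 1` when there are data qubits, which makes
`γ_out` large enough. -/

noncomputable section

set_option linter.unusedSectionVars false

namespace FaultTol

/-! ### Avoiding sets in graphs and domination -/

section Graph

variable {V : Type*} [Finite V] {G : SimpleGraph V}

/-- Characterisation of avoiding sets by connected vertex sets. -/
theorem isAvoiding_graphBadSets_iff {η γ : ℝ} {S : Set V} :
    IsAvoiding (graphBadSets G η γ) S ↔
      ∀ W : Set V, (G.induce W).Connected → η ≤ (W.ncard : ℝ) →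
        ((S ∩ W).ncard : ℝ) < γ * W.ncard := by
  constructor
  · intro h W hW hη
    by_contra hlt
    push Not at hlt
    have hpos : 0 < (W.ncard : ℝ) := by
      have : W.Nonempty := Set.nonempty_coe_sort.mp hW.nonempty
      exact_mod_cast (Set.ncard_pos (Set.toFinite W)).mpr this
    refine h (S ∩ W) ⟨(⊤ : G.Subgraph).induce W, SimpleGraph.connected_induce_iff.mp hW, ?_, ?_, ?_⟩
      Set.inter_subset_left
    · exact Set.inter_subset_right
    · exact hη
    · change γ ≤ ((S ∩ W).ncard : ℝ) / (W.ncard : ℝ)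
      rwa [le_div_iff₀ hpos]
  · rintro h B ⟨H, hH, hBH, hη, hγ⟩ hBS
    have h1 := h H.verts hH.induce_verts hη
    have hpos : 0 < (H.verts.ncard : ℝ) := by
      exact_mod_cast (Set.ncard_pos (Set.toFinite _)).mpr (SimpleGraph.Subgraph.Connected.nonempty hH)
    rw [le_div_iff₀ hpos] at hγ
    have h2 : B.ncard ≤ (S ∩ H.verts).ncard :=
      Set.ncard_le_ncard (Set.subset_inter hBS hBH) (Set.toFinite _)
    have h3 : (B.ncard : ℝ) ≤ ((S ∩ H.verts).ncard : ℝ) := by exact_mod_cast h2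
    linarith

theorem IsAvoiding.anti {E : Set (Set V)} {S S' : Set V} (h : IsAvoiding E S) (hS : S' ⊆ S) :
    IsAvoiding E S' := fun B hB hBS => h B hB (hBS.trans hS)

theorem IsAvoiding.empty {η γ : ℝ} (hγ : 0 < γ) : IsAvoiding (graphBadSets G η γ) ∅ := by
  rintro B ⟨H, -, -, -, h⟩ hB
  rw [Set.subset_empty_iff.mp hB] at h
  simp at h
  linarith

/-- The densities of the two sets in any fixed connected vertex set add up. -/
theorem IsAvoiding.union {η γ₁ γ₂ : ℝ} {S₁ S₂ : Set V}
    (h₁ : IsAvoiding (graphBadSets G η γ₁) S₁) (h₂ : IsAvoiding (graphBadSets G η γ₂) S₂) :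
    IsAvoiding (graphBadSets G η (γ₁ + γ₂)) (S₁ ∪ S₂) := by
  rw [isAvoiding_graphBadSets_iff] at *
  intro W hW hη
  have a := h₁ W hW hη
  have b := h₂ W hW hη
  have c : ((S₁ ∪ S₂) ∩ W).ncard ≤ (S₁ ∩ W).ncard + (S₂ ∩ W).ncard := by
    rw [Set.union_inter_distrib_right]; exact Set.ncard_union_le _ _
  have c' : (((S₁ ∪ S₂) ∩ W).ncard : ℝ) ≤ (S₁ ∩ W).ncard + (S₂ ∩ W).ncard := by exact_mod_cast c
  linarith

theorem IsAvoiding.mono {η γ γ' : ℝ} {S : Set V}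
    (h : IsAvoiding (graphBadSets G η γ) S) (hγ : γ ≤ γ') :
    IsAvoiding (graphBadSets G η γ') S := by
  rintro B ⟨H, h1, h2, h3, h4⟩ hB
  exact h B ⟨H, h1, h2, h3, hγ.trans h4⟩ hB

theorem isAvoiding_biUnion {ι : Type*} [DecidableEq ι] {η γ : ℝ} {S : ι → Set V} (I : Finset ι)
    (h : ∀ t ∈ I, IsAvoiding (graphBadSets G η γ) (S t)) (hI : I.Nonempty) :
    IsAvoiding (graphBadSets G η (I.card * γ)) (⋃ t ∈ I, S t) := by
  induction hI using Finset.Nonempty.cons_induction with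
  | singleton a => simpa using h a (by simp)
  | cons a I ha hI ih =>
    have h1 := ih (fun t ht => h t (by simp [ht]))
    have h2 := (h a (by simp)).union h1
    simp only [Finset.mem_cons, Set.iUnion_iUnion_eq_or_left, Finset.card_cons, Nat.cast_add,
      Nat.cast_one]
    exact h2.mono (by linarith)

/-- Every set that is closed under adjacency inside `R` has a fraction at least `1 / K` of its
elements in `S`. -/
def Dominated (G : SimpleGraph V) (K : ℕ) (S R : Set V) : Prop :=
  ∀ U ⊆ R, (∀ u ∈ U, ∀ v ∈ R, G.Adj u v → v ∈ U) → U.ncard ≤ K * (U ∩ S).ncard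

/-- A connected set inside an ambient set can be enlarged to a connected set closed under
adjacency inside the ambient set. -/
theorem exists_connected_closed {W A : Set V} (hW : (G.induce W).Connected) (hWA : W ⊆ A) :
    ∃ W', W ⊆ W' ∧ W' ⊆ A ∧ (G.induce W').Connected ∧
      ∀ u ∈ W', ∀ v ∈ A, G.Adj u v → v ∈ W' := by
  obtain ⟨W', hW', hmax⟩ := Set.Finite.exists_maximal
    (Set.toFinite {W' : Set V | W ⊆ W' ∧ W' ⊆ A ∧ (G.induce W').Connected})
    ⟨W, subset_rfl, hWA, hW⟩
  refine ⟨W', hW'.1, hW'.2.1, hW'.2.2, fun u hu v hv huv => ?_⟩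
  have hc : (G.induce (W' ∪ {u, v})).Connected :=
    SimpleGraph.induce_union_connected hW'.2.2.preconnected
      (SimpleGraph.induce_pair_connected_of_adj huv).preconnected ⟨u, hu, by simp⟩
  refine hmax (y := W' ∪ {u, v}) ⟨hW'.1.trans Set.subset_union_left, ?_, hc⟩
    Set.subset_union_left (Or.inr (by simp))
  rintro x (hx | rfl | rfl)
  · exact hW'.2.1 hx
  · exact hW'.2.1 hu
  · exact hv

/-- If `R` is dense in a connected `W`, absorb into `W` the parts of `R` attached to it, giving
`W'`. By domination `W'` contains many points of `S`, and it has grown by at most `K` times their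
number. Half of the factor `2 * K` pays for `W`, the other half for the growth. -/
theorem IsAvoiding.of_dominated {η γ : ℝ} {K : ℕ} {S R : Set V} (hγ : 0 < γ) (hK : 1 ≤ K)
    (h : IsAvoiding (graphBadSets G η γ) S) (hd : Dominated G K S R) :
    IsAvoiding (graphBadSets G η (2 * K * γ)) R := by
  rw [isAvoiding_graphBadSets_iff] at *
  intro W hW hη
  have hWpos : 0 < (W.ncard : ℝ) := by
    have : W.Nonempty := Set.nonempty_coe_sort.mp hW.nonempty
    exact_mod_cast (Set.ncard_pos (Set.toFinite W)).mpr this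
  have hRW : ((R ∩ W).ncard : ℝ) ≤ W.ncard := by
    exact_mod_cast Set.ncard_le_ncard Set.inter_subset_right (Set.toFinite _)
  have hK' : (1 : ℝ) ≤ K := by exact_mod_cast hK
  by_contra hlt
  push Not at hlt
  obtain ⟨W', h1, h2, h3, h4⟩ := exists_connected_closed hW (Set.subset_union_left (t := R))
  have hU := hd (W' ∩ R) Set.inter_subset_right
    (fun u hu v hv huv => ⟨h4 u hu.1 v (Or.inr hv) huv, hv⟩)
  have e1 : (R ∩ W).ncard ≤ (W' ∩ R).ncard :=
    Set.ncard_le_ncard (fun x hx => ⟨h1 hx.2, hx.1⟩) (Set.toFinite _)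
  have e2 : (W' ∩ R ∩ S).ncard ≤ (S ∩ W').ncard :=
    Set.ncard_le_ncard (fun x hx => ⟨hx.2, hx.1.1⟩) (Set.toFinite _)
  have e3 : W'.ncard ≤ W.ncard + (W' ∩ R).ncard := by
    refine (Set.ncard_le_ncard ?_ (Set.toFinite _)).trans (Set.ncard_union_le _ _)
    intro x hx
    rcases h2 hx with h | h
    · exact Or.inl h
    · exact Or.inr ⟨hx, h⟩
  have e4 : W.ncard ≤ W'.ncard := Set.ncard_le_ncard h1 (Set.toFinite _)
  have e5 : (W' ∩ R).ncard ≤ K * (S ∩ W').ncard := hU.trans (Nat.mul_le_mul_left _ e2)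
  have hη' : η ≤ (W'.ncard : ℝ) := hη.trans (by exact_mod_cast e4)
  have h5 := h W' h3 hη'
  have f1 : ((R ∩ W).ncard : ℝ) ≤ K * (S ∩ W').ncard := by exact_mod_cast e1.trans e5
  have f3 : (W'.ncard : ℝ) ≤ W.ncard + K * (S ∩ W').ncard := by
    exact_mod_cast e3.trans (Nat.add_le_add_left e5 _)
  have g1 : 2 * γ * W.ncard ≤ (S ∩ W').ncard := by
    have : K * (2 * γ * W.ncard) ≤ K * ((S ∩ W').ncard : ℝ) := by linarith
    exact le_of_mul_le_mul_left this (by linarith)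
  -- If `R ∩ W` has density at least `2Kγ` in `W`, that number cannot exceed 1. This bounds the
  -- contribution of the growth to `γ |W'|` by half of `|S ∩ W'|`.
  have g2 : 2 * K * γ ≤ 1 := by
    have : 2 * K * γ * W.ncard ≤ 1 * (W.ncard : ℝ) := by linarith
    exact le_of_mul_le_mul_right this hWpos
  have g3 : γ * (W'.ncard : ℝ) ≤ γ * (W.ncard + K * (S ∩ W').ncard) :=
    mul_le_mul_of_nonneg_left f3 hγ.le
  have g4 : 2 * K * γ * ((S ∩ W').ncard : ℝ) ≤ 1 * (S ∩ W').ncard :=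
    mul_le_mul_of_nonneg_right g2 (by positivity)
  linarith

/-- Neighbourhoods for a sparse subrelation of adjacency are dominated. -/
theorem dominated_neighbourhood {w : ℕ} (I : V → V → Prop) (hI : ∀ u v, I u v → u = v ∨ G.Adj u v)
    (hw : ∀ u, {v | I u v}.ncard ≤ w) (S : Set V) :
    Dominated G (w + 1) S (S ∪ {v | ∃ s ∈ S, I s v}) := by
  classical
  intro U hU hcl
  have hsub : U ⊆ (U ∩ S) ∪ ⋃ s ∈ (Set.toFinite (U ∩ S)).toFinset, {v | I s v} := by
    intro v hv
    rcases hU hv with h | ⟨s, hs, hsv⟩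
    · exact Or.inl ⟨hv, h⟩
    · refine Or.inr ?_
      simp only [Set.mem_iUnion]
      refine ⟨s, ?_, hsv⟩
      -- A neighbour in `U` is reached from a point of `S` equal or adjacent to it, so closedness
      -- puts that point in `U` as well; all of `U` is charged to `U ∩ S`.
      have : s ∈ U := by
        rcases hI s v hsv with rfl | h
        · exact hv
        · exact hcl v hv s (Or.inl hs) h.symm
      simp [this, hs]
  refine (Set.ncard_le_ncard hsub (Set.toFinite _)).trans ?_
  refine (Set.ncard_union_le _ _).trans ?_
  have h2 : (⋃ s ∈ (Set.toFinite (U ∩ S)).toFinset, {v | I s v}).ncard ≤ (U ∩ S).ncard * w := by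
    refine (Finset.set_ncard_biUnion_le _ _).trans ?_
    refine (Finset.sum_le_card_nsmul _ _ w (fun s _ => hw s)).trans ?_
    rw [Set.ncard_eq_toFinset_card _ (Set.toFinite _), smul_eq_mul]
  linarith [h2]

/-- A closed part of the union cuts out a closed part of each `R`. Disjointness ensures that no
point of the dominating set is charged twice. -/
theorem Dominated.union {K : ℕ} {S₁ S₂ R₁ R₂ : Set V} (h₁ : Dominated G K S₁ R₁)
    (h₂ : Dominated G K S₂ R₂) (hS : Disjoint S₁ S₂) :
    Dominated G K (S₁ ∪ S₂) (R₁ ∪ R₂) := by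
  intro U hU hcl
  have a := h₁ (U ∩ R₁) Set.inter_subset_right
    (fun u hu v hv huv => ⟨hcl u hu.1 v (Or.inl hv) huv, hv⟩)
  have b := h₂ (U ∩ R₂) Set.inter_subset_right
    (fun u hu v hv huv => ⟨hcl u hu.1 v (Or.inr hv) huv, hv⟩)
  have c : U.ncard ≤ (U ∩ R₁).ncard + (U ∩ R₂).ncard := by
    refine (Set.ncard_le_ncard ?_ (Set.toFinite _)).trans (Set.ncard_union_le _ _)
    intro x hx
    exact (hU hx).imp (fun h => ⟨hx, h⟩) (fun h => ⟨hx, h⟩)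
  have d : (U ∩ R₁ ∩ S₁).ncard + (U ∩ R₂ ∩ S₂).ncard ≤ (U ∩ (S₁ ∪ S₂)).ncard := by
    rw [← Set.ncard_union_eq (hS.mono Set.inter_subset_right Set.inter_subset_right)
      (Set.toFinite _) (Set.toFinite _)]
    refine Set.ncard_le_ncard ?_ (Set.toFinite _)
    rintro x (hx | hx)
    · exact ⟨hx.1.1, Or.inl hx.2⟩
    · exact ⟨hx.1.1, Or.inr hx.2⟩
  nlinarith [Nat.mul_le_mul_left K d]

end Graph

/-! ### Supports of binary vectors as vertex sets -/

/-- The locations of the nonzero entries of a vector. -/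
def suppAt {α V : Type*} (p : α → V) (e : α → ZMod 2) : Set V := p '' {c | e c ≠ 0}

theorem mem_suppAt {α V : Type*} {p : α → V} {e : α → ZMod 2} {v : V} :
    v ∈ suppAt p e ↔ ∃ c, e c ≠ 0 ∧ p c = v := Iff.rfl

theorem mem_suppAt_apply {α V : Type*} {p : α → V} (hp : Function.Injective p) {e : α → ZMod 2}
    {c : α} : p c ∈ suppAt p e ↔ e c ≠ 0 := by
  rw [mem_suppAt]
  exact ⟨fun ⟨c', h, h'⟩ => hp h' ▸ h, fun h => ⟨c, h, rfl⟩⟩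

theorem suppAt_add {α V : Type*} (p : α → V) (e f : α → ZMod 2) :
    suppAt p (e + f) ⊆ suppAt p e ∪ suppAt p f := by
  rintro v ⟨c, hc, rfl⟩
  by_cases h : e c = 0
  · refine Or.inr ⟨c, fun h' => hc ?_, rfl⟩
    simp [h, h']
  · exact Or.inl ⟨c, h, rfl⟩

theorem suppAt_zero {α V : Type*} (p : α → V) : suppAt p 0 = ∅ := by
  simp [suppAt]

theorem ncard_suppAt {α V : Type*} [Fintype α] {p : α → V} (hp : Function.Injective p)
    (e : α → ZMod 2) : (suppAt p e).ncard = hammingNorm e := by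
  rw [suppAt, Set.ncard_image_of_injective _ hp, hammingNorm, Set.ncard_eq_toFinset_card']
  congr 1
  ext c
  simp

/-! ### Clusters, residual errors and the decoder -/

section Flip

variable {V : Type*} [Finite V] {G : SimpleGraph V} {α β : Type*} [Fintype α] [Fintype β]

/-- Small errors can be reduced, either in weight by a stabilizer or in syndrome weight by a flip,
inside a clique of bounded size. -/
def FlipProperty (G : SimpleGraph V) (p : α → V) (q : β → V) (H : Matrix β α (ZMod 2))
    (L : Submodule (ZMod 2) (α → ZMod 2)) (m w : ℕ) : Prop :=
  ∀ e : α → ZMod 2, e ≠ 0 → hammingNorm e ≤ m → ∃ P : Set V, P.ncard ≤ w ∧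
    (∀ u ∈ P, ∀ v ∈ P, u ≠ v → G.Adj u v) ∧
    ((∃ b ∈ L, suppAt p b ⊆ P ∧ hammingNorm (e + b) < hammingNorm e) ∨
     (∃ a, suppAt p a ⊆ P ∧ suppAt q (H *ᵥ a) ⊆ P ∧
        hammingNorm (H *ᵥ (e + a)) < hammingNorm (H *ᵥ e)))

theorem connected_of_clique {P : Set V} (hP : P.Nonempty)
    (h : ∀ u ∈ P, ∀ v ∈ P, u ≠ v → G.Adj u v) : (G.induce P).Connected := by
  rw [SimpleGraph.connected_iff]
  refine ⟨?_, hP.to_subtype⟩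
  rintro ⟨u, hu⟩ ⟨v, hv⟩
  by_cases huv : u = v
  · subst huv; exact SimpleGraph.Reachable.refl _
  · exact SimpleGraph.Adj.reachable (G := G.induce P) (by simpa using h u hu v hv huv)

theorem hammingNorm_add_le' (e a : α → ZMod 2) :
    hammingNorm (e + a) ≤ hammingNorm e + hammingNorm a := by
  have h := suppAt_add (id : α → α) e a
  rw [← ncard_suppAt Function.injective_id, ← ncard_suppAt Function.injective_id,
    ← ncard_suppAt Function.injective_id]
  exact (Set.ncard_le_ncard h (Set.toFinite _)).trans (Set.ncard_union_le _ _)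

theorem add_self_zmod {ι : Type*} (e : ι → ZMod 2) : e + e = 0 := by
  funext c
  exact CharTwo.add_self_eq_zero _

/-- Lowering the syndrome inside a set keeps the syndrome outside unchanged. -/
theorem ncard_inter_lt {S S₁ U P : Set V} (hlt : S₁.ncard < S.ncard) (hPU : P ⊆ U)
    (hout : ∀ v ∉ P, v ∈ S₁ ↔ v ∈ S) : (U ∩ S₁).ncard < (U ∩ S).ncard := by
  have h1 := Set.ncard_inter_add_ncard_sdiff_eq_ncard S₁ U (Set.toFinite _)
  have h2 := Set.ncard_inter_add_ncard_sdiff_eq_ncard S U (Set.toFinite _)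
  have h3 : S₁ \ U = S \ U := by
    ext v
    simp only [Set.mem_sdiff]
    exact and_congr_left fun hv => hout v (fun h => hv (hPU h))
  rw [h3] at h1
  rw [Set.inter_comm U, Set.inter_comm U]
  omega

/-- Repeated flips terminate because `|e| + (w + 1) |He|` drops: a stabilizer flip lowers `|e|`, and
a syndrome flip lowers `|He|` while raising `|e|` by at most `w`. The last hypothesis is a budget
with the same mechanism: each flip enlarges `W` by at most `w`, and `w |e| + (w + w²) |He|` drops by
at least that much. So `W` never exceeds `B`, and `hB` keeps the error within reach of the decoder.
`R` collects the cliques of the syndrome flips; stabilizer flips are absorbed in `L`. -/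
theorem exists_reduced_of_cluster {p : α → V} {q : β → V} (hp : Function.Injective p)
    (hq : Function.Injective q) {H : Matrix β α (ZMod 2)}
    {L : Submodule (ZMod 2) (α → ZMod 2)} (hL : ∀ b ∈ L, H *ᵥ b = 0) {m w B : ℕ}
    (hflip : FlipProperty G p q H L m w) {A : Set V}
    (hB : ∀ W : Set V, (G.induce W).Connected → A ⊆ W → W.ncard ≤ B → W.ncard ≤ m) :
    ∀ (n : ℕ) (e : α → ZMod 2) (W : Set V),
      hammingNorm e + (w + 1) * hammingNorm (H *ᵥ e) ≤ n →
      (G.induce W).Connected → A ⊆ W → suppAt p e ⊆ W → suppAt q (H *ᵥ e) ⊆ W →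
      W.ncard + w * hammingNorm e + (w + w ^ 2) * hammingNorm (H *ᵥ e) ≤ B →
      ∃ ρ, e + ρ ∈ L ∧ ∃ R, suppAt p ρ ⊆ R ∧ Dominated G (w + 1) (suppAt q (H *ᵥ e)) R := by
  intro n
  induction n with
  | zero =>
    intro e W hn _ _ _ _ _
    have : e = 0 := by
      rw [← hammingNorm_eq_zero]; omega
    subst this
    refine ⟨0, by simp, ∅, by simp [suppAt_zero], ?_⟩
    intro U hU _
    simp [Set.subset_empty_iff.mp hU]
  | succ n ih =>
    intro e W hn hW hAW heW hsW hBW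
    by_cases he : e = 0
    · subst he
      refine ⟨0, by simp, ∅, by simp [suppAt_zero], ?_⟩
      intro U hU _
      simp [Set.subset_empty_iff.mp hU]
    have hWm := hB W hW hAW (by omega)
    have hem : hammingNorm e ≤ m := by
      rw [← ncard_suppAt hp]
      exact (Set.ncard_le_ncard heW (Set.toFinite _)).trans hWm
    obtain ⟨P, hPw, hPc, ⟨b, hbL, hbP, hlt⟩ | ⟨a, haP, hsP, hlt⟩⟩ := hflip e he hem
    · have hHb : H *ᵥ (e + b) = H *ᵥ e := by rw [Matrix.mulVec_add, hL b hbL, add_zero]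
      -- A flip away from `W` could only add to the support and never lower the weight. So the
      -- clique touches `W`, and the union stays connected.
      have hmeet : (W ∩ P).Nonempty := by
        by_contra hne
        rw [Set.not_nonempty_iff_eq_empty] at hne
        have hsub : suppAt p e ⊆ suppAt p (e + b) := by
          rintro v ⟨c, hc, rfl⟩
          refine ⟨c, ?_, rfl⟩
          have : b c = 0 := by
            by_contra hb
            have : p c ∈ W ∩ P := ⟨heW ⟨c, hc, rfl⟩, hbP ⟨c, hb, rfl⟩⟩
            rw [hne] at this
            exact this
          simpa [this] using hc
        have := Set.ncard_le_ncard hsub (Set.toFinite _)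
        rw [ncard_suppAt hp, ncard_suppAt hp] at this
        omega
      have hconn : (G.induce (W ∪ P)).Connected :=
        SimpleGraph.induce_union_connected hW.preconnected
          (connected_of_clique (hmeet.mono Set.inter_subset_right) hPc).preconnected hmeet
      have hcard := Set.ncard_union_le W P
      obtain ⟨ρ, hρ, R, hR, hd⟩ := ih (e + b) (W ∪ P) (by rw [hHb]; omega) hconn
        (hAW.trans Set.subset_union_left)
        ((suppAt_add p e b).trans (Set.union_subset_union heW hbP))
        (by rw [hHb]; exact hsW.trans Set.subset_union_left)
        (by
          rw [hHb]
          have : w * (hammingNorm (e + b) + 1) ≤ w * hammingNorm e := Nat.mul_le_mul_left _ hlt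
          have h' : w * (hammingNorm (e + b) + 1) = w * hammingNorm (e + b) + w := by ring
          omega)
      rw [hHb] at hd
      refine ⟨ρ, ?_, R, hR, hd⟩
      have h2 := L.add_mem hρ hbL
      have : e + b + ρ + b = e + ρ + (b + b) := by abel
      rwa [this, add_self_zmod, add_zero] at h2
    · have hHa : H *ᵥ (e + a) = H *ᵥ e + H *ᵥ a := Matrix.mulVec_add _ _ _
      have hout : ∀ v ∉ P, v ∈ suppAt q (H *ᵥ (e + a)) ↔ v ∈ suppAt q (H *ᵥ e) := by
        intro v hv
        rw [mem_suppAt, mem_suppAt]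
        refine exists_congr fun d => and_congr_left ?_
        rintro rfl
        have : (H *ᵥ a) d = 0 := by
          by_contra h
          exact hv (hsP ⟨d, h, rfl⟩)
        rw [hHa, Pi.add_apply, this, add_zero]
      have hlt' : (suppAt q (H *ᵥ (e + a))).ncard < (suppAt q (H *ᵥ e)).ncard := by
        rwa [ncard_suppAt hq, ncard_suppAt hq]
      have hmeet : (W ∩ P).Nonempty := by
        by_contra hne
        rw [Set.not_nonempty_iff_eq_empty] at hne
        have hsub : suppAt q (H *ᵥ e) ⊆ suppAt q (H *ᵥ (e + a)) := by
          intro v hv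
          refine (hout v fun hvP => ?_).mpr hv
          have : v ∈ W ∩ P := ⟨hsW hv, hvP⟩
          rw [hne] at this
          exact this
        have := Set.ncard_le_ncard hsub (Set.toFinite _)
        omega
      have hPne : P.Nonempty := hmeet.mono Set.inter_subset_right
      have hconn : (G.induce (W ∪ P)).Connected :=
        SimpleGraph.induce_union_connected hW.preconnected
          (connected_of_clique hPne hPc).preconnected hmeet
      have hcard := Set.ncard_union_le W P
      have haw : hammingNorm a ≤ w := by
        rw [← ncard_suppAt hp]
        exact (Set.ncard_le_ncard haP (Set.toFinite _)).trans hPw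
      have hea := hammingNorm_add_le' e a
      have hs1 : suppAt q (H *ᵥ (e + a)) ⊆ W ∪ P := by
        intro v hv
        by_cases hvP : v ∈ P
        · exact Or.inr hvP
        · exact Or.inl (hsW ((hout v hvP).mp hv))
      obtain ⟨ρ, hρ, R, hR, hd⟩ := ih (e + a) (W ∪ P)
        (by
          have : (w + 1) * (hammingNorm (H *ᵥ (e + a)) + 1) ≤ (w + 1) * hammingNorm (H *ᵥ e) :=
            Nat.mul_le_mul_left _ hlt
          have h' : (w + 1) * (hammingNorm (H *ᵥ (e + a)) + 1)
            = (w + 1) * hammingNorm (H *ᵥ (e + a)) + w + 1 := by ring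
          omega) hconn
        (hAW.trans Set.subset_union_left)
        ((suppAt_add p e a).trans (Set.union_subset_union heW haP)) hs1
        (by
          have h1 : (w + w ^ 2) * (hammingNorm (H *ᵥ (e + a)) + 1)
              ≤ (w + w ^ 2) * hammingNorm (H *ᵥ e) := Nat.mul_le_mul_left _ hlt
          have h2 : w * hammingNorm (e + a) ≤ w * (hammingNorm e + w) :=
            Nat.mul_le_mul_left _ (by omega)
          nlinarith)
      refine ⟨ρ + a, ?_, R ∪ P, ?_, ?_⟩
      · have : e + (ρ + a) = e + a + ρ := by abel
        rwa [this]
      · exact (suppAt_add p ρ a).trans (Set.union_subset_union hR haP)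
      · intro U hU hcl
        have hd' := hd (U ∩ R) Set.inter_subset_right
          (fun u hu v hv huv => ⟨hcl u hu.1 v (Or.inl hv) huv, hv⟩)
        have hle : U.ncard ≤ (U ∩ R).ncard + (U ∩ P).ncard := by
          refine (Set.ncard_le_ncard ?_ (Set.toFinite _)).trans (Set.ncard_union_le _ _)
          intro x hx
          exact (hU hx).imp (fun h => ⟨hx, h⟩) (fun h => ⟨hx, h⟩)
        have hle2 : (U ∩ R ∩ suppAt q (H *ᵥ (e + a))).ncard
            ≤ (U ∩ suppAt q (H *ᵥ (e + a))).ncard :=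
          Set.ncard_le_ncard (fun x hx => ⟨hx.1.1, hx.2⟩) (Set.toFinite _)
        have hle2' := Nat.mul_le_mul_left (w + 1) hle2
        -- A closed set meeting the clique contains all of it. It then gains at most `w` points
        -- while the syndrome inside it strictly drops, which fits the ratio `w + 1`. A closed set
        -- missing the clique sees no change of syndrome.
        by_cases hUP : (U ∩ P).Nonempty
        · have hPU : P ⊆ U := by
            obtain ⟨x, hxU, hxP⟩ := hUP
            intro y hy
            by_cases hxy : x = y
            · exact hxy ▸ hxU
            · exact hcl x hxU y (Or.inr hy) (hPc x hxP y hy hxy)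
          have h1 := ncard_inter_lt hlt' hPU hout
          have h2 : (U ∩ P).ncard ≤ w :=
            (Set.ncard_le_ncard Set.inter_subset_right (Set.toFinite _)).trans hPw
          have h3 := Nat.mul_le_mul_left (w + 1) (Nat.succ_le_of_lt h1)
          have h4 : (w + 1) * (U ∩ suppAt q (H *ᵥ (e + a))).ncard.succ
            = (w + 1) * (U ∩ suppAt q (H *ᵥ (e + a))).ncard + w + 1 := by
            rw [Nat.succ_eq_add_one]; ring
          omega
        · rw [Set.not_nonempty_iff_eq_empty] at hUP
          rw [hUP, Set.ncard_empty] at hle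
          have : U ∩ suppAt q (H *ᵥ (e + a)) = U ∩ suppAt q (H *ᵥ e) := by
            ext x
            simp only [Set.mem_inter_iff]
            refine and_congr_right fun hxU => hout x fun hxP => ?_
            have : x ∈ U ∩ P := ⟨hxU, hxP⟩
            rw [hUP] at this
            exact this
          rw [← this]
          omega

/-- Decomposition of an avoiding error into clusters: it is equivalent to an error dominated by
its syndrome. -/
theorem exists_reduced {p : α → V} {q : β → V} (hp : Function.Injective p)
    (hq : Function.Injective q) {H : Matrix β α (ZMod 2)}
    (hadj : ∀ d c, H d c ≠ 0 → G.Adj (q d) (p c))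
    {L : Submodule (ZMod 2) (α → ZMod 2)} (hL : ∀ b ∈ L, H *ᵥ b = 0) {m w : ℕ}
    (hw : ∀ c, {d | H d c ≠ 0}.ncard ≤ w)
    (hflip : FlipProperty G p q H L m w) {η γ : ℝ} (hη : η ≤ m)
    (hγ : γ * (1 + 2 * w + w ^ 2 + w ^ 3) ≤ 1) :
    ∀ (n : ℕ) (e : α → ZMod 2), hammingNorm e ≤ n →
      IsAvoiding (graphBadSets G η γ) (suppAt p e) →
      ∃ ρ, e + ρ ∈ L ∧ ∃ R, suppAt p ρ ⊆ R ∧ Dominated G (w + 1) (suppAt q (H *ᵥ e)) R := by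
  classical
  intro n
  induction n with
  | zero =>
    intro e hn _
    have : e = 0 := by
      rw [← hammingNorm_eq_zero]; omega
    subst this
    refine ⟨0, by simp, ∅, by simp [suppAt_zero], ?_⟩
    intro U hU _
    simp [Set.subset_empty_iff.mp hU]
  | succ n ih =>
    intro e hn hav
    by_cases he : e = 0
    · subst he
      refine ⟨0, by simp, ∅, by simp [suppAt_zero], ?_⟩
      intro U hU _
      simp [Set.subset_empty_iff.mp hU]
    obtain ⟨c₀, hc₀⟩ : ∃ c, e c ≠ 0 := by
      by_contra h
      push Not at h
      exact he (funext h)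
    -- The cluster of `c₀` is taken in the support together with all checks touching it, including
    -- checks with zero syndrome. Two parts of the error that share a check thus lie in one cluster,
    -- and different clusters have disjoint syndromes.
    set N : Set V := q '' {d | ∃ c, e c ≠ 0 ∧ H d c ≠ 0} with hN
    obtain ⟨W, hcW, hWA, hWc, hcl⟩ := exists_connected_closed (G := G) (W := {p c₀})
      (A := suppAt p e ∪ N)
      (connected_of_clique (by simp) (by rintro u rfl v rfl h; exact absurd rfl h))
      (by rintro _ rfl; exact Or.inl ⟨c₀, hc₀, rfl⟩)
    set e₁ : α → ZMod 2 := fun c => if p c ∈ W then e c else 0 with he₁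
    set e₂ : α → ZMod 2 := fun c => if p c ∈ W then 0 else e c with he₂
    have hsplit : e = e₁ + e₂ := by
      funext c
      by_cases h : p c ∈ W <;> simp [he₁, he₂, h]
    have hs₁ : suppAt p e₁ = suppAt p e ∩ W := by
      ext v
      simp only [mem_suppAt, Set.mem_inter_iff]
      constructor
      · rintro ⟨c, hc, rfl⟩
        by_cases h : p c ∈ W
        · exact ⟨⟨c, by simpa [he₁, h] using hc, rfl⟩, h⟩
        · simp [he₁, h] at hc
      · rintro ⟨⟨c, hc, rfl⟩, h⟩
        exact ⟨c, by simpa [he₁, h] using hc, rfl⟩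
    have hs₂ : suppAt p e₂ = suppAt p e \ W := by
      ext v
      simp only [mem_suppAt, Set.mem_sdiff]
      constructor
      · rintro ⟨c, hc, rfl⟩
        by_cases h : p c ∈ W
        · simp [he₂, h] at hc
        · exact ⟨⟨c, by simpa [he₂, h] using hc, rfl⟩, h⟩
      · rintro ⟨⟨c, hc, rfl⟩, h⟩
        exact ⟨c, by simpa [he₂, h] using hc, rfl⟩
    have hne : ∀ (f : α → ZMod 2) d, (H *ᵥ f) d ≠ 0 → ∃ c, f c ≠ 0 ∧ H d c ≠ 0 := by
      intro f d hd
      by_contra h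
      push Not at h
      refine hd (Finset.sum_eq_zero fun c _ => ?_)
      by_cases hf : f c = 0
      · simp [hf]
      · simp [h c hf]
    have hq₁ : suppAt q (H *ᵥ e₁) ⊆ W := by
      rintro _ ⟨d, hd, rfl⟩
      obtain ⟨c, hc, hdc⟩ := hne _ _ hd
      have h1 : p c ∈ suppAt p e ∩ W := hs₁ ▸ (mem_suppAt_apply hp).mpr hc
      exact hcl _ h1.2 _ (Or.inr ⟨d, ⟨c, (mem_suppAt_apply hp).mp h1.1, hdc⟩, rfl⟩)
        (hadj d c hdc).symm
    have hq₂ : Disjoint (suppAt q (H *ᵥ e₁)) (suppAt q (H *ᵥ e₂)) := by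
      rw [Set.disjoint_left]
      rintro _ h1 ⟨d, hd, rfl⟩
      obtain ⟨c, hc, hdc⟩ := hne _ _ hd
      have h2 : p c ∈ suppAt p e \ W := hs₂ ▸ (mem_suppAt_apply hp).mpr hc
      exact h2.2 (hcl _ (hq₁ h1) _ (Or.inl h2.1) (hadj d c hdc))
    have hqe : suppAt q (H *ᵥ e) = suppAt q (H *ᵥ e₁) ∪ suppAt q (H *ᵥ e₂) := by
      ext v
      constructor
      · intro hv
        rw [hsplit, Matrix.mulVec_add] at hv
        exact suppAt_add q _ _ hv
      · rintro (⟨d, hd, rfl⟩ | ⟨d, hd, rfl⟩)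
        · refine ⟨d, ?_, rfl⟩
          have : (H *ᵥ e₂) d = 0 := by
            by_contra h
            exact Set.disjoint_left.mp hq₂ ⟨d, hd, rfl⟩ ⟨d, h, rfl⟩
          change (H *ᵥ e) d ≠ 0
          rwa [hsplit, Matrix.mulVec_add, Pi.add_apply, this, add_zero]
        · refine ⟨d, ?_, rfl⟩
          have : (H *ᵥ e₁) d = 0 := by
            by_contra h
            exact Set.disjoint_left.mp hq₂ ⟨d, h, rfl⟩ ⟨d, hd, rfl⟩
          change (H *ᵥ e) d ≠ 0
          rwa [hsplit, Matrix.mulVec_add, Pi.add_apply, this, zero_add]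
    have hc₀W : p c₀ ∈ W := hcW rfl
    have hcount : ∀ f : α → ZMod 2, {d | ∃ c, f c ≠ 0 ∧ H d c ≠ 0}.ncard ≤ w * hammingNorm f := by
      intro f
      have hsub : {d | ∃ c, f c ≠ 0 ∧ H d c ≠ 0}
          ⊆ ⋃ c ∈ Finset.univ.filter (fun c => f c ≠ 0), {d | H d c ≠ 0} := by
        rintro d ⟨c, hc, hdc⟩
        simp only [Set.mem_iUnion]
        exact ⟨c, by simpa using hc, hdc⟩
      refine (Set.ncard_le_ncard hsub (Set.toFinite _)).trans ?_
      refine (Finset.set_ncard_biUnion_le _ _).trans ?_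
      refine (Finset.sum_le_card_nsmul _ _ w (fun c _ => hw c)).trans ?_
      rw [smul_eq_mul, mul_comm]
      rfl
    have hWcard : W.ncard ≤ hammingNorm e₁ + w * hammingNorm e₁ := by
      have hsub : W ⊆ suppAt p e₁ ∪ q '' {d | ∃ c, e₁ c ≠ 0 ∧ H d c ≠ 0} := by
        intro v hv
        rcases hWA hv with h | ⟨d, ⟨c, hc, hdc⟩, rfl⟩
        · exact Or.inl (hs₁ ▸ ⟨h, hv⟩)
        · have h1 : p c ∈ W := hcl _ hv _ (Or.inl ⟨c, hc, rfl⟩) (hadj d c hdc)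
          exact Or.inr ⟨d, ⟨c, by simpa [he₁, h1] using hc, hdc⟩, rfl⟩
      refine (Set.ncard_le_ncard hsub (Set.toFinite _)).trans ?_
      refine (Set.ncard_union_le _ _).trans ?_
      rw [ncard_suppAt hp, Set.ncard_image_of_injective _ hq]
      exact Nat.add_le_add_left (hcount e₁) _
    have hHe₁ : hammingNorm (H *ᵥ e₁) ≤ w * hammingNorm e₁ := by
      rw [← ncard_suppAt hq]
      refine le_trans ?_ (hcount e₁)
      rw [← Set.ncard_image_of_injective {d | ∃ c, e₁ c ≠ 0 ∧ H d c ≠ 0} hq]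
      refine Set.ncard_le_ncard ?_ (Set.toFinite _)
      rintro _ ⟨d, hd, rfl⟩
      exact ⟨d, hne _ _ hd, rfl⟩
    set k := hammingNorm e₁ with hk
    have hkpos : 0 < k := by
      rw [hk, hammingNorm_pos_iff]
      intro h
      have := congrFun h c₀
      simp [he₁, hc₀W, hc₀] at this
    have hav' := isAvoiding_graphBadSets_iff.mp hav
    -- For a cluster with error weight `k`, the starting budget is at most `(k + wk) + wk + (w +
    -- w²)wk`, which is `B`. A connected set of size at most `B` containing the `k` errors, but
    -- larger than `m ≥ η`, would contain fewer than `γB ≤ k` of them, which is absurd.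
    obtain ⟨ρ₁, hρ₁, R₁, hR₁, hd₁⟩ := exists_reduced_of_cluster (G := G) (p := p) (q := q) hp hq hL
      (B := (1 + 2 * w + w ^ 2 + w ^ 3) * k) hflip
      (A := suppAt p e₁)
      (by
        intro W' hW' hA hB
        have hkW : k ≤ (suppAt p e ∩ W').ncard := by
          rw [hk, ← ncard_suppAt hp]
          refine Set.ncard_le_ncard ?_ (Set.toFinite _)
          intro v hv
          exact ⟨(hs₁ ▸ hv : v ∈ suppAt p e ∩ W).1, hA hv⟩
        by_contra hlt
        push Not at hlt
        have h1 := hav' W' hW' (by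
          have : (m : ℝ) ≤ W'.ncard := by exact_mod_cast hlt.le
          linarith)
        have h2 : (k : ℝ) ≤ ((suppAt p e ∩ W').ncard : ℝ) := by exact_mod_cast hkW
        have h3 : (W'.ncard : ℝ) ≤ (1 + 2 * w + w ^ 2 + w ^ 3) * k := by exact_mod_cast hB
        have h5 : (0 : ℝ) < k := by exact_mod_cast hkpos
        have h4 : 0 ≤ γ := by
          by_contra h
          push Not at h
          have : γ * (W'.ncard : ℝ) ≤ 0 := mul_nonpos_of_nonpos_of_nonneg h.le (by positivity)
          linarith
        have h6 : γ * W'.ncard ≤ γ * ((1 + 2 * w + w ^ 2 + w ^ 3) * k) :=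
          mul_le_mul_of_nonneg_left h3 h4
        have h7 : γ * (1 + 2 * w + w ^ 2 + w ^ 3) * k ≤ 1 * k :=
          mul_le_mul_of_nonneg_right hγ h5.le
        linarith)
      _ e₁ W le_rfl hWc (by rw [hs₁]; exact Set.inter_subset_right)
      (by rw [hs₁]; exact Set.inter_subset_right) hq₁
      (by
        have h1 : (w + w ^ 2) * hammingNorm (H *ᵥ e₁) ≤ (w + w ^ 2) * (w * k) :=
          Nat.mul_le_mul_left _ hHe₁
        nlinarith)
    have hlt₂ : hammingNorm e₂ ≤ n := by
      have : hammingNorm e₂ < hammingNorm e := by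
        rw [← ncard_suppAt hp, ← ncard_suppAt hp, hs₂]
        refine Set.ncard_lt_ncard ⟨Set.sdiff_subset, fun h => ?_⟩ (Set.toFinite _)
        exact (h ((mem_suppAt_apply hp).mpr hc₀)).2 hc₀W
      omega
    obtain ⟨ρ₂, hρ₂, R₂, hR₂, hd₂⟩ := ih e₂ hlt₂ (hav.anti (by rw [hs₂]; exact Set.sdiff_subset))
    refine ⟨ρ₁ + ρ₂, ?_, R₁ ∪ R₂, ?_, ?_⟩
    · have : e + (ρ₁ + ρ₂) = (e₁ + ρ₁) + (e₂ + ρ₂) := by rw [hsplit]; abel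
      rw [this]
      exact L.add_mem hρ₁ hρ₂
    · exact (suppAt_add p _ _).trans (Set.union_subset_union hR₁ hR₂)
    · rw [hqe]
      exact hd₁.union hd₂ hq₂

/-- A decoder that corrects avoiding errors up to a residual controlled by the measurement
errors. -/
theorem exists_decoder {p : α → V} {q : β → V} (hp : Function.Injective p)
    (hq : Function.Injective q) {H : Matrix β α (ZMod 2)}
    (hadj : ∀ d c, H d c ≠ 0 → G.Adj (q d) (p c))
    {L : Submodule (ZMod 2) (α → ZMod 2)} (hL : ∀ b ∈ L, H *ᵥ b = 0) {m w : ℕ}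
    (hw : ∀ c, {d | H d c ≠ 0}.ncard ≤ w)
    (hflip : FlipProperty G p q H L m w) {ηin γin η γ : ℝ} (hη : ηin ≤ m)
    (hγin : (γin + γin) * (1 + 2 * w + w ^ 2 + w ^ 3) ≤ 1) (hγ : 0 < γ) :
    ∃ dec : (β → ZMod 2) → (α → ZMod 2), ∀ e f,
      IsAvoiding (graphBadSets G ηin γin) (suppAt p e) →
      IsAvoiding (graphBadSets G η γ) (suppAt q f) →
      ∃ ρ, e + dec (H *ᵥ e + f) + ρ ∈ L ∧
        IsAvoiding (graphBadSets G η (4 * (w + 1) * γ)) (suppAt p ρ) := by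
  classical
  -- The decoder returns an arbitrary admissible explanation of the noisy syndrome; the true error
  -- is one, so the choice is nonvacuous.
  let ok : (β → ZMod 2) → (α → ZMod 2) → Prop := fun s e =>
    ∃ f, s = H *ᵥ e + f ∧ IsAvoiding (graphBadSets G ηin γin) (suppAt p e) ∧
      IsAvoiding (graphBadSets G η γ) (suppAt q f)
  refine ⟨fun s => if h : ∃ e, ok s e then h.choose else 0, fun e f he hf => ?_⟩
  have hex : ∃ e', ok (H *ᵥ e + f) e' := ⟨e, f, rfl, he, hf⟩
  simp only [hex, dif_pos]
  obtain ⟨f', hs, he', hf'⟩ := hex.choose_spec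
  set e' := hex.choose
  -- Two explanations of the same data differ by an error whose true syndrome is the sum of the two
  -- measurement errors. This accounts for a factor 2 in the density, besides the `2(w + 1)` from
  -- domination.
  have hsyn : H *ᵥ (e + e') = f + f' := by
    rw [Matrix.mulVec_add]
    have : H *ᵥ e + f + (H *ᵥ e' + f) = H *ᵥ e' + f' + (H *ᵥ e' + f) := by rw [hs]
    calc H *ᵥ e + H *ᵥ e' = H *ᵥ e + f + (H *ᵥ e' + f) + (f + f) := by
          rw [add_self_zmod, add_zero]
          calc _ = H *ᵥ e + H *ᵥ e' + (f + f) := by rw [add_self_zmod, add_zero]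
            _ = _ := by abel
      _ = (H *ᵥ e' + H *ᵥ e') + (f + f) + (f + f') := by rw [this]; abel
      _ = f + f' := by rw [add_self_zmod, add_self_zmod, add_zero, zero_add]
  obtain ⟨ρ, hρ, R, hR, hd⟩ := exists_reduced hp hq hadj hL hw hflip hη hγin _ (e + e') le_rfl
    ((he.union he').anti (suppAt_add p _ _))
  refine ⟨ρ, hρ, IsAvoiding.anti ?_ hR⟩
  have h1 : IsAvoiding (graphBadSets G η (γ + γ)) (suppAt q (H *ᵥ (e + e'))) := by
    rw [hsyn]
    exact (hf.union hf').anti (suppAt_add q _ _)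
  have h2 := h1.of_dominated (by linarith) (Nat.le_add_left 1 w) hd
  refine h2.mono (le_of_eq ?_)
  push_cast
  ring

end Flip

/-! ### Signs, Weyl operators and sandwiches -/

/-- The character of `ZMod 2`. -/
def sgn (s : ZMod 2) : ℂ := if s = 0 then 1 else -1

theorem zmod2_cases (s : ZMod 2) : s = 0 ∨ s = 1 := by revert s; decide

@[simp] theorem sgn_zero : sgn 0 = 1 := by simp [sgn]

@[simp] theorem sgn_one : sgn 1 = -1 := by simp [sgn]

theorem sgn_add (s t : ZMod 2) : sgn (s + t) = sgn s * sgn t := by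
  have h : (1 : ZMod 2) + 1 = 0 := by decide
  rcases zmod2_cases s with rfl | rfl <;> rcases zmod2_cases t with rfl | rfl <;> simp [h]

theorem sgn_mul_self (s : ZMod 2) : sgn s * sgn s = 1 := by
  rcases zmod2_cases s with rfl | rfl <;> simp

section Weyl

variable {q : Type*} [Fintype q] {Λ : Type*}

/-- The action of `X^a Z^b` on the rows of a matrix. -/
def weylAct (a b : q → ZMod 2) (A : Matrix (q → ZMod 2) Λ ℂ) : Matrix (q → ZMod 2) Λ ℂ :=
  fun u x => sgn (b ⬝ᵥ (u + a)) * A (u + a) x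

theorem weylAct_zero (A : Matrix (q → ZMod 2) Λ ℂ) : weylAct 0 0 A = A := by
  funext u x
  simp [weylAct]

/-- The sign comes from moving `Z^b` past `X^{a'}`. -/
theorem weylAct_weylAct (a b a' b' : q → ZMod 2) (A : Matrix (q → ZMod 2) Λ ℂ) :
    weylAct a b (weylAct a' b' A) = sgn (b ⬝ᵥ a') • weylAct (a + a') (b + b') A := by
  funext u x
  simp only [weylAct, Matrix.smul_apply, smul_eq_mul]
  rw [← add_assoc, add_dotProduct, sgn_add, dotProduct_add b (u + a) a', sgn_add]
  linear_combination (sgn (b ⬝ᵥ (u + a)) * sgn (b' ⬝ᵥ (u + a + a')) * A (u + a + a') x) *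
    (-sgn_mul_self (b ⬝ᵥ a'))

theorem weylAct_smul (a b : q → ZMod 2) (c : ℂ) (A : Matrix (q → ZMod 2) Λ ℂ) :
    weylAct a b (c • A) = c • weylAct a b A := by
  funext u x
  simp only [weylAct, Matrix.smul_apply, smul_eq_mul]
  ring

/-- The exponent of `X` in a Pauli operator. -/
def Pauli.xBit : Pauli → ZMod 2
  | .I => 0
  | .X => 1
  | .Y => 1
  | .Z => 0

/-- The exponent of `Z` in a Pauli operator. -/
def Pauli.zBit : Pauli → ZMod 2
  | .I => 0
  | .X => 0
  | .Y => 1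
  | .Z => 1

/-- The phase of a Pauli operator relative to `X^a Z^b`. -/
def Pauli.phase : Pauli → ℂ
  | .Y => Complex.I
  | _ => 1

/-- The Pauli operator with given exponents. -/
def Pauli.ofBits (a b : ZMod 2) : Pauli :=
  if a = 0 then (if b = 0 then .I else .Z) else (if b = 0 then .X else .Y)

theorem Pauli.xBit_ofBits (a b : ZMod 2) : (Pauli.ofBits a b).xBit = a := by
  rcases zmod2_cases a with rfl | rfl <;> rcases zmod2_cases b with rfl | rfl <;>
    simp [Pauli.ofBits, Pauli.xBit]

theorem Pauli.zBit_ofBits (a b : ZMod 2) : (Pauli.ofBits a b).zBit = b := by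
  rcases zmod2_cases a with rfl | rfl <;> rcases zmod2_cases b with rfl | rfl <;>
    simp [Pauli.ofBits, Pauli.zBit]

theorem Pauli.phase_ne_zero (P : Pauli) : P.phase ≠ 0 := by
  cases P <;> simp [Pauli.phase]

theorem Pauli.mat_zero_zero (P : Pauli) : P.mat 0 0 =
    (match P with | .I => 1 | .X => 0 | .Y => 0 | .Z => 1) := by
  cases P <;> rfl

theorem Pauli.mat_zero_one (P : Pauli) : P.mat 0 1 =
    (match P with | .I => 0 | .X => 1 | .Y => -Complex.I | .Z => 0) := by
  cases P <;> rfl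

theorem Pauli.mat_one_zero (P : Pauli) : P.mat 1 0 =
    (match P with | .I => 0 | .X => 1 | .Y => Complex.I | .Z => 0) := by
  cases P <;> rfl

theorem Pauli.mat_one_one (P : Pauli) : P.mat 1 1 =
    (match P with | .I => 1 | .X => 0 | .Y => 0 | .Z => -1) := by
  cases P <;> rfl

theorem Pauli.mat_apply (P : Pauli) (x y : ZMod 2) :
    P.mat x y = if y = x + P.xBit then P.phase * sgn (P.zBit * y) else 0 := by
  have h : (1 : ZMod 2) + 1 = 0 := by decide
  rcases zmod2_cases x with rfl | rfl <;> rcases zmod2_cases y with rfl | rfl <;> cases P <;>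
    simp [Pauli.xBit, Pauli.zBit, Pauli.phase, h, Pauli.mat_zero_zero, Pauli.mat_zero_one,
      Pauli.mat_one_zero, Pauli.mat_one_one]

theorem Pauli.star_mat (P : Pauli) (x y : ZMod 2) : star (P.mat x y) = P.mat y x := by
  rcases zmod2_cases x with rfl | rfl <;> rcases zmod2_cases y with rfl | rfl <;> cases P <;>
    simp [Pauli.mat_zero_zero, Pauli.mat_zero_one,
      Pauli.mat_one_zero, Pauli.mat_one_one]

theorem pauliMat_conjTranspose (P : q → Pauli) : (pauliMat P)ᴴ = pauliMat P := by
  funext x y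
  simp only [Matrix.conjTranspose_apply, pauliMat, star_prod, Pauli.star_mat]

variable [DecidableEq q]

theorem pauliMat_mul (P : q → Pauli) (A : Matrix (q → ZMod 2) Λ ℂ) :
    pauliMat P * A = (∏ a, (P a).phase) •
      weylAct (fun a => (P a).xBit) (fun a => (P a).zBit) A := by
  funext u x
  rw [Matrix.mul_apply, Finset.sum_eq_single (u + fun a => (P a).xBit)]
  · simp only [pauliMat, Pauli.mat_apply, Pi.add_apply, if_true, Finset.prod_mul_distrib,
      Matrix.smul_apply, weylAct, smul_eq_mul, mul_assoc]
    congr 2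
    have : ∀ s : Finset q, ∀ f : q → ZMod 2, ∏ a ∈ s, sgn (f a) = sgn (∑ a ∈ s, f a) := by
      intro s f
      induction s using Finset.induction_on with
      | empty => simp
      | insert a s ha ih => rw [Finset.prod_insert ha, Finset.sum_insert ha, sgn_add, ih]
    rw [this]
    rfl
  · intro v _ hv
    obtain ⟨a, ha⟩ : ∃ a, v a ≠ (u + fun a => (P a).xBit) a := by
      by_contra h
      push Not at h
      exact hv (funext h)
    have : pauliMat P u v = 0 := by
      refine Finset.prod_eq_zero (Finset.mem_univ a) ?_
      rw [Pauli.mat_apply]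
      exact if_neg ha
    rw [this, zero_mul]
  · simp

end Weyl

section Sandwich

variable {m m' Λ R : Type*} [Fintype m] [Fintype m'] [Fintype Λ] [Fintype R] [DecidableEq R]

/-- `(A ⊗ 1) ρ (B ⊗ 1)†`. -/
def sandwich (A B : Matrix m Λ ℂ) (ρ : Matrix (Λ × R) (Λ × R) ℂ) : Matrix (m × R) (m × R) ℂ :=
  (A ⊗ₖ (1 : Matrix R R ℂ)) * ρ * (B ⊗ₖ (1 : Matrix R R ℂ))ᴴ

theorem sandwich_smul (c d : ℂ) (A B : Matrix m Λ ℂ) (ρ : Matrix (Λ × R) (Λ × R) ℂ) :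
    sandwich (c • A) (d • B) ρ = (c * star d) • sandwich A B ρ := by
  simp only [sandwich, Matrix.smul_kronecker, Matrix.conjTranspose_smul, Matrix.smul_mul,
    Matrix.mul_smul, smul_smul, mul_comm]

theorem sandwich_zero_left (B : Matrix m Λ ℂ) (ρ : Matrix (Λ × R) (Λ × R) ℂ) :
    sandwich 0 B ρ = 0 := by
  simp [sandwich]

theorem sandwich_zero_right (A : Matrix m Λ ℂ) (ρ : Matrix (Λ × R) (Λ × R) ℂ) :
    sandwich A 0 ρ = 0 := by
  simp [sandwich]

/-- With `K = L` this covers Kraus operators; different `K` and `L` are needed for Pauli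
superoperators, whose two sides are unrelated. -/
theorem kronecker_one_mul_sandwich (K L : Matrix m' m ℂ) (A B : Matrix m Λ ℂ)
    (ρ : Matrix (Λ × R) (Λ × R) ℂ) :
    (K ⊗ₖ (1 : Matrix R R ℂ)) * sandwich A B ρ * (L ⊗ₖ (1 : Matrix R R ℂ))ᴴ
      = sandwich (K * A) (L * B) ρ := by
  simp only [sandwich]
  have h : ∀ (K : Matrix m' m ℂ) (A : Matrix m Λ ℂ),
      (K * A) ⊗ₖ (1 : Matrix R R ℂ) = (K ⊗ₖ (1 : Matrix R R ℂ)) * (A ⊗ₖ (1 : Matrix R R ℂ)) := by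
    intro K A
    rw [← Matrix.mul_kronecker_mul, Matrix.one_mul]
  rw [h, h, Matrix.conjTranspose_mul]
  simp only [Matrix.mul_assoc]

theorem sandwich_apply (A B : Matrix m Λ ℂ) (ρ : Matrix (Λ × R) (Λ × R) ℂ) (u u' : m) (r r' : R) :
    sandwich A B ρ (u, r) (u', r') = ∑ x, ∑ y, A u x * ρ (x, r) (y, r') * star (B u' y) := by
  simp only [sandwich, Matrix.mul_apply, Matrix.conjTranspose_apply, Fintype.sum_prod_type,
    Matrix.kroneckerMap_apply, Matrix.one_apply, Finset.sum_mul]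
  simp only [mul_ite, mul_one, mul_zero, ite_mul, zero_mul, Finset.sum_ite_eq, Finset.mem_univ,
    if_true, star_zero, apply_ite star, Finset.sum_ite_irrel, Finset.sum_const_zero]
  rw [Finset.sum_comm]

end Sandwich

theorem conjBy_sandwich {N : ℕ} {Λ R : Type*} [Fintype Λ] [Fintype R] [DecidableEq R]
    (K : Matrix (Fin N → ZMod 2) (Fin N → ZMod 2) ℂ) (A B : Matrix (Fin N → ZMod 2) Λ ℂ)
    (ρ : Matrix (Λ × R) (Λ × R) ℂ) :
    conjBy K (sandwich A B ρ) = sandwich (K * A) (K * B) ρ :=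
  kronecker_one_mul_sandwich K K A B ρ

theorem conjBy_zero_left {N : ℕ} {R : Type*} [Fintype R] [DecidableEq R]
    (ρ : Matrix ((Fin N → ZMod 2) × R) ((Fin N → ZMod 2) × R) ℂ) : conjBy 0 ρ = 0 := by
  simp [conjBy]

theorem conjBy_smul {N : ℕ} {R : Type*} [Fintype R] [DecidableEq R]
    (K : Matrix (Fin N → ZMod 2) (Fin N → ZMod 2) ℂ) (c : ℂ)
    (ρ : Matrix ((Fin N → ZMod 2) × R) ((Fin N → ZMod 2) × R) ℂ) :
    conjBy K (c • ρ) = c • conjBy K ρ := by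
  simp [conjBy]

theorem PauliSuperop.apply_sandwich {q Λ R : Type*} [Fintype q] [DecidableEq q] [Fintype Λ]
    [Fintype R] [DecidableEq R] (F : PauliSuperop q) (A B : Matrix (q → ZMod 2) Λ ℂ)
    (ρ : Matrix (Λ × R) (Λ × R) ℂ) :
    F.apply (sandwich A B ρ) = sandwich (pauliMat F.left * A) (pauliMat F.right * B) ρ := by
  rw [← kronecker_one_mul_sandwich, Matrix.conjTranspose_kronecker, pauliMat_conjTranspose,
    Matrix.conjTranspose_one]
  rfl

theorem PauliSuperop.apply_smul {q R : Type*} [Fintype q] [DecidableEq q]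
    [Fintype R] [DecidableEq R] (F : PauliSuperop q) (c : ℂ)
    (ρ : Matrix ((q → ZMod 2) × R) ((q → ZMod 2) × R) ℂ) :
    F.apply (c • ρ) = c • F.apply ρ := by
  simp [PauliSuperop.apply]

/-- Every pair of Weyl operators is a Pauli superoperator up to a nonzero scalar. -/
theorem exists_pauliSuperop {q Λ R : Type*} [Fintype q] [DecidableEq q] [Fintype Λ]
    [Fintype R] [DecidableEq R] (a b a' b' : q → ZMod 2) :
    ∃ (F : PauliSuperop q) (z : ℂ),
      F.support ⊆ {c | a c ≠ 0} ∪ {c | b c ≠ 0} ∪ ({c | a' c ≠ 0} ∪ {c | b' c ≠ 0}) ∧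
      ∀ (A B : Matrix (q → ZMod 2) Λ ℂ) (ρ : Matrix (Λ × R) (Λ × R) ℂ),
        sandwich (weylAct a b A) (weylAct a' b' B) ρ = z • F.apply (sandwich A B ρ) := by
  refine ⟨⟨fun c => Pauli.ofBits (a c) (b c), fun c => Pauli.ofBits (a' c) (b' c)⟩,
    ((∏ c, (Pauli.ofBits (a c) (b c)).phase) *
      star (∏ c, (Pauli.ofBits (a' c) (b' c)).phase))⁻¹, ?_, ?_⟩
  · rintro c (hc | hc)
    · left
      by_contra h
      simp only [Set.mem_union, Set.mem_ofPred_eq, not_or, not_not] at h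
      simp [Pauli.ofBits, h.1, h.2] at hc
    · right
      by_contra h
      simp only [Set.mem_union, Set.mem_ofPred_eq, not_or, not_not] at h
      simp [Pauli.ofBits, h.1, h.2] at hc
  · intro A B ρ
    rw [PauliSuperop.apply_sandwich, pauliMat_mul, pauliMat_mul, sandwich_smul, smul_smul,
      inv_mul_cancel₀, one_smul]
    · simp only [Pauli.xBit_ofBits, Pauli.zBit_ofBits]
    · refine mul_ne_zero (Finset.prod_ne_zero_iff.mpr fun c _ => Pauli.phase_ne_zero _) ?_
      rw [Ne, star_eq_zero]
      exact Finset.prod_ne_zero_iff.mpr fun c _ => Pauli.phase_ne_zero _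

/-! ### Gates -/

section Gates

variable {N M : ℕ} {Λ R : Type*} [Fintype Λ] [Fintype R] [DecidableEq R]

theorem onQubit_mul (a : Fin N) (U : Matrix (ZMod 2) (ZMod 2) ℂ)
    (A : Matrix (Fin N → ZMod 2) Λ ℂ) (u : Fin N → ZMod 2) (x : Λ) :
    (onQubit a U * A) u x = ∑ s, U (u a) s * A (Function.update u a s) x := by
  classical
  rw [Matrix.mul_apply]
  symm
  refine Finset.sum_of_injOn (fun s => Function.update u a s)
    (Function.update_injective u a).injOn (fun _ _ => by simp) ?_ ?_
  · intro v _ hv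
    have : onQubit a U u v = 0 := by
      refine if_neg fun h => hv ⟨v a, by simp, ?_⟩
      funext b
      by_cases hb : b = a
      · subst hb; simp
      · simp [hb, h b hb]
    rw [this, zero_mul]
  · intro s _
    have : onQubit a U u (Function.update u a s) = U (u a) s := by
      rw [onQubit, if_pos]
      · simp
      · intro b hb; simp [hb]
    rw [this]

/-- Addition of the control bit to the target bit. -/
def cnotAct (c t : Fin N) (u : Fin N → ZMod 2) : Fin N → ZMod 2 := u + Pi.single t (u c)

theorem cnotAct_eq_update (c t : Fin N) (u : Fin N → ZMod 2) :
    cnotAct c t u = Function.update u t (u t + u c) := by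
  funext b
  by_cases h : b = t
  · subst h; simp [cnotAct]
  · simp [cnotAct, h]

theorem cnotAct_cnotAct {c t : Fin N} (h : c ≠ t) (u : Fin N → ZMod 2) :
    cnotAct c t (cnotAct c t u) = u := by
  simp only [cnotAct, Pi.add_apply, Pi.single_eq_of_ne h, add_zero]
  rw [add_assoc, add_self_zmod, add_zero]

theorem cnotAct_add (c t : Fin N) (u v : Fin N → ZMod 2) :
    cnotAct c t (u + v) = cnotAct c t u + cnotAct c t v := by
  simp only [cnotAct, Pi.add_apply, Pi.single_add]
  abel

theorem dotProduct_cnotAct (c t : Fin N) (b u : Fin N → ZMod 2) :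
    b ⬝ᵥ cnotAct c t u = cnotAct t c b ⬝ᵥ u := by
  simp only [cnotAct, dotProduct_add, add_dotProduct, dotProduct_single, single_dotProduct]

theorem cnotMat_mul {c t : Fin N} (h : c ≠ t) (A : Matrix (Fin N → ZMod 2) Λ ℂ)
    (u : Fin N → ZMod 2) (x : Λ) : (cnotMat c t * A) u x = A (cnotAct c t u) x := by
  rw [Matrix.mul_apply, Finset.sum_eq_single (cnotAct c t u)]
  · rw [cnotMat, ← cnotAct_eq_update, cnotAct_cnotAct h, if_pos rfl, one_mul]
  · intro v _ hv
    rw [cnotMat, ← cnotAct_eq_update, if_neg, zero_mul]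
    rintro rfl
    exact hv (cnotAct_cnotAct h v).symm
  · simp

/-- Conjugation by a controlled-not gate acts linearly on the `X`-exponent, and by the transpose,
which exchanges control and target, on the `Z`-exponent. This is the rule of error propagation. -/
theorem cnotMat_mul_weylAct {c t : Fin N} (h : c ≠ t) (a b : Fin N → ZMod 2)
    (A : Matrix (Fin N → ZMod 2) Λ ℂ) :
    cnotMat c t * weylAct a b A
      = weylAct (cnotAct c t a) (cnotAct t c b) (cnotMat c t * A) := by
  funext u x
  rw [cnotMat_mul h]
  simp only [weylAct]
  rw [cnotMat_mul h, cnotAct_add, cnotAct_cnotAct h, ← dotProduct_cnotAct, cnotAct_add,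
    cnotAct_cnotAct h]

/-- A hybrid state whose classical register is in the computational basis state `x₀`. -/
def pureOn (x₀ : Fin M → ZMod 2)
    (ω : Matrix ((Fin N → ZMod 2) × R) ((Fin N → ZMod 2) × R) ℂ) : HybridState N M R :=
  fun x => if x = x₀ then ω else 0

theorem conjBy_zero_right (K : Matrix (Fin N → ZMod 2) (Fin N → ZMod 2) ℂ) :
    conjBy K (0 : Matrix ((Fin N → ZMod 2) × R) ((Fin N → ZMod 2) × R) ℂ) = 0 := by
  simp [conjBy]

theorem act_pureOn_of_kraus {g : CliffordGate N} (hg : ∀ P hP a, g ≠ .measure P hP a)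
    (j : Fin M) (x₀ : Fin M → ZMod 2)
    (ω : Matrix ((Fin N → ZMod 2) × R) ((Fin N → ZMod 2) × R) ℂ) :
    g.act j (pureOn x₀ ω) = pureOn x₀ (if x₀ j = 1 then ∑ b, conjBy (g.kraus b) ω else ω) := by
  have key : g.act j (pureOn x₀ ω) = fun x =>
      if x j = 1 then ∑ b : ZMod 2, conjBy (g.kraus b) (pureOn x₀ ω x) else pureOn x₀ ω x := by
    cases g <;> first | rfl | exact absurd rfl (hg _ _ _)
  rw [key]
  funext x
  by_cases h : x = x₀
  · subst h
    simp [pureOn]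
  · simp [pureOn, h, conjBy_zero_right]

theorem sum_zmod2 {A : Type*} [AddCommMonoid A] (f : ZMod 2 → A) : ∑ b, f b = f 0 + f 1 :=
  Fin.sum_univ_two f

theorem act_cnot (c t : Fin N) (h : c ≠ t) (j : Fin M) (x₀ : Fin M → ZMod 2) (hx : x₀ j = 1)
    (ω : Matrix ((Fin N → ZMod 2) × R) ((Fin N → ZMod 2) × R) ℂ) :
    (CliffordGate.cnot c t h).act j (pureOn x₀ ω) = pureOn x₀ (conjBy (cnotMat c t) ω) := by
  rw [act_pureOn_of_kraus (by simp), if_pos hx, sum_zmod2]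
  simp [CliffordGate.kraus, conjBy_zero_left]

theorem act_pauli (P : Pauli) (a : Fin N) (j : Fin M) (x₀ : Fin M → ZMod 2)
    (ω : Matrix ((Fin N → ZMod 2) × R) ((Fin N → ZMod 2) × R) ℂ) :
    (CliffordGate.pauli P a).act j (pureOn x₀ ω)
      = pureOn x₀ (if x₀ j = 1 then conjBy (onQubit a P.mat) ω else ω) := by
  rw [act_pureOn_of_kraus (by simp), sum_zmod2]
  simp [CliffordGate.kraus, conjBy_zero_left]

theorem act_measure (P : Pauli) (hP : P ≠ Pauli.I) (a : Fin N) (j : Fin M) (x₀ : Fin M → ZMod 2)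
    (ω : Matrix ((Fin N → ZMod 2) × R) ((Fin N → ZMod 2) × R) ℂ) (x : Fin M → ZMod 2) :
    (CliffordGate.measure P hP a).act j (pureOn x₀ ω) x
      = if x = Function.update x₀ j (x j) then conjBy (onQubit a (P.proj (x j))) ω else 0 := by
  change ∑ b : ZMod 2, conjBy (onQubit a (P.proj (x j))) (pureOn x₀ ω (Function.update x j b)) = _
  rw [Finset.sum_eq_single (x₀ j)]
  · have : Function.update x j (x₀ j) = x₀ ↔ x = Function.update x₀ j (x j) := by
      rw [Function.update_eq_iff, Function.eq_update_iff]
      simp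
    by_cases h : x = Function.update x₀ j (x j)
    · rw [if_pos h, pureOn, if_pos (this.mpr h)]
    · rw [if_neg h, pureOn, if_neg (fun h' => h (this.mp h')), conjBy_zero_right]
  · intro b _ hb
    rw [pureOn, if_neg, conjBy_zero_right]
    rintro rfl
    simp at hb
  · simp

theorem onQubit_proj_mul (P : Pauli) (a : Fin N) (b : ZMod 2) (A : Matrix (Fin N → ZMod 2) Λ ℂ) :
    onQubit a (P.proj b) * A = (1 / 2 : ℂ) • (A + sgn b • (onQubit a P.mat * A)) := by
  funext u x
  simp only [onQubit_mul, Matrix.smul_apply, Matrix.add_apply, smul_eq_mul, Pauli.proj,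
    Matrix.one_apply]
  have h1 : ∑ s, (1 / 2 : ℂ) * ((if u a = s then (1 : ℂ) else 0)
      + (if b = 0 then 1 else -1) * P.mat (u a) s) * A (Function.update u a s) x
      = (1 / 2 : ℂ) * (∑ s, (if u a = s then A (Function.update u a s) x else 0)
        + sgn b * ∑ s, P.mat (u a) s * A (Function.update u a s) x) := by
    rw [Finset.mul_sum, ← Finset.sum_add_distrib, Finset.mul_sum]
    refine Finset.sum_congr rfl fun s _ => ?_
    simp only [sgn]
    split_ifs <;> ring
  rw [h1, Finset.sum_ite_eq]
  simp

theorem onQubit_proj_mul_of_eigen {P : Pauli} {a : Fin N} {s : ZMod 2}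
    {A : Matrix (Fin N → ZMod 2) Λ ℂ} (h : onQubit a P.mat * A = sgn s • A) (b : ZMod 2) :
    onQubit a (P.proj b) * A = if b = s then A else 0 := by
  rw [onQubit_proj_mul, h, smul_smul]
  rcases zmod2_cases b with rfl | rfl <;> rcases zmod2_cases s with rfl | rfl <;>
    simp [← two_smul ℂ A, smul_smul]

/-- A measurement whose outcome is determined on both sides. -/
theorem act_measure_of_eigen (P : Pauli) (hP : P ≠ Pauli.I) (a : Fin N) (j : Fin M)
    (x₀ : Fin M → ZMod 2) {A B : Matrix (Fin N → ZMod 2) Λ ℂ} {s s' : ZMod 2}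
    (hA : onQubit a P.mat * A = sgn s • A) (hB : onQubit a P.mat * B = sgn s' • B)
    (z : ℂ) (ρ : Matrix (Λ × R) (Λ × R) ℂ) :
    (CliffordGate.measure P hP a).act j (pureOn x₀ (z • sandwich A B ρ))
      = pureOn (Function.update x₀ j s) ((if s = s' then z else 0) • sandwich A B ρ) := by
  funext x
  rw [act_measure, conjBy_smul, conjBy_sandwich, onQubit_proj_mul_of_eigen hA,
    onQubit_proj_mul_of_eigen hB, pureOn]
  by_cases hx : x = Function.update x₀ j s
  · have hxj : x j = s := by rw [hx]; simp
    rw [if_pos hx, if_pos (by rw [hxj]; exact hx), if_pos hxj, hxj]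
    -- If the two sides have different eigenvalues, the projector selected by the left side
    -- annihilates the right side.
    by_cases h : s = s'
    · simp [h]
    · simp [h, sandwich_zero_right]
  · rw [if_neg hx]
    by_cases hx' : x = Function.update x₀ j (x j)
    · rw [if_pos hx']
      have : x j ≠ s := fun h => hx (h ▸ hx')
      rw [if_neg this, sandwich_zero_left, smul_zero]
    · rw [if_neg hx']

theorem onQubit_X_mul (a : Fin N) (A : Matrix (Fin N → ZMod 2) Λ ℂ) :
    onQubit a Pauli.X.mat * A = weylAct (Pi.single a 1) 0 A := by
  funext u x
  rw [onQubit_mul, Finset.sum_eq_single (u a + 1)]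
  · rw [Pauli.mat_apply]
    simp only [Pauli.xBit, Pauli.zBit, Pauli.phase, weylAct]
    simp only [if_true, zero_mul, sgn_zero, mul_one, one_mul, zero_dotProduct]
    congr 1
    funext b
    by_cases h : b = a
    · subst h; simp
    · simp [h]
  · intro s _ hs
    rw [Pauli.mat_apply, if_neg, zero_mul]
    simpa [Pauli.xBit] using hs
  · simp

theorem onQubit_Z_mul (a : Fin N) (A : Matrix (Fin N → ZMod 2) Λ ℂ) :
    onQubit a Pauli.Z.mat * A = weylAct 0 (Pi.single a 1) A := by
  funext u x
  rw [onQubit_mul, Finset.sum_eq_single (u a)]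
  · rw [Pauli.mat_apply]
    simp [Pauli.xBit, Pauli.zBit, Pauli.phase, weylAct]
  · intro s _ hs
    rw [Pauli.mat_apply, if_neg, zero_mul]
    simpa [Pauli.xBit] using hs
  · simp

/-- Only the `Z`-exponent at the measured qubit anticommutes with `X`, so noise merely shifts the
eigenvalue: a noisy measurement is an ideal one with a flipped outcome. -/
theorem onQubit_X_mul_weylAct {i : Fin N} {s : ZMod 2} {A : Matrix (Fin N → ZMod 2) Λ ℂ}
    (h : onQubit i Pauli.X.mat * A = sgn s • A) (a b : Fin N → ZMod 2) :
    onQubit i Pauli.X.mat * weylAct a b A = sgn (s + b i) • weylAct a b A := by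
  rw [onQubit_X_mul] at *
  rw [weylAct_weylAct, zero_dotProduct, sgn_zero, one_smul, sgn_add, mul_comm, ← smul_smul,
    ← weylAct_smul a b (sgn s), ← h, weylAct_weylAct, smul_smul]
  simp [sgn_mul_self, add_comm]

theorem onQubit_Z_mul_weylAct {i : Fin N} {s : ZMod 2} {A : Matrix (Fin N → ZMod 2) Λ ℂ}
    (h : onQubit i Pauli.Z.mat * A = sgn s • A) (a b : Fin N → ZMod 2) :
    onQubit i Pauli.Z.mat * weylAct a b A = sgn (s + a i) • weylAct a b A := by
  rw [onQubit_Z_mul] at *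
  rw [weylAct_weylAct, sgn_add, mul_comm, ← smul_smul (sgn (a i)),
    ← weylAct_smul a b (sgn s), ← h, weylAct_weylAct, smul_smul]
  simp [add_comm]

end Gates

/-! ### Tracing out ancillas -/

section Trace

variable {N M : ℕ} {α β : Type*} [Fintype α] [Fintype β] [DecidableEq α] [DecidableEq β]
  {R : Type*} [Fintype R] [DecidableEq R]

/-- The configuration given by data values and ancilla values. -/
def comb (e : α ⊕ β ≃ Fin N) (p : α → ZMod 2) (v : β → ZMod 2) : Fin N → ZMod 2 :=
  fun a => Sum.elim p v (e.symm a)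

@[simp] theorem comb_inl (e : α ⊕ β ≃ Fin N) (p : α → ZMod 2) (v : β → ZMod 2) (c : α) :
    comb e p v (e (.inl c)) = p c := by simp [comb]

@[simp] theorem comb_inr (e : α ⊕ β ≃ Fin N) (p : α → ZMod 2) (v : β → ZMod 2) (d : β) :
    comb e p v (e (.inr d)) = v d := by simp [comb]

theorem ext_of_equiv {X : Type*} (e : α ⊕ β ≃ Fin N) {u v : Fin N → X}
    (h : ∀ c, u (e (.inl c)) = v (e (.inl c))) (h' : ∀ d, u (e (.inr d)) = v (e (.inr d))) :
    u = v := by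
  funext a
  obtain ⟨x, rfl⟩ := e.surjective a
  rcases x with c | d
  · exact h c
  · exact h' d

theorem comb_self (e : α ⊕ β ≃ Fin N) (u : Fin N → ZMod 2) :
    comb e (fun c => u (e (.inl c))) (fun d => u (e (.inr d))) = u :=
  ext_of_equiv e (by simp) (by simp)

theorem comb_add (e : α ⊕ β ≃ Fin N) (p p' : α → ZMod 2) (v v' : β → ZMod 2) :
    comb e (p + p') (v + v') = comb e p v + comb e p' v' :=
  ext_of_equiv e (by simp) (by simp)

theorem update_comb (e : α ⊕ β ≃ Fin N) (p : α → ZMod 2) (v : β → ZMod 2) (d : β) (s : ZMod 2) :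
    Function.update (comb e p v) (e (.inr d)) s = comb e p (Function.update v d s) := by
  refine ext_of_equiv e (fun c => ?_) (fun d' => ?_)
  · simp
  · by_cases h : d' = d
    · subst h; simp
    · simp [h]

/-- The partial trace over the ancillas. -/
def dataTrace (e : α ⊕ β ≃ Fin N)
    (ω : Matrix ((Fin N → ZMod 2) × R) ((Fin N → ZMod 2) × R) ℂ) :
    Matrix ((α → ZMod 2) × R) ((α → ZMod 2) × R) ℂ :=
  fun p p' => ∑ v : β → ZMod 2, ω (comb e p.1 v, p.2) (comb e p'.1 v, p'.2)

/-- The embedding of the data qubits. -/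
def dataEmb (e : α ⊕ β ≃ Fin N) : α ↪ Fin N := ⟨fun c => e (.inl c), fun _ _ h => by simpa using h⟩

@[simp] theorem dataEmb_apply (e : α ⊕ β ≃ Fin N) (c : α) : dataEmb e c = e (.inl c) := rfl

/-- Pairs of configurations that agree on the ancillas and have prescribed data parts are
parametrised by their common ancilla part. -/
theorem partialTrace_eq (e : α ⊕ β ≃ Fin N) (τ : HybridState N M R) :
    partialTrace (dataEmb e) τ = dataTrace e (∑ x, τ x) := by
  classical
  funext p p'
  simp only [partialTrace, dataTrace, Matrix.sum_apply]
  rw [Finset.sum_comm (s := (Finset.univ : Finset (β → ZMod 2)))]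
  refine Finset.sum_congr rfl fun x _ => ?_
  rw [← Fintype.sum_prod_type']
  symm
  refine Finset.sum_of_injOn (fun v => (comb e p.1 v, comb e p'.1 v)) ?_ (fun _ _ => by simp) ?_ ?_
  · intro v _ v' _ h
    funext d
    have := congrFun (congrArg Prod.fst h) (e (.inr d))
    simpa using this
  · rintro ⟨u, u'⟩ _ h
    refine if_neg ?_
    rintro ⟨h1, h2, h3⟩
    refine h ⟨fun d => u (e (.inr d)), by simp, Prod.ext ?_ ?_⟩
    · refine ext_of_equiv e (fun c => ?_) (fun d => by simp)
      simpa using (h1 c).symm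
    · refine ext_of_equiv e (fun c => ?_) (fun d => ?_)
      · simpa using (h2 c).symm
      · simpa using h3 (e (.inr d)) (by simp)
  · intro v _
    rw [if_pos]
    refine ⟨fun c => by simp, fun c => by simp, fun a ha => ?_⟩
    obtain ⟨c | d, rfl⟩ := e.surjective a
    · exact absurd ⟨c, rfl⟩ ha
    · simp

theorem sum_pureOn (x₀ : Fin M → ZMod 2)
    (ω : Matrix ((Fin N → ZMod 2) × R) ((Fin N → ZMod 2) × R) ℂ) :
    ∑ x, pureOn x₀ ω x = ω := by
  simp [pureOn]

theorem dataTrace_smul (e : α ⊕ β ≃ Fin N) (z : ℂ)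
    (ω : Matrix ((Fin N → ZMod 2) × R) ((Fin N → ZMod 2) × R) ℂ) :
    dataTrace e (z • ω) = z • dataTrace e ω := by
  funext p p'
  simp [dataTrace, Finset.mul_sum]

variable {Λ : Type*} [Fintype Λ]

/-- The rows of `Φ` factor into an ancilla amplitude and the rows of `A`. -/
def Factors (e : α ⊕ β ≃ Fin N) (Φ : Matrix (Fin N → ZMod 2) Λ ℂ)
    (A : Matrix (α → ZMod 2) Λ ℂ) : Prop :=
  ∃ f : (β → ZMod 2) → ℂ, ∀ p v x, Φ (comb e p v) x = f v * A p x

/-- The ancilla amplitudes integrate out to their inner product. It may vanish, and then the scalar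
is zero. -/
theorem dataTrace_sandwich {e : α ⊕ β ≃ Fin N} {Φ Φ' : Matrix (Fin N → ZMod 2) Λ ℂ}
    {A A' : Matrix (α → ZMod 2) Λ ℂ} (h : Factors e Φ A) (h' : Factors e Φ' A')
    (ρ : Matrix (Λ × R) (Λ × R) ℂ) :
    ∃ z : ℂ, dataTrace e (sandwich Φ Φ' ρ) = z • sandwich A A' ρ := by
  obtain ⟨f, hf⟩ := h
  obtain ⟨f', hf'⟩ := h'
  refine ⟨∑ v, f v * star (f' v), ?_⟩
  funext p p'
  obtain ⟨p, r⟩ := p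
  obtain ⟨p', r'⟩ := p'
  simp only [dataTrace, Matrix.smul_apply, sandwich_apply, hf, hf', smul_eq_mul, Finset.sum_mul]
  refine Finset.sum_congr rfl fun v _ => ?_
  rw [Finset.mul_sum]
  refine Finset.sum_congr rfl fun x _ => ?_
  rw [Finset.mul_sum]
  refine Finset.sum_congr rfl fun y _ => ?_
  rw [star_mul']
  ring

theorem sum_equiv_eq (e : α ⊕ β ≃ Fin N) (f : Fin N → ZMod 2) :
    ∑ a, f a = ∑ c, f (e (.inl c)) + ∑ d, f (e (.inr d)) := by
  rw [← e.sum_comp, Fintype.sum_sum_type]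

theorem Factors.weylAct {e : α ⊕ β ≃ Fin N} {Φ : Matrix (Fin N → ZMod 2) Λ ℂ}
    {A : Matrix (α → ZMod 2) Λ ℂ} (h : Factors e Φ A) (a b : Fin N → ZMod 2) :
    Factors e (weylAct a b Φ)
      (FaultTol.weylAct (fun c => a (e (.inl c))) (fun c => b (e (.inl c))) A) := by
  obtain ⟨f, hf⟩ := h
  refine ⟨fun v => sgn ((fun d => b (e (.inr d))) ⬝ᵥ (v + fun d => a (e (.inr d))))
    * f (v + fun d => a (e (.inr d))), fun p v x => ?_⟩
  simp only [FaultTol.weylAct]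
  have h1 : comb e p v + a = comb e (p + fun c => a (e (.inl c))) (v + fun d => a (e (.inr d))) := by
    rw [comb_add, comb_self]
  rw [h1, hf]
  have h2 : b ⬝ᵥ comb e (p + fun c => a (e (.inl c))) (v + fun d => a (e (.inr d)))
      = (fun c => b (e (.inl c))) ⬝ᵥ (p + fun c => a (e (.inl c)))
        + (fun d => b (e (.inr d))) ⬝ᵥ (v + fun d => a (e (.inr d))) := by
    simp only [dotProduct]
    rw [sum_equiv_eq e]
    simp
  rw [h2, sgn_add]
  ring

end Trace

/-! ### Layers -/

section Layers

variable {N M : ℕ} {R : Type*} [Fintype R] [DecidableEq R]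

theorem foldl_finRange_inv {σ : Type*} {n : ℕ} (f : σ → Fin n → σ) (Inv : ℕ → σ → Prop) (s₀ : σ)
    (h0 : Inv 0 s₀) (hs : ∀ (j : Fin n) s, Inv j s → Inv (j + 1) (f s j)) :
    Inv n ((List.finRange n).foldl f s₀) := by
  induction n with
  | zero => simpa using h0
  | succ n ih =>
    rw [List.finRange_succ_last, List.foldl_append, List.foldl_map]
    have := ih (fun s j => f s j.castSucc) (fun j s h => hs j.castSucc s h)
    simpa using hs (Fin.last n) _ this

/-- The layer consisting of a finite family of gates. -/
def layerOf {ι : Type*} [Fintype ι] (h : Fintype.card ι ≤ M) (g : ι → CliffordGate N)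
    (hd : Pairwise fun i i' => Disjoint (g i).qubits (g i').qubits) : CliffordLayer N M where
  numGates := Fintype.card ι
  numGates_le := h
  gate := fun j => g ((Fintype.equivFin ι).symm j)
  disjoint := fun _ _ hjj => hd fun h' => hjj ((Fintype.equivFin ι).symm.injective h')

/-- The classical bit attached to a gate of a layer. -/
def layerBit {ι : Type*} [Fintype ι] (h : Fintype.card ι ≤ M) (i : ι) : Fin M :=
  Fin.castLE h (Fintype.equivFin ι i)

theorem layerBit_injective {ι : Type*} [Fintype ι] (h : Fintype.card ι ≤ M) :
    Function.Injective (layerBit h) := fun _ _ h' =>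
  (Fintype.equivFin ι).injective (Fin.castLE_injective h h')

/-- Indexing the invariant by the set of gates already applied hides the enumeration of the layer; a
step may use that the next gate is new. -/
theorem layerOf_act_inv {ι : Type*} [Fintype ι] [DecidableEq ι] (h : Fintype.card ι ≤ M)
    (g : ι → CliffordGate N)
    (hd : Pairwise fun i i' => Disjoint (g i).qubits (g i').qubits)
    (Inv : Finset ι → HybridState N M R → Prop) (τ : HybridState N M R) (h0 : Inv ∅ τ)
    (hs : ∀ s i τ, i ∉ s → Inv s τ → Inv (insert i s) ((g i).act (layerBit h i) τ)) :
    Inv Finset.univ ((layerOf h g hd).act τ) := by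
  let S : ℕ → Finset ι := fun k => Finset.univ.filter fun i => (Fintype.equivFin ι i : ℕ) < k
  have hS0 : S 0 = ∅ := by simp [S]
  have hSn : S (Fintype.card ι) = Finset.univ := by
    ext i
    simp [S]
  have := foldl_finRange_inv (n := Fintype.card ι)
    (fun τ j => (g ((Fintype.equivFin ι).symm j)).act (Fin.castLE h j) τ)
    (fun k τ => Inv (S k) τ) τ (by rw [hS0]; exact h0) (by
      intro j τ hτ
      set i := (Fintype.equivFin ι).symm j with hi
      have hj : j = Fintype.equivFin ι i := by simp [hi]
      have hins : S (j + 1) = insert i (S j) := by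
        ext i'
        simp only [S, Finset.mem_filter, Finset.mem_univ, true_and, Finset.mem_insert]
        rw [hj, ← (Fintype.equivFin ι).apply_eq_iff_eq (x := i'), Fin.ext_iff]
        omega
      rw [hins]
      have hnot : i ∉ S j := by simp [S, hj]
      have := hs (S j) i τ hnot hτ
      rwa [layerBit, ← hj] at this)
  rw [← hSn]
  exact this

theorem classicalAct_pureOn (f : (Fin M → ZMod 2) → (Fin M → ZMod 2)) (x₀ : Fin M → ZMod 2)
    (ω : Matrix ((Fin N → ZMod 2) × R) ((Fin N → ZMod 2) × R) ℂ) :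
    classicalAct f (pureOn x₀ ω) = pureOn (f x₀) ω := by
  funext x
  rw [classicalAct, Finset.sum_eq_single x₀]
  · simp [pureOn, eq_comm]
  · intro y _ hy
    simp [pureOn, hy]
  · simp

/-- Overwriting the register sums out its initial state, so the first timestep needs only the
partial trace of the input. -/
theorem classicalAct_const (y₀ : Fin M → ZMod 2) (τ : HybridState N M R) :
    classicalAct (fun _ => y₀) τ = pureOn y₀ (∑ x, τ x) := by
  funext x
  by_cases h : x = y₀
  · subst h; simp [classicalAct, pureOn]
  · simp [classicalAct, pureOn, h, Ne.symm h]

theorem PauliSuperop.apply_pureOn (F : PauliSuperop (Fin N)) (x₀ : Fin M → ZMod 2)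
    (ω : Matrix ((Fin N → ZMod 2) × R) ((Fin N → ZMod 2) × R) ℂ) :
    (fun x => F.apply (pureOn x₀ ω x)) = pureOn x₀ (F.apply ω) := by
  funext x
  by_cases h : x = x₀
  · simp [pureOn, h]
  · simp [pureOn, h, PauliSuperop.apply]

end Layers

/-! ### Resets -/

section Reset

variable {N M : ℕ} {R : Type*} [Fintype R] [DecidableEq R]

/-- The action of a reset to `|0⟩`. -/
def resetZ (a : Fin N) (ω : Matrix ((Fin N → ZMod 2) × R) ((Fin N → ZMod 2) × R) ℂ) :
    Matrix ((Fin N → ZMod 2) × R) ((Fin N → ZMod 2) × R) ℂ :=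
  fun p p' => if p.1 a = 0 ∧ p'.1 a = 0 then
    ∑ b, ω (Function.update p.1 a b, p.2) (Function.update p'.1 a b, p'.2) else 0

/-- The action of a reset to `|+⟩`. -/
def resetP (a : Fin N) (ω : Matrix ((Fin N → ZMod 2) × R) ((Fin N → ZMod 2) × R) ℂ) :
    Matrix ((Fin N → ZMod 2) × R) ((Fin N → ZMod 2) × R) ℂ :=
  fun p p' => (1 / 2 : ℂ) *
    ∑ b, ω (Function.update p.1 a b, p.2) (Function.update p'.1 a b, p'.2)

theorem conjBy_onQubit_apply (a : Fin N) (U : Matrix (ZMod 2) (ZMod 2) ℂ)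
    (ω : Matrix ((Fin N → ZMod 2) × R) ((Fin N → ZMod 2) × R) ℂ) (u u' : Fin N → ZMod 2)
    (r r' : R) :
    conjBy (onQubit a U) ω (u, r) (u', r') = ∑ s, ∑ s', U (u a) s *
      ω (Function.update u a s, r) (Function.update u' a s', r') * star (U (u' a) s') := by
  have key : ∀ (f : (Fin N → ZMod 2) → ℂ) (u : Fin N → ZMod 2),
      ∑ v, onQubit a U u v * f v = ∑ s, U (u a) s * f (Function.update u a s) := fun f u =>
    onQubit_mul (Λ := Unit) a U (fun v _ => f v) u ()
  have key' : ∀ (f : (Fin N → ZMod 2) → ℂ) (u : Fin N → ZMod 2),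
      ∑ v, f v * star (onQubit a U u v) = ∑ s, f (Function.update u a s) * star (U (u a) s) := by
    intro f u
    have := congrArg star (key (fun v => star (f v)) u)
    simpa [star_sum, star_mul', mul_comm] using this
  change sandwich (onQubit a U) (onQubit a U) ω (u, r) (u', r') = _
  rw [sandwich_apply]
  simp only [mul_assoc, ← Finset.mul_sum]
  rw [key]
  refine Finset.sum_congr rfl fun s _ => ?_
  rw [key' (fun v => ω (Function.update u a s, r) (v, r'))]

theorem act_resetZero (a : Fin N) (j : Fin M) (x₀ : Fin M → ZMod 2) (hx : x₀ j = 1)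
    (ω : Matrix ((Fin N → ZMod 2) × R) ((Fin N → ZMod 2) × R) ℂ) :
    (CliffordGate.resetZero a).act j (pureOn x₀ ω) = pureOn x₀ (resetZ a ω) := by
  rw [act_pureOn_of_kraus (by simp), if_pos hx]
  congr 1
  funext p p'
  obtain ⟨u, r⟩ := p
  obtain ⟨u', r'⟩ := p'
  rw [Matrix.sum_apply]
  refine (Finset.sum_congr rfl fun b _ => conjBy_onQubit_apply a
    (Matrix.of fun x y => if x = 0 ∧ y = b then (1 : ℂ) else 0) ω u u' r r').trans ?_
  simp only [resetZ, Matrix.of_apply]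
  by_cases h : u a = 0
  · by_cases h' : u' a = 0
    · simp [h, h', apply_ite star]
    · simp [h, h']
  · simp [h]

theorem act_resetPlus (a : Fin N) (j : Fin M) (x₀ : Fin M → ZMod 2) (hx : x₀ j = 1)
    (ω : Matrix ((Fin N → ZMod 2) × R) ((Fin N → ZMod 2) × R) ℂ) :
    (CliffordGate.resetPlus a).act j (pureOn x₀ ω) = pureOn x₀ (resetP a ω) := by
  rw [act_pureOn_of_kraus (by simp), if_pos hx]
  congr 1
  funext p p'
  obtain ⟨u, r⟩ := p
  obtain ⟨u', r'⟩ := p'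
  rw [Matrix.sum_apply]
  refine (Finset.sum_congr rfl fun b _ => conjBy_onQubit_apply a
    (Matrix.of fun _ y => if y = b then (((Real.sqrt 2)⁻¹ : ℝ) : ℂ) else 0) ω u u' r r').trans ?_
  simp only [resetP, Matrix.of_apply]
  rw [Finset.mul_sum]
  refine Finset.sum_congr rfl fun b _ => ?_
  have h2 : ((((Real.sqrt 2)⁻¹ : ℝ) : ℂ)) * (((Real.sqrt 2)⁻¹ : ℝ) : ℂ) = 1 / 2 := by
    rw [← Complex.ofReal_mul, ← mul_inv, Real.mul_self_sqrt (by norm_num)]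
    norm_num
  rw [Finset.sum_eq_single b, Finset.sum_eq_single b]
  · rw [if_pos rfl, Complex.star_def, Complex.conj_ofReal, mul_right_comm, h2]
  · intro s _ hs
    rw [if_neg hs, star_zero, mul_zero]
  · simp
  · intro s _ hs
    simp [hs]
  · simp

variable {α β : Type*} [Fintype α] [Fintype β] [DecidableEq α] [DecidableEq β]

/-- Exchanging the coordinate `v d` with `b` is a bijection of the pairs `(v, b)` and separates the
two factors. It expresses that resetting an ancilla leaves the traced-out state unchanged. -/
theorem sum_update_eq (d : β) (h : ZMod 2 → ℂ) (F : (β → ZMod 2) → ℂ) :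
    ∑ v : β → ZMod 2, ∑ b, h (v d) * F (Function.update v d b) = (∑ b, h b) * ∑ v, F v := by
  rw [Finset.sum_mul_sum, ← Fintype.sum_prod_type', ← Fintype.sum_prod_type']
  refine Finset.sum_bij' (fun p _ => (p.1 d, Function.update p.1 d p.2))
    (fun p _ => (Function.update p.2 d p.1, p.2 d)) (by simp) (by simp) ?_ ?_ ?_
  · intro p _; simp
  · intro p _; simp
  · intro p _; simp

theorem dataTrace_resetZ (e : α ⊕ β ≃ Fin N) (d : β)
    (ω : Matrix ((Fin N → ZMod 2) × R) ((Fin N → ZMod 2) × R) ℂ) :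
    dataTrace e (resetZ (e (.inr d)) ω) = dataTrace e ω := by
  funext p p'
  have := sum_update_eq d (fun b => if b = 0 then 1 else 0)
    (fun v => ω (comb e p.1 v, p.2) (comb e p'.1 v, p'.2))
  simp only [sum_zmod2 (fun b : ZMod 2 => if b = 0 then (1 : ℂ) else 0), if_true, one_ne_zero,
    if_false, add_zero, one_mul] at this
  rw [dataTrace, dataTrace, ← this]
  refine Finset.sum_congr rfl fun v _ => ?_
  simp only [resetZ, comb_inr, and_self, update_comb]
  by_cases h : v d = 0 <;> simp [h]

theorem dataTrace_resetP (e : α ⊕ β ≃ Fin N) (d : β)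
    (ω : Matrix ((Fin N → ZMod 2) × R) ((Fin N → ZMod 2) × R) ℂ) :
    dataTrace e (resetP (e (.inr d)) ω) = dataTrace e ω := by
  funext p p'
  have := sum_update_eq d (fun _ => (1 / 2 : ℂ))
    (fun v => ω (comb e p.1 v, p.2) (comb e p'.1 v, p'.2))
  rw [sum_zmod2 (fun _ : ZMod 2 => (1 / 2 : ℂ))] at this
  rw [dataTrace, dataTrace]
  simp only [resetP, update_comb, Finset.mul_sum]
  rw [this]
  norm_num

theorem eq_of_update_invariant {X : Type*} (g : (Fin N → ZMod 2) → X) (I : Finset (Fin N))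
    (hg : ∀ i ∈ I, ∀ u s, g (Function.update u i s) = g u) :
    ∀ u v : Fin N → ZMod 2, (∀ a ∉ I, u a = v a) → g u = g v := by
  induction I using Finset.induction_on with
  | empty =>
    intro u v h
    rw [funext fun a => h a (by simp)]
  | insert i I hi ih =>
    intro u v h
    rw [← hg i (by simp) u (v i)]
    refine ih (fun i' hi' => hg i' (by simp [hi'])) _ _ fun a ha => ?_
    by_cases hai : a = i
    · subst hai; simp
    · rw [Function.update_of_ne hai]
      exact h a (by simp [hai, ha])

/-- `ω` has the ancilla `a` in the state `|0⟩`. -/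
def InZero (a : Fin N) (ω : Matrix ((Fin N → ZMod 2) × R) ((Fin N → ZMod 2) × R) ℂ) : Prop :=
  ∀ u r u' r', ω (u, r) (u', r') ≠ 0 → u a = 0 ∧ u' a = 0

/-- `ω` has the ancilla `a` in the state `|+⟩`. -/
def InPlus (a : Fin N) (ω : Matrix ((Fin N → ZMod 2) × R) ((Fin N → ZMod 2) × R) ℂ) : Prop :=
  ∀ u r u' r' s s',
    ω (Function.update u a s, r) (Function.update u' a s', r') = ω (u, r) (u', r')

theorem inZero_resetZ (a : Fin N)
    (ω : Matrix ((Fin N → ZMod 2) × R) ((Fin N → ZMod 2) × R) ℂ) : InZero a (resetZ a ω) := by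
  intro u r u' r' h
  by_contra hn
  exact h (if_neg hn)

theorem inPlus_resetP (a : Fin N)
    (ω : Matrix ((Fin N → ZMod 2) × R) ((Fin N → ZMod 2) × R) ℂ) : InPlus a (resetP a ω) := by
  intro u r u' r' s s'
  simp [resetP]

theorem InZero.resetZ {a c : Fin N} {ω : Matrix ((Fin N → ZMod 2) × R) ((Fin N → ZMod 2) × R) ℂ}
    (h : InZero a ω) (hac : a ≠ c) : InZero a (resetZ c ω) := by
  intro u r u' r' hne
  simp only [FaultTol.resetZ] at hne
  split_ifs at hne
  · obtain ⟨b, -, hb⟩ := Finset.exists_ne_zero_of_sum_ne_zero hne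
    simpa [hac] using h _ _ _ _ hb
  · exact absurd rfl hne

theorem InZero.resetP {a c : Fin N} {ω : Matrix ((Fin N → ZMod 2) × R) ((Fin N → ZMod 2) × R) ℂ}
    (h : InZero a ω) (hac : a ≠ c) : InZero a (resetP c ω) := by
  intro u r u' r' hne
  obtain ⟨b, -, hb⟩ := Finset.exists_ne_zero_of_sum_ne_zero (right_ne_zero_of_mul hne)
  simpa [hac] using h _ _ _ _ hb

theorem InPlus.resetZ {a c : Fin N} {ω : Matrix ((Fin N → ZMod 2) × R) ((Fin N → ZMod 2) × R) ℂ}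
    (h : InPlus a ω) (hac : a ≠ c) : InPlus a (resetZ c ω) := by
  intro u r u' r' s s'
  simp only [FaultTol.resetZ, Function.update_of_ne hac.symm, Function.update_comm hac]
  simp only [h _ _ _ _ s s']

theorem InPlus.resetP {a c : Fin N} {ω : Matrix ((Fin N → ZMod 2) × R) ((Fin N → ZMod 2) × R) ℂ}
    (h : InPlus a ω) (hac : a ≠ c) : InPlus a (resetP c ω) := by
  intro u r u' r' s s'
  simp only [FaultTol.resetP, Function.update_comm hac]
  simp only [h _ _ _ _ s s']

end Reset

/-! ### Preparation of the ancillas -/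

section Prepare

variable {N M : ℕ} {α βX βZ : Type*} [Fintype α] [Fintype βX] [Fintype βZ] [DecidableEq α]
  [DecidableEq βX] [DecidableEq βZ] {R Λ : Type*} [Fintype R] [DecidableEq R] [Fintype Λ]

/-- Reset of the ancilla of an `X`-check to `|+⟩` and of a `Z`-check to `|0⟩`. -/
def resetGate (e : α ⊕ (βX ⊕ βZ) ≃ Fin N) : βX ⊕ βZ → CliffordGate N
  | .inl b => .resetPlus (e (.inr (.inl b)))
  | .inr d => .resetZero (e (.inr (.inr d)))

/-- The Pauli operator measured on an ancilla. -/
def ancPauli : βX ⊕ βZ → Pauli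
  | .inl _ => .X
  | .inr _ => .Z

theorem ancPauli_ne (i : βX ⊕ βZ) : ancPauli i ≠ Pauli.I := by
  rcases i with i | i <;> simp [ancPauli]

/-- Measurement of an ancilla. -/
def measGate (e : α ⊕ (βX ⊕ βZ) ≃ Fin N) (i : βX ⊕ βZ) : CliffordGate N :=
  .measure (ancPauli i) (ancPauli_ne i) (e (.inr i))

theorem resetGate_qubits (e : α ⊕ (βX ⊕ βZ) ≃ Fin N) (i : βX ⊕ βZ) :
    (resetGate e i).qubits = {e (.inr i)} := by
  rcases i with i | i <;> rfl

theorem resetGate_disjoint (e : α ⊕ (βX ⊕ βZ) ≃ Fin N) :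
    Pairwise fun i i' => Disjoint (resetGate e i).qubits (resetGate e i').qubits := by
  intro i i' h
  rw [resetGate_qubits, resetGate_qubits]
  simpa using h

theorem measGate_disjoint (e : α ⊕ (βX ⊕ βZ) ≃ Fin N) :
    Pairwise fun i i' => Disjoint (measGate e i).qubits (measGate e i').qubits := by
  intro i i' h
  simpa [measGate, CliffordGate.qubits] using h

/-- The data rows `A`, with the ancillas prepared in `|+⟩` and `|0⟩`. -/
def lift0 (e : α ⊕ (βX ⊕ βZ) ≃ Fin N) (A : Matrix (α → ZMod 2) Λ ℂ) :
    Matrix (Fin N → ZMod 2) Λ ℂ :=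
  fun u x => (if (fun d => u (e (.inr (.inr d)))) = 0 then 1 else 0)
    * A (fun c => u (e (.inl c))) x

/-- Entries are constant in the bits of ancillas in `|+⟩` and vanish unless ancillas in `|0⟩` have
bit 0. Hence `ω` is determined by its entries with all ancillas at 0, and these are read off from
the partial trace. -/
theorem exists_eq_sandwich_lift0 (e : α ⊕ (βX ⊕ βZ) ≃ Fin N)
    {ω : Matrix ((Fin N → ZMod 2) × R) ((Fin N → ZMod 2) × R) ℂ}
    (hX : ∀ b, InPlus (e (.inr (.inl b))) ω) (hZ : ∀ d, InZero (e (.inr (.inr d))) ω)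
    {A B : Matrix (α → ZMod 2) Λ ℂ} {ρ : Matrix (Λ × R) (Λ × R) ℂ} {z : ℂ}
    (h : dataTrace e ω = z • sandwich A B ρ) :
    ∃ z' : ℂ, ω = z' • sandwich (lift0 e A) (lift0 e B) ρ := by
  classical
  let I : Finset (Fin N) := Finset.univ.image fun b => e (.inr (.inl b))
  have hinv1 : ∀ i ∈ I, ∀ u s r u' r', ω (Function.update u i s, r) (u', r') = ω (u, r) (u', r') := by
    intro i hi u s r u' r'
    obtain ⟨b, -, rfl⟩ := Finset.mem_image.mp hi
    have := hX b u r u' r' s (u' (e (.inr (.inl b))))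
    rwa [Function.update_eq_self] at this
  have hinv2 : ∀ i ∈ I, ∀ u s r u' r', ω (u', r') (Function.update u i s, r) = ω (u', r') (u, r) := by
    intro i hi u s r u' r'
    obtain ⟨b, -, rfl⟩ := Finset.mem_image.mp hi
    have := hX b u' r' u r (u' (e (.inr (.inl b)))) s
    rwa [Function.update_eq_self] at this
  have hzero : ∀ p v p' v' r r', (fun d => v (.inr d)) = 0 → (fun d => v' (.inr d)) = 0 →
      ω (comb e p v, r) (comb e p' v', r') = ω (comb e p 0, r) (comb e p' 0, r') := by
    intro p v p' v' r r' hv hv'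
    have agree : ∀ (p : α → ZMod 2) (v : βX ⊕ βZ → ZMod 2), (fun d => v (.inr d)) = 0 →
        ∀ a ∉ I, comb e p v a = comb e p 0 a := by
      intro p v hv a ha
      obtain ⟨c | b | d, rfl⟩ := e.surjective a
      · simp
      · exact absurd (Finset.mem_image_of_mem _ (Finset.mem_univ b)) ha
      · simpa using congrFun hv d
    rw [eq_of_update_invariant (fun u => ω (u, r) (comb e p' v', r')) I
      (fun i hi u s => hinv1 i hi u s _ _ _) _ _ (agree p v hv)]
    exact eq_of_update_invariant (fun u => ω (comb e p 0, r) (u, r')) I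
      (fun i hi u s => hinv2 i hi u s _ _ _) _ _ (agree p' v' hv')
  have hvan : ∀ p v p' v' r r', ¬ ((fun d => v (.inr d)) = 0 ∧ (fun d => v' (.inr d)) = 0) →
      ω (comb e p v, r) (comb e p' v', r') = 0 := by
    intro p v p' v' r r' hn
    by_contra hne
    refine hn ⟨funext fun d => ?_, funext fun d => ?_⟩
    · simpa using (hZ d _ _ _ _ hne).1
    · simpa using (hZ d _ _ _ _ hne).2
  -- The number of ancilla configurations contributing to the partial trace; it is the normalisation
  -- that `lift0` omits.
  set κ : ℂ := ((Finset.univ.filter fun v : βX ⊕ βZ → ZMod 2 => (fun d => v (.inr d)) = 0).card : ℂ)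
    with hκ
  have hκ0 : κ ≠ 0 := by
    rw [hκ, Nat.cast_ne_zero, Finset.card_ne_zero]
    exact ⟨0, by simp; rfl⟩
  have htr : ∀ p p' r r', dataTrace e ω (p, r) (p', r') = κ * ω (comb e p 0, r) (comb e p' 0, r') := by
    intro p p' r r'
    rw [dataTrace, ← Finset.sum_filter_add_sum_filter_not _
      (fun v : βX ⊕ βZ → ZMod 2 => (fun d => v (.inr d)) = 0)]
    rw [Finset.sum_congr rfl (g := fun _ => ω (comb e p 0, r) (comb e p' 0, r'))
      (fun v hv => hzero p v p' v r r' (Finset.mem_filter.mp hv).2 (Finset.mem_filter.mp hv).2),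
      Finset.sum_eq_zero (s := Finset.univ.filter
        fun v : βX ⊕ βZ → ZMod 2 => ¬ (fun d => v (.inr d)) = 0)
      (fun v hv => hvan p v p' v r r' fun h => (Finset.mem_filter.mp hv).2 h.1)]
    simp [hκ]
  refine ⟨κ⁻¹ * z, ?_⟩
  funext q q'
  obtain ⟨u, r⟩ := q
  obtain ⟨u', r'⟩ := q'
  rw [← comb_self e u, ← comb_self e u']
  set p := fun c => u (e (.inl c))
  set p' := fun c => u' (e (.inl c))
  set v := fun d => u (e (.inr d)) with hv
  set v' := fun d => u' (e (.inr d)) with hv'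
  have hs : (sandwich (lift0 e A) (lift0 e B) ρ) (comb e p v, r) (comb e p' v', r')
      = (if (fun d => v (.inr d)) = 0 then 1 else 0) * (if (fun d => v' (.inr d)) = 0 then 1 else 0)
        * sandwich A B ρ (p, r) (p', r') := by
    simp only [sandwich_apply, lift0, comb_inl, comb_inr, Finset.mul_sum]
    refine Finset.sum_congr rfl fun x _ => Finset.sum_congr rfl fun y _ => ?_
    split_ifs <;> simp
  rw [Matrix.smul_apply, hs]
  by_cases h1 : (fun d => v (.inr d)) = 0 ∧ (fun d => v' (.inr d)) = 0
  · rw [if_pos h1.1, if_pos h1.2, hzero p v p' v' r r' h1.1 h1.2]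
    have h2 := htr p p' r r'
    rw [h, Matrix.smul_apply, smul_eq_mul] at h2
    rw [one_mul, one_mul, smul_eq_mul, mul_assoc, h2, inv_mul_cancel_left₀ hκ0]
  · rw [hvan p v p' v' r r' h1]
    by_cases h2 : (fun d => v (.inr d)) = 0
    · have h3 : ¬ (fun d => v' (.inr d)) = 0 := fun h3 => h1 ⟨h2, h3⟩
      rw [if_neg h3]; simp
    · rw [if_neg h2]; simp

theorem exists_resetLayer_act (e : α ⊕ (βX ⊕ βZ) ≃ Fin N) (hM : Fintype.card (βX ⊕ βZ) ≤ M)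
    {ω : Matrix ((Fin N → ZMod 2) × R) ((Fin N → ZMod 2) × R) ℂ}
    {A B : Matrix (α → ZMod 2) Λ ℂ} {ρ : Matrix (Λ × R) (Λ × R) ℂ} {z : ℂ}
    (h : dataTrace e ω = z • sandwich A B ρ) :
    ∃ z' : ℂ, (layerOf hM (resetGate e) (resetGate_disjoint e)).act (pureOn (fun _ => 1) ω)
      = pureOn (fun _ => 1) (z' • sandwich (lift0 e A) (lift0 e B) ρ) := by
  obtain ⟨ω', hω', htr, hX, hZ⟩ := layerOf_act_inv hM (resetGate e) (resetGate_disjoint e)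
    (fun s τ => ∃ ω' : Matrix ((Fin N → ZMod 2) × R) ((Fin N → ZMod 2) × R) ℂ,
      τ = pureOn (fun _ => 1) ω' ∧ dataTrace e ω' = dataTrace e ω ∧
      (∀ b, .inl b ∈ s → InPlus (e (.inr (.inl b))) ω') ∧
      (∀ d, .inr d ∈ s → InZero (e (.inr (.inr d))) ω')) (pureOn (fun _ => 1) ω)
    ⟨ω, rfl, rfl, by simp, by simp⟩ (by
      rintro s i _ his ⟨ω', rfl, htr, hX, hZ⟩
      rcases i with b₀ | d₀
      · refine ⟨resetP (e (.inr (.inl b₀))) ω', act_resetPlus _ _ _ rfl _, ?_, ?_, ?_⟩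
        · rw [dataTrace_resetP, htr]
        · intro b hb
          by_cases hbb : b = b₀
          · subst hbb; exact inPlus_resetP _ _
          · exact (hX b (by simpa [hbb] using hb)).resetP (by simpa using hbb)
        · intro d hd
          exact (hZ d (by simpa using hd)).resetP (by simp)
      · refine ⟨resetZ (e (.inr (.inr d₀))) ω', act_resetZero _ _ _ rfl _, ?_, ?_, ?_⟩
        · rw [dataTrace_resetZ, htr]
        · intro b hb
          exact (hX b (by simpa using hb)).resetZ (by simp)
        · intro d hd
          by_cases hdd : d = d₀
          · subst hdd; exact inZero_resetZ _ _
          · exact (hZ d (by simpa [hdd] using hd)).resetZ (by simpa using hdd))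
  obtain ⟨z', hz'⟩ := exists_eq_sandwich_lift0 e (fun b => hX b (Finset.mem_univ _))
    (fun d => hZ d (Finset.mem_univ _)) (htr.trans h)
  exact ⟨z', by rw [hω', hz']⟩

end Prepare

/-! ### Noisy states -/

section Noisy

variable {N M : ℕ} {R Λ : Type*} [Fintype R] [DecidableEq R] [Fintype Λ]

/-- `ω` is, up to a scalar which vanishes unless `C` holds, the sandwich of `A` and `B` corrupted
by Weyl operators with `X`-part in `XS` and `Z`-part in `ZS`. -/
def Noisy (C : Prop) (XS ZS : Set (Fin N)) (A B : Matrix (Fin N → ZMod 2) Λ ℂ)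
    (ρ : Matrix (Λ × R) (Λ × R) ℂ)
    (ω : Matrix ((Fin N → ZMod 2) × R) ((Fin N → ZMod 2) × R) ℂ) : Prop :=
  ∃ (a b a' b' : Fin N → ZMod 2) (z : ℂ), (∀ i, a i ≠ 0 → i ∈ XS) ∧ (∀ i, b i ≠ 0 → i ∈ ZS) ∧
    (∀ i, a' i ≠ 0 → i ∈ XS) ∧ (∀ i, b' i ≠ 0 → i ∈ ZS) ∧ (z ≠ 0 → C) ∧
    ω = z • sandwich (weylAct a b A) (weylAct a' b' B) ρ

variable {C : Prop} {XS ZS : Set (Fin N)} {A B : Matrix (Fin N → ZMod 2) Λ ℂ}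
    {ρ : Matrix (Λ × R) (Λ × R) ℂ}
    {ω : Matrix ((Fin N → ZMod 2) × R) ((Fin N → ZMod 2) × R) ℂ}

theorem noisy_self (z : ℂ) (hz : z ≠ 0 → C) : Noisy C XS ZS A B ρ (z • sandwich A B ρ) :=
  ⟨0, 0, 0, 0, z, by simp, by simp, by simp, by simp, hz, by simp [weylAct_zero]⟩

theorem add_ne_zero_imp {S : Set (Fin N)} {a b : Fin N → ZMod 2} (ha : ∀ i, a i ≠ 0 → i ∈ S)
    (hb : ∀ i, b i ≠ 0 → i ∈ S) : ∀ i, (a + b) i ≠ 0 → i ∈ S := by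
  intro i hi
  by_contra h
  have h1 : a i = 0 := by
    by_contra h'; exact h (ha i h')
  have h2 : b i = 0 := by
    by_contra h'; exact h (hb i h')
  exact hi (by simp [h1, h2])

theorem Noisy.fault (h : Noisy C XS ZS A B ρ ω) (F : PauliSuperop (Fin N))
    (hX : F.support ⊆ XS) (hZ : F.support ⊆ ZS) : Noisy C XS ZS A B ρ (F.apply ω) := by
  obtain ⟨a, b, a', b', z, h1, h2, h3, h4, hz, rfl⟩ := h
  have hl : ∀ i, (F.left i).xBit ≠ 0 ∨ (F.left i).zBit ≠ 0 → i ∈ F.support := by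
    intro i hi
    refine Or.inl fun h => ?_
    rw [h] at hi
    simp [Pauli.xBit, Pauli.zBit] at hi
  have hr : ∀ i, (F.right i).xBit ≠ 0 ∨ (F.right i).zBit ≠ 0 → i ∈ F.support := by
    intro i hi
    refine Or.inr fun h => ?_
    rw [h] at hi
    simp [Pauli.xBit, Pauli.zBit] at hi
  rw [PauliSuperop.apply_smul, PauliSuperop.apply_sandwich, pauliMat_mul, pauliMat_mul,
    weylAct_weylAct, weylAct_weylAct, smul_smul, smul_smul, sandwich_smul, smul_smul]
  exact ⟨_, _, _, _, _, add_ne_zero_imp (fun i hi => hX (hl i (Or.inl hi))) h1,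
    add_ne_zero_imp (fun i hi => hZ (hl i (Or.inr hi))) h2,
    add_ne_zero_imp (fun i hi => hX (hr i (Or.inl hi))) h3,
    add_ne_zero_imp (fun i hi => hZ (hr i (Or.inr hi))) h4,
    fun h => hz (left_ne_zero_of_mul h), rfl⟩

/-- The two hypotheses say that `XS` is closed under propagation from control to target and `ZS`
under the reverse; with such closed sets the bounds need no update from gate to gate. -/
theorem Noisy.cnot (h : Noisy C XS ZS A B ρ ω) {c t : Fin N} (hct : c ≠ t)
    (hX : c ∈ XS → t ∈ XS) (hZ : t ∈ ZS → c ∈ ZS) :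
    Noisy C XS ZS (cnotMat c t * A) (cnotMat c t * B) ρ (conjBy (cnotMat c t) ω) := by
  have key : ∀ {S : Set (Fin N)} {c t : Fin N} {a : Fin N → ZMod 2}, (c ∈ S → t ∈ S) →
      (∀ i, a i ≠ 0 → i ∈ S) → ∀ i, cnotAct c t a i ≠ 0 → i ∈ S := by
    intro S c t a hS ha
    refine add_ne_zero_imp ha fun i hi => ?_
    by_cases hit : i = t
    · subst hit
      exact hS (ha c (by simpa using hi))
    · simp [hit] at hi
  obtain ⟨a, b, a', b', z, h1, h2, h3, h4, hz, rfl⟩ := h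
  rw [conjBy_smul, conjBy_sandwich, cnotMat_mul_weylAct hct, cnotMat_mul_weylAct hct]
  exact ⟨_, _, _, _, _, key hX h1, key hZ h2, key hX h3, key hZ h4, hz, rfl⟩

/-- A correction passes the noise up to a sign, which goes into the scalar, so it acts on the ideal
states and leaves the noise unchanged. -/
theorem Noisy.weyl (h : Noisy C XS ZS A B ρ ω) {K : Matrix (Fin N → ZMod 2) (Fin N → ZMod 2) ℂ}
    {k l : Fin N → ZMod 2} (hK : ∀ A : Matrix (Fin N → ZMod 2) Λ ℂ, K * A = weylAct k l A) :
    Noisy C XS ZS (weylAct k l A) (weylAct k l B) ρ (conjBy K ω) := by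
  obtain ⟨a, b, a', b', z, h1, h2, h3, h4, hz, rfl⟩ := h
  have key : ∀ (a b : Fin N → ZMod 2) (A : Matrix (Fin N → ZMod 2) Λ ℂ),
      weylAct k l (weylAct a b A)
        = (sgn (l ⬝ᵥ a) * sgn (b ⬝ᵥ k)) • weylAct a b (weylAct k l A) := by
    intro a b A
    rw [weylAct_weylAct, weylAct_weylAct, smul_smul, mul_assoc, sgn_mul_self, mul_one,
      add_comm a, add_comm b]
  rw [conjBy_smul, conjBy_sandwich, hK, hK, key, key, sandwich_smul, smul_smul]
  exact ⟨a, b, a', b', _, h1, h2, h3, h4, fun h => hz (left_ne_zero_of_mul h), rfl⟩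

/-! ### Networks of controlled-not gates -/

variable {ι : Type*} [DecidableEq ι]

/-- The linear map of a network of controlled-not gates whose controls are not targets. -/
def shear (s : Finset ι) (c t : ι → Fin N) (u : Fin N → ZMod 2) : Fin N → ZMod 2 :=
  u + ∑ i ∈ s, Pi.single (t i) (u (c i))

theorem shear_apply (s : Finset ι) (c t : ι → Fin N) (u : Fin N → ZMod 2) (a : Fin N) :
    shear s c t u a = u a + ∑ i ∈ s, if t i = a then u (c i) else 0 := by
  simp only [shear, Pi.add_apply, Finset.sum_apply, Pi.single_apply, eq_comm]

theorem shear_apply_of_ne (s : Finset ι) (c t : ι → Fin N) (u : Fin N → ZMod 2) (a : Fin N)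
    (h : ∀ i, t i ≠ a) : shear s c t u a = u a := by
  rw [shear_apply]
  simp [h]

/-- Relabelling of the rows of a matrix. -/
def pull (g : (Fin N → ZMod 2) → (Fin N → ZMod 2)) (A : Matrix (Fin N → ZMod 2) Λ ℂ) :
    Matrix (Fin N → ZMod 2) Λ ℂ := fun u x => A (g u) x

theorem pull_shear_empty (c t : ι → Fin N) : pull (shear ∅ c t) A = A := by
  funext u x
  simp [pull, shear]

/-- Since no control is ever a target, earlier gates do not alter the control value; the network is
one shear, independent of the order of its gates. -/
theorem cnotMat_mul_pull_shear {c t : ι → Fin N} (hct : ∀ i j, c i ≠ t j) {s : Finset ι} {i : ι}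
    (hi : i ∉ s) :
    cnotMat (c i) (t i) * pull (shear s c t) A = pull (shear (insert i s) c t) A := by
  funext u x
  rw [cnotMat_mul (hct i i)]
  simp only [pull]
  congr 1
  rw [shear, shear, Finset.sum_insert hi, cnotAct, ← add_assoc]
  congr 1
  refine Finset.sum_congr rfl fun j _ => ?_
  simp [Pi.single_eq_of_ne (hct j i)]

variable [Fintype ι]

/-- The gates of a given colour in a network of controlled-not gates. -/
def cnotLayer (hM : Fintype.card ι ≤ M) (E : Finset ι) (c t : ι → Fin N)
    (hct : ∀ i j, c i ≠ t j) (col : ι → ℕ)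
    (hcol : ∀ i ∈ E, ∀ j ∈ E, i ≠ j → col i = col j → c i ≠ c j ∧ t i ≠ t j) (k : ℕ) :
    CliffordLayer N M :=
  layerOf (ι := {i // i ∈ E ∧ col i = k}) ((Fintype.card_subtype_le _).trans hM)
    (fun i => .cnot (c i) (t i) (hct _ _)) (by
      rintro ⟨i, hi, hik⟩ ⟨j, hj, hjk⟩ hij
      have h := hcol i hi j hj (fun h => hij (Subtype.ext h)) (hik.trans hjk.symm)
      simp only [CliffordGate.qubits, Set.disjoint_insert_left, Set.disjoint_singleton_left,
        Set.mem_insert_iff, Set.mem_singleton_iff, not_or]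
      exact ⟨⟨h.1, hct _ _⟩, (hct _ _).symm, h.2⟩)

theorem exists_cnotLayer_act (hM : Fintype.card ι ≤ M) (E : Finset ι) (c t : ι → Fin N)
    (hct : ∀ i j, c i ≠ t j) (col : ι → ℕ)
    (hcol : ∀ i ∈ E, ∀ j ∈ E, i ≠ j → col i = col j → c i ≠ c j ∧ t i ≠ t j) (k : ℕ)
    (hX : ∀ i ∈ E, c i ∈ XS → t i ∈ XS) (hZ : ∀ i ∈ E, t i ∈ ZS → c i ∈ ZS)
    (h : Noisy C XS ZS (pull (shear (E.filter (col · < k)) c t) A)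
      (pull (shear (E.filter (col · < k)) c t) B) ρ ω) :
    ∃ ω', (cnotLayer hM E c t hct col hcol k).act (pureOn (fun _ => 1) ω)
        = pureOn (fun _ => 1) ω' ∧
      Noisy C XS ZS (pull (shear (E.filter (col · < k + 1)) c t) A)
        (pull (shear (E.filter (col · < k + 1)) c t) B) ρ ω' := by
  have := layerOf_act_inv (R := R) (ι := {i // i ∈ E ∧ col i = k})
    ((Fintype.card_subtype_le _).trans hM)
    (fun i => CliffordGate.cnot (c i) (t i) (hct _ _)) (by
      rintro ⟨i, hi, hik⟩ ⟨j, hj, hjk⟩ hij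
      have h := hcol i hi j hj (fun h => hij (Subtype.ext h)) (hik.trans hjk.symm)
      simp only [CliffordGate.qubits, Set.disjoint_insert_left, Set.disjoint_singleton_left,
        Set.mem_insert_iff, Set.mem_singleton_iff, not_or]
      exact ⟨⟨h.1, hct _ _⟩, (hct _ _).symm, h.2⟩)
    -- Inside the layer of colour `k`, the completed gates are those of smaller colour together with
    -- the part `s` of colour `k`.
    (fun s τ => ∃ ω', τ = pureOn (fun _ => 1) ω' ∧
      Noisy C XS ZS (pull (shear (E.filter (col · < k) ∪ s.map (Function.Embedding.subtype _)) c t) A)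
        (pull (shear (E.filter (col · < k) ∪ s.map (Function.Embedding.subtype _)) c t) B) ρ ω')
    (pureOn (fun _ => 1) ω) ⟨ω, rfl, by simpa using h⟩ (by
      rintro s i _ hi ⟨ω', rfl, hω'⟩
      refine ⟨_, act_cnot _ _ (hct _ _) _ _ rfl _, ?_⟩
      have hnot : (i : ι) ∉ E.filter (col · < k) ∪ s.map (Function.Embedding.subtype _) := by
        rw [Finset.mem_union, not_or]
        refine ⟨fun h' => ?_, fun h' => hi ?_⟩
        · have := (Finset.mem_filter.mp h').2
          have := i.2.2
          omega
        · obtain ⟨j, hj, hji⟩ := Finset.mem_map.mp h'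
          rwa [← Subtype.ext (p := fun i => i ∈ E ∧ col i = k) (a1 := j) (a2 := i) hji]
      rw [Finset.map_insert, Finset.union_insert]
      have := hω'.cnot (hct i i) (hX i i.2.1) (hZ i i.2.1)
      rwa [cnotMat_mul_pull_shear hct hnot, cnotMat_mul_pull_shear hct hnot] at this)
  have hE : E.filter (col · < k) ∪ (Finset.univ : Finset {i // i ∈ E ∧ col i = k}).map
      (Function.Embedding.subtype _) = E.filter (col · < k + 1) := by
    ext i
    simp only [Finset.mem_union, Finset.mem_filter, Finset.mem_map, Finset.mem_univ, true_and,
      Function.Embedding.subtype_apply, Subtype.exists, exists_prop, exists_eq_right]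
    constructor
    · rintro (⟨h, h'⟩ | ⟨h, h'⟩)
      · exact ⟨h, by omega⟩
      · exact ⟨h, by omega⟩
    · rintro ⟨h, h'⟩
      by_cases hk : col i = k
      · exact Or.inr ⟨h, hk⟩
      · exact Or.inl ⟨h, by omega⟩
  rw [hE] at this
  exact this

end Noisy

/-! ### Measurements and corrections -/

section Correct

variable {N M : ℕ} {α βX βZ : Type*} [Fintype α] [Fintype βX] [Fintype βZ] [DecidableEq α]
  [DecidableEq βX] [DecidableEq βZ] {R Λ : Type*} [Fintype R] [DecidableEq R] [Fintype Λ]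

/-- All measurements are deterministic, so the register stays in one basis state. It records the
left syndrome, and the scalar survives only if the right syndrome is the same. -/
theorem exists_measLayer_act (e : α ⊕ (βX ⊕ βZ) ≃ Fin N) (hM : Fintype.card (βX ⊕ βZ) ≤ M)
    (x₀ : Fin M → ZMod 2) {A B : Matrix (Fin N → ZMod 2) Λ ℂ} (ρ : Matrix (Λ × R) (Λ × R) ℂ)
    {s s' : βX ⊕ βZ → ZMod 2}
    (hA : ∀ i, onQubit (e (.inr i)) (ancPauli i).mat * A = sgn (s i) • A)
    (hB : ∀ i, onQubit (e (.inr i)) (ancPauli i).mat * B = sgn (s' i) • B) (z : ℂ) :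
    ∃ (x₁ : Fin M → ZMod 2) (z' : ℂ),
      (layerOf hM (measGate e) (measGate_disjoint e)).act (pureOn x₀ (z • sandwich A B ρ))
        = pureOn x₁ (z' • sandwich A B ρ) ∧
      (∀ i, x₁ (layerBit hM i) = s i) ∧ (z' ≠ 0 → s = s') := by
  obtain ⟨x₁, z', h1, h2, h3⟩ := layerOf_act_inv hM (measGate e) (measGate_disjoint e)
    (fun S τ => ∃ (x₁ : Fin M → ZMod 2) (z' : ℂ), τ = pureOn x₁ (z' • sandwich A B ρ) ∧
      (∀ i ∈ S, x₁ (layerBit hM i) = s i) ∧ (z' ≠ 0 → ∀ i ∈ S, s i = s' i))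
    (pureOn x₀ (z • sandwich A B ρ)) ⟨x₀, z, rfl, by simp, by simp⟩ (by
      rintro S i _ hi ⟨x₁, z', rfl, h1, h2⟩
      refine ⟨_, _, act_measure_of_eigen _ _ _ _ _ (hA i) (hB i) _ _, ?_, ?_⟩
      · intro j hj
        by_cases hji : j = i
        · subst hji; simp
        · rw [Function.update_of_ne fun h => hji (layerBit_injective hM h)]
          exact h1 j (Finset.mem_of_mem_insert_of_ne hj hji)
      · intro hz j hj
        have hss : s i = s' i := by
          by_contra h; exact hz (if_neg h)
        rw [if_pos hss] at hz
        rcases Finset.mem_insert.mp hj with rfl | hj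
        · exact hss
        · exact h2 hz j hj)
  exact ⟨x₁, z', h1, fun i => h2 i (Finset.mem_univ _),
    fun hz => funext fun i => h3 hz i (Finset.mem_univ _)⟩

/-- A layer of Pauli gates on the data qubits. -/
def pauliLayer (e : α ⊕ (βX ⊕ βZ) ≃ Fin N) (hM : Fintype.card α ≤ M) (P : Pauli) :
    CliffordLayer N M :=
  layerOf hM (fun c => .pauli P (e (.inl c))) (by
    intro c c' h
    simpa [CliffordGate.qubits] using h)

/-- The pair `(px, pz)` treats `X`-corrections `(1, 0)` and `Z`-corrections `(0, 1)` at once. -/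
theorem exists_pauliLayer_act {C : Prop} {XS ZS : Set (Fin N)}
    {A B : Matrix (Fin N → ZMod 2) Λ ℂ} {ρ : Matrix (Λ × R) (Λ × R) ℂ}
    {ω : Matrix ((Fin N → ZMod 2) × R) ((Fin N → ZMod 2) × R) ℂ}
    (e : α ⊕ (βX ⊕ βZ) ≃ Fin N) (hM : Fintype.card α ≤ M) (P : Pauli) {px pz : ZMod 2}
    (hP : ∀ (a : Fin N) (A : Matrix (Fin N → ZMod 2) Λ ℂ),
      onQubit a P.mat * A = weylAct (Pi.single a px) (Pi.single a pz) A)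
    (x₀ : Fin M → ZMod 2) (v : α → ZMod 2) (hv : ∀ c, x₀ (layerBit hM c) = v c)
    (h : Noisy C XS ZS A B ρ ω) :
    ∃ ω', (pauliLayer e hM P).act (pureOn x₀ ω) = pureOn x₀ ω' ∧
      Noisy C XS ZS (weylAct (comb e (px • v) 0) (comb e (pz • v) 0) A)
        (weylAct (comb e (px • v) 0) (comb e (pz • v) 0) B) ρ ω' := by
  have := layerOf_act_inv (R := R) hM (fun c => CliffordGate.pauli P (e (.inl c))) (by
    intro c c' h
    simpa [CliffordGate.qubits] using h)
    (fun S τ => ∃ ω', τ = pureOn x₀ ω' ∧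
      Noisy C XS ZS
        (weylAct (∑ c ∈ S, Pi.single (e (.inl c)) (px * v c))
          (∑ c ∈ S, Pi.single (e (.inl c)) (pz * v c)) A)
        (weylAct (∑ c ∈ S, Pi.single (e (.inl c)) (px * v c))
          (∑ c ∈ S, Pi.single (e (.inl c)) (pz * v c)) B) ρ ω')
    (pureOn x₀ ω) ⟨ω, rfl, by simpa [weylAct_zero] using h⟩ (by
      rintro S c _ hc ⟨ω', rfl, hω'⟩
      refine ⟨_, act_pauli _ _ _ _ _, ?_⟩
      rw [hv c, Finset.sum_insert hc, Finset.sum_insert hc]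
      rcases zmod2_cases (v c) with h0 | h1
      · rw [if_neg (by rw [h0]; decide), h0]
        simpa using hω'
      · rw [if_pos h1, h1]
        have := hω'.weyl (hP (e (.inl c)))
        -- The new gate acts on a qubit not yet corrected in this layer, so no sign arises.
        have hd : (Pi.single (e (.inl c)) pz : Fin N → ZMod 2) ⬝ᵥ
            (∑ c ∈ S, Pi.single (e (.inl c)) (px * v c)) = 0 := by
          rw [single_dotProduct]
          have : (∑ c ∈ S, Pi.single (e (.inl c)) (px * v c) : Fin N → ZMod 2) (e (.inl c)) = 0 := by
            rw [Finset.sum_apply]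
            refine Finset.sum_eq_zero fun c' hc' => ?_
            rw [Pi.single_eq_of_ne]
            intro h
            have : c = c' := by simpa using h
            exact hc (this ▸ hc')
          rw [this, mul_zero]
        rw [weylAct_weylAct, weylAct_weylAct, hd, sgn_zero, one_smul, one_smul] at this
        simpa using this)
  have hsum : ∀ p : ZMod 2, (∑ c, Pi.single (e (.inl c)) (p * v c) : Fin N → ZMod 2)
      = comb e (p • v) 0 := by
    intro p
    refine ext_of_equiv e (fun c => ?_) (fun d => ?_)
    · rw [Finset.sum_apply, Finset.sum_eq_single c]
      · simp
      · intro c' _ hc'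
        rw [Pi.single_eq_of_ne]
        simpa using Ne.symm hc'
      · simp
    · rw [Finset.sum_apply]
      simp
  rw [hsum, hsum] at this
  exact this

end Correct

/-! ### Coupling of the ancillas and ideal syndromes -/

section Syndrome

variable {N M : ℕ} {α βX βZ : Type*} [Fintype α] [Fintype βX] [Fintype βZ] [DecidableEq α]
  [DecidableEq βX] [DecidableEq βZ] {R Λ : Type*} [Fintype R] [DecidableEq R] [Fintype Λ]

/-- The columns of `Enc` are supported on the kernel of `HZ` and invariant under the row space of
`HX`. -/
def IsEncoding (HX : Matrix βX α (ZMod 2)) (HZ : Matrix βZ α (ZMod 2))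
    (Enc : Matrix (α → ZMod 2) Λ ℂ) : Prop :=
  (∀ y x, Enc y x ≠ 0 → HZ *ᵥ y = 0) ∧ ∀ y v x, Enc (y + HXᵀ *ᵥ v) x = Enc y x

/-- Control of the gates coupling the ancillas of the `X`-checks to the data. -/
def ctlX (e : α ⊕ (βX ⊕ βZ) ≃ Fin N) (i : βX × α) : Fin N := e (.inr (.inl i.1))

/-- Target of the gates coupling the ancillas of the `X`-checks to the data. -/
def tgtX (e : α ⊕ (βX ⊕ βZ) ≃ Fin N) (i : βX × α) : Fin N := e (.inl i.2)

/-- Control of the gates coupling the data to the ancillas of the `Z`-checks. -/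
def ctlZ (e : α ⊕ (βX ⊕ βZ) ≃ Fin N) (i : βZ × α) : Fin N := e (.inl i.2)

/-- Target of the gates coupling the data to the ancillas of the `Z`-checks. -/
def tgtZ (e : α ⊕ (βX ⊕ βZ) ≃ Fin N) (i : βZ × α) : Fin N := e (.inr (.inr i.1))

theorem ctlX_ne_tgtX (e : α ⊕ (βX ⊕ βZ) ≃ Fin N) (i j : βX × α) : ctlX e i ≠ tgtX e j := by
  simp [ctlX, tgtX]

theorem ctlZ_ne_tgtZ (e : α ⊕ (βX ⊕ βZ) ≃ Fin N) (i j : βZ × α) : ctlZ e i ≠ tgtZ e j := by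
  simp [ctlZ, tgtZ]

/-- The incident pairs of a check matrix. -/
def edges {β : Type*} [Fintype β] (H : Matrix β α (ZMod 2)) : Finset (β × α) :=
  Finset.univ.filter fun i => H i.1 i.2 ≠ 0

theorem sum_edges {β : Type*} [Fintype β] (H : Matrix β α (ZMod 2)) (f : β × α → ZMod 2) :
    ∑ i ∈ edges H, f i = ∑ b, ∑ c, H b c * f (b, c) := by
  rw [edges, Finset.sum_filter, Fintype.sum_prod_type]
  refine Finset.sum_congr rfl fun b _ => Finset.sum_congr rfl fun c _ => ?_
  rcases zmod2_cases (H b c) with h | h <;> simp [h]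

theorem shearX_data (e : α ⊕ (βX ⊕ βZ) ≃ Fin N) (HX : Matrix βX α (ZMod 2)) (u : Fin N → ZMod 2)
    (c : α) : shear (edges HX) (ctlX e) (tgtX e) u (e (.inl c))
      = u (e (.inl c)) + (HXᵀ *ᵥ fun b => u (e (.inr (.inl b)))) c := by
  rw [shear_apply, sum_edges]
  congr 1
  simp [tgtX, ctlX, Matrix.mulVec, dotProduct]

theorem shearX_ancZ (e : α ⊕ (βX ⊕ βZ) ≃ Fin N) (HX : Matrix βX α (ZMod 2)) (u : Fin N → ZMod 2)
    (d : βX ⊕ βZ) : shear (edges HX) (ctlX e) (tgtX e) u (e (.inr d)) = u (e (.inr d)) :=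
  shear_apply_of_ne _ _ _ _ _ fun i => by simp [tgtX]

theorem shearZ_ancZ (e : α ⊕ (βX ⊕ βZ) ≃ Fin N) (HZ : Matrix βZ α (ZMod 2)) (u : Fin N → ZMod 2)
    (d : βZ) : shear (edges HZ) (ctlZ e) (tgtZ e) u (e (.inr (.inr d)))
      = u (e (.inr (.inr d))) + (HZ *ᵥ fun c => u (e (.inl c))) d := by
  rw [shear_apply, sum_edges]
  congr 1
  simp only [tgtZ, ctlZ, Matrix.mulVec, dotProduct, EmbeddingLike.apply_eq_iff_eq, Sum.inr.injEq]
  rw [Finset.sum_eq_single d]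
  · simp
  · intro d' _ h
    simp [h]
  · simp

theorem shearZ_data (e : α ⊕ (βX ⊕ βZ) ≃ Fin N) (HZ : Matrix βZ α (ZMod 2)) (u : Fin N → ZMod 2)
    (c : α) : shear (edges HZ) (ctlZ e) (tgtZ e) u (e (.inl c)) = u (e (.inl c)) :=
  shear_apply_of_ne _ _ _ _ _ fun i => by simp [tgtZ]

theorem shearZ_ancX (e : α ⊕ (βX ⊕ βZ) ≃ Fin N) (HZ : Matrix βZ α (ZMod 2)) (u : Fin N → ZMod 2)
    (b : βX) : shear (edges HZ) (ctlZ e) (tgtZ e) u (e (.inr (.inl b))) = u (e (.inr (.inl b))) :=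
  shear_apply_of_ne _ _ _ _ _ fun i => by simp [tgtZ]

/-- The state after the network of controlled-not gates. -/
def coupled (e : α ⊕ (βX ⊕ βZ) ≃ Fin N) (HX : Matrix βX α (ZMod 2)) (HZ : Matrix βZ α (ZMod 2))
    (A : Matrix (α → ZMod 2) Λ ℂ) : Matrix (Fin N → ZMod 2) Λ ℂ :=
  pull (shear (edges HZ) (ctlZ e) (tgtZ e)) (pull (shear (edges HX) (ctlX e) (tgtX e)) (lift0 e A))

theorem add_eq_zero_iff_zmod {ι : Type*} (x y : ι → ZMod 2) : x + y = 0 ↔ x = y := by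
  constructor
  · intro h
    have : x + y + y = y := by rw [h, zero_add]
    rwa [add_assoc, add_self_zmod, add_zero] at this
  · rintro rfl
    exact add_self_zmod x

/-- Undoing both shears evaluates `Enc` at `ud + a + HXᵀ ux`. Invariance under the row space of `HX`
removes the last term but leaves the sign `(HX b) · ux`; the support condition turns the requirement
on the `Z`-ancillas into `uz = HZ a`. Thus the data keep their error, while the ancillas form a
product state encoding both syndromes. -/
theorem coupled_apply (e : α ⊕ (βX ⊕ βZ) ≃ Fin N) {HX : Matrix βX α (ZMod 2)}
    {HZ : Matrix βZ α (ZMod 2)} {Enc : Matrix (α → ZMod 2) Λ ℂ} (hE : IsEncoding HX HZ Enc)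
    (a b : α → ZMod 2) (u : Fin N → ZMod 2) (x : Λ) :
    coupled e HX HZ (weylAct a b Enc) u x
      = ((if (fun d => u (e (.inr (.inr d)))) = HZ *ᵥ a then 1 else 0)
        * sgn ((HX *ᵥ b) ⬝ᵥ fun b => u (e (.inr (.inl b)))))
        * weylAct a b Enc (fun c => u (e (.inl c))) x := by
  have h1 : (fun c => shear (edges HX) (ctlX e) (tgtX e)
      (shear (edges HZ) (ctlZ e) (tgtZ e) u) (e (.inl c)))
      = (fun c => u (e (.inl c))) + HXᵀ *ᵥ fun b => u (e (.inr (.inl b))) := by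
    funext c
    rw [shearX_data, shearZ_data, Pi.add_apply]
    simp only [shearZ_ancX]
  have h2 : (fun d => shear (edges HX) (ctlX e) (tgtX e)
      (shear (edges HZ) (ctlZ e) (tgtZ e) u) (e (.inr (.inr d))))
      = (fun d => u (e (.inr (.inr d)))) + HZ *ᵥ fun c => u (e (.inl c)) := by
    funext d
    rw [shearX_ancZ, shearZ_ancZ, Pi.add_apply]
  rw [coupled, pull, pull, lift0, h1, h2]
  set ud := fun c => u (e (.inl c))
  set ux := fun b => u (e (.inr (.inl b)))
  set uz := fun d => u (e (.inr (.inr d)))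
  simp only [weylAct]
  have h3 : ud + HXᵀ *ᵥ ux + a = ud + a + HXᵀ *ᵥ ux := by abel
  rw [h3, hE.2]
  by_cases h0 : Enc (ud + a) x = 0
  · simp [h0]
  · have h4 := hE.1 _ _ h0
    rw [Matrix.mulVec_add, add_eq_zero_iff_zmod] at h4
    have h5 : b ⬝ᵥ HXᵀ *ᵥ ux = (HX *ᵥ b) ⬝ᵥ ux := by
      rw [Matrix.dotProduct_mulVec, Matrix.vecMul_transpose]
    have h6 : (uz + HZ *ᵥ ud = 0) = (uz = HZ *ᵥ a) := by rw [add_eq_zero_iff_zmod, h4]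
    simp only [h6, dotProduct_add b (ud + a), sgn_add, h5]
    ring

theorem coupled_factors (e : α ⊕ (βX ⊕ βZ) ≃ Fin N) {HX : Matrix βX α (ZMod 2)}
    {HZ : Matrix βZ α (ZMod 2)} {Enc : Matrix (α → ZMod 2) Λ ℂ} (hE : IsEncoding HX HZ Enc)
    (a b : α → ZMod 2) : Factors e (coupled e HX HZ (weylAct a b Enc)) (weylAct a b Enc) :=
  ⟨fun v => (if (fun d => v (.inr d)) = HZ *ᵥ a then 1 else 0)
    * sgn ((HX *ᵥ b) ⬝ᵥ fun b => v (.inl b)), fun p v x => by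
      rw [coupled_apply e hE]
      simp⟩

/-- The syndrome bit is the ideal one plus the part of the accumulated noise on that ancilla that
anticommutes with the measured operator: `Z`-part for `X`-checks, `X`-part for `Z`-checks. -/
theorem measure_coupled (e : α ⊕ (βX ⊕ βZ) ≃ Fin N) {HX : Matrix βX α (ZMod 2)}
    {HZ : Matrix βZ α (ZMod 2)} {Enc : Matrix (α → ZMod 2) Λ ℂ} (hE : IsEncoding HX HZ Enc)
    (a b : α → ZMod 2) (n n' : Fin N → ZMod 2) (i : βX ⊕ βZ) :
    onQubit (e (.inr i)) (ancPauli i).mat * weylAct n n' (coupled e HX HZ (weylAct a b Enc))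
      = sgn (Sum.elim (HX *ᵥ b + fun b => n' (e (.inr (.inl b))))
          (HZ *ᵥ a + fun d => n (e (.inr (.inr d)))) i)
        • weylAct n n' (coupled e HX HZ (weylAct a b Enc)) := by
  rcases i with b₀ | d₀
  · refine onQubit_X_mul_weylAct (s := (HX *ᵥ b) b₀) ?_ n n'
    rw [onQubit_X_mul]
    funext u x
    rw [weylAct, Matrix.smul_apply, coupled_apply e hE, coupled_apply e hE]
    have h1 : (fun c => (u + Pi.single (e (.inr (.inl b₀))) 1 : Fin N → ZMod 2) (e (.inl c)))
        = fun c => u (e (.inl c)) := by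
      funext c; simp
    have h2 : (fun d => (u + Pi.single (e (.inr (.inl b₀))) 1 : Fin N → ZMod 2) (e (.inr (.inr d))))
        = fun d => u (e (.inr (.inr d))) := by
      funext c; simp
    have h3 : (fun b => (u + Pi.single (e (.inr (.inl b₀))) 1 : Fin N → ZMod 2) (e (.inr (.inl b))))
        = (fun b => u (e (.inr (.inl b)))) + Pi.single b₀ 1 := by
      funext c
      by_cases h : c = b₀
      · subst h; simp
      · simp [h]
    rw [h1, h2, h3, dotProduct_add (HX *ᵥ b), sgn_add, zero_dotProduct, sgn_zero,
      dotProduct_single, mul_one, smul_eq_mul]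
    ring
  · refine onQubit_Z_mul_weylAct (s := (HZ *ᵥ a) d₀) ?_ n n'
    rw [onQubit_Z_mul]
    funext u x
    rw [weylAct, Matrix.smul_apply, add_zero, coupled_apply e hE]
    by_cases h : (fun d => u (e (.inr (.inr d)))) = HZ *ᵥ a
    · have := congrFun h d₀
      rw [single_dotProduct, one_mul, this, smul_eq_mul]
    · simp [h]

end Syndrome

/-! ### The error-correction circuit -/

section Circuit

variable {N : ℕ} {α βX βZ : Type*} [Fintype α] [Fintype βX] [Fintype βZ] [DecidableEq α]
  [DecidableEq βX] [DecidableEq βZ]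

/-- A schedule of the gates coupling checks to data. -/
structure Schedule {β : Type*} [Fintype β] (H : Matrix β α (ZMod 2)) (D : ℕ) where
  col : β × α → ℕ
  col_lt : ∀ i ∈ edges H, col i < D
  col_ne : ∀ i ∈ edges H, ∀ j ∈ edges H, i ≠ j → col i = col j → i.1 ≠ j.1 ∧ i.2 ≠ j.2

variable {HX : Matrix βX α (ZMod 2)} {HZ : Matrix βZ α (ZMod 2)} {D : ℕ}

/-- The number of classical bits used by the circuit. -/
def bits (N : ℕ) (α βX βZ : Type*) [Fintype α] [Fintype βX] [Fintype βZ] : ℕ :=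
  N + Fintype.card α + Fintype.card (βX ⊕ βZ) + Fintype.card (βX × α) + Fintype.card (βZ × α)

theorem card_data_le : Fintype.card α ≤ bits N α βX βZ := by unfold bits; omega

theorem card_anc_le : Fintype.card (βX ⊕ βZ) ≤ bits N α βX βZ := by unfold bits; omega

theorem card_edgeX_le : Fintype.card (βX × α) ≤ bits N α βX βZ := by unfold bits; omega

theorem card_edgeZ_le : Fintype.card (βZ × α) ≤ bits N α βX βZ := by unfold bits; omega

/-- A classical bit storing the `Z`-correction of a data qubit. -/
def storeBit (e : α ⊕ (βX ⊕ βZ) ≃ Fin N) (c : α) : Fin (bits N α βX βZ) :=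
  ⟨Fintype.card α + e (.inl c), by
    have := (e (.inl c)).2
    unfold bits
    omega⟩

theorem storeBit_injective (e : α ⊕ (βX ⊕ βZ) ≃ Fin N) : Function.Injective (storeBit e) := by
  intro c c' h
  have := Fin.mk.inj_iff.mp h
  have h' : e (.inl c) = e (.inl c') := Fin.ext (by omega)
  simpa using h'

/-- Storage starts at bit `card α`, just above the bits that control a layer of data gates. -/
theorem dataBits_injective (e : α ⊕ (βX ⊕ βZ) ≃ Fin N) :
    Function.Injective (Sum.elim (layerBit (card_data_le (N := N) (α := α) (βX := βX) (βZ := βZ)))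
      (storeBit e)) := by
  refine (layerBit_injective _).sumElim (storeBit_injective e) fun c c' h => ?_
  have h1 := congrArg Fin.val h
  have h2 := (Fintype.equivFin α c).2
  simp only [layerBit, storeBit, Fin.val_castLE] at h1
  omega

/-- The layers of the error-correction circuit. -/
def ecLayer (e : α ⊕ (βX ⊕ βZ) ≃ Fin N) (sX : Schedule HX D) (sZ : Schedule HZ D) (t : ℕ) :
    CliffordLayer N (bits N α βX βZ) :=
  if t = 0 then layerOf card_anc_le (resetGate e) (resetGate_disjoint e)
  else if t ≤ D then
    cnotLayer card_edgeX_le (edges HX) (ctlX e) (tgtX e) (ctlX_ne_tgtX e) sX.col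
      (fun i hi j hj hij h => by
        have := sX.col_ne i hi j hj hij h
        exact ⟨by simpa [ctlX] using this.1, by simpa [tgtX] using this.2⟩) (t - 1)
  else if t ≤ 2 * D then
    cnotLayer card_edgeZ_le (edges HZ) (ctlZ e) (tgtZ e) (ctlZ_ne_tgtZ e) sZ.col
      (fun i hi j hj hij h => by
        have := sZ.col_ne i hi j hj hij h
        exact ⟨by simpa [ctlZ] using this.2, by simpa [tgtZ] using this.1⟩) (t - 1 - D)
  else if t = 2 * D + 1 then layerOf card_anc_le (measGate e) (measGate_disjoint e)
  else if t = 2 * D + 2 then pauliLayer e card_data_le .X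
  else pauliLayer e card_data_le .Z

/-- The classical computations of the error-correction circuit. -/
def ecClassical (D : ℕ) (e : α ⊕ (βX ⊕ βZ) ≃ Fin N) (decX : (βZ → ZMod 2) → (α → ZMod 2))
    (decZ : (βX → ZMod 2) → (α → ZMod 2)) (t : ℕ) (x : Fin (bits N α βX βZ) → ZMod 2) :
    Fin (bits N α βX βZ) → ZMod 2 :=
  -- Resets and couplings fire only on control bit 1, so all bits are set to 1. At `2 * D + 2` the
  -- measured syndromes are still in the register: `decX` is loaded for immediate use and `decZ`
  -- saved for the last timestep.
  if t ≤ 2 * D + 1 then fun _ => 1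
  else if t = 2 * D + 2 then
    Function.extend (Sum.elim (layerBit card_data_le) (storeBit e))
      (Sum.elim (decX fun d => x (layerBit card_anc_le (.inr d)))
        (decZ fun b => x (layerBit card_anc_le (.inl b)))) 0
  else Function.extend (layerBit card_data_le) (fun c => x (storeBit e c)) 0

/-- The error-correction circuit: ancilla preparation, coupling to the `X`-checks and to the
`Z`-checks, measurement, and correction. -/
def ecCircuit (e : α ⊕ (βX ⊕ βZ) ≃ Fin N) (sX : Schedule HX D) (sZ : Schedule HZ D)
    (decX : (βZ → ZMod 2) → (α → ZMod 2)) (decZ : (βX → ZMod 2) → (α → ZMod 2)) :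
    AdaptiveCliffordCircuit N (bits N α βX βZ) (2 * D + 4) where
  space_le := by unfold bits; omega
  classical := fun t => ecClassical D e decX decZ t
  layer := fun t => ecLayer e sX sZ t

variable {R Λ : Type*} [Fintype R] [DecidableEq R] [Fintype Λ]

/-- The ideal state before timestep `n + 1`. -/
def idealAt (e : α ⊕ (βX ⊕ βZ) ≃ Fin N) (sX : Schedule HX D) (sZ : Schedule HZ D) (n : ℕ)
    (A : Matrix (α → ZMod 2) Λ ℂ) : Matrix (Fin N → ZMod 2) Λ ℂ :=
  -- Truncated subtraction keeps the set of completed `Z`-couplings empty as long as `n ≤ D`.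
  pull (shear ((edges HZ).filter (sZ.col · < n - D)) (ctlZ e) (tgtZ e))
    (pull (shear ((edges HX).filter (sX.col · < n)) (ctlX e) (tgtX e)) (lift0 e A))

theorem idealAt_zero (e : α ⊕ (βX ⊕ βZ) ≃ Fin N) (sX : Schedule HX D) (sZ : Schedule HZ D)
    (A : Matrix (α → ZMod 2) Λ ℂ) : idealAt e sX sZ 0 A = lift0 e A := by
  simp [idealAt, pull_shear_empty]

theorem idealAt_of_le (e : α ⊕ (βX ⊕ βZ) ≃ Fin N) (sX : Schedule HX D) (sZ : Schedule HZ D) {n : ℕ}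
    (hn : n ≤ D) (A : Matrix (α → ZMod 2) Λ ℂ) : idealAt e sX sZ n A
      = pull (shear ((edges HX).filter (sX.col · < n)) (ctlX e) (tgtX e)) (lift0 e A) := by
  simp [idealAt, Nat.sub_eq_zero_of_le hn, pull_shear_empty]

theorem idealAt_of_ge (e : α ⊕ (βX ⊕ βZ) ≃ Fin N) (sX : Schedule HX D) (sZ : Schedule HZ D) {n : ℕ}
    (hn : D ≤ n) (A : Matrix (α → ZMod 2) Λ ℂ) : idealAt e sX sZ n A
      = pull (shear ((edges HZ).filter (sZ.col · < n - D)) (ctlZ e) (tgtZ e))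
        (pull (shear (edges HX) (ctlX e) (tgtX e)) (lift0 e A)) := by
  rw [idealAt, Finset.filter_true_of_mem (s := edges HX)]
  intro i hi
  have := sX.col_lt i hi
  omega

theorem idealAt_final (e : α ⊕ (βX ⊕ βZ) ≃ Fin N) (sX : Schedule HX D) (sZ : Schedule HZ D)
    (A : Matrix (α → ZMod 2) Λ ℂ) : idealAt e sX sZ (2 * D) A = coupled e HX HZ A := by
  rw [idealAt_of_ge e sX sZ (by omega), coupled, Finset.filter_true_of_mem (s := edges HZ)]
  intro i hi
  have := sZ.col_lt i hi
  omega

/-- The invariant of the circuit after the measurements: the corrections `k` have been applied, the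
classical register satisfies `P`, and the syndromes are determined by both errors. -/
def Measured (e : α ⊕ (βX ⊕ βZ) ≃ Fin N) (HX : Matrix βX α (ZMod 2)) (HZ : Matrix βZ α (ZMod 2))
    (XS ZS : Set (Fin N)) (a b a' b' : α → ZMod 2) (Enc : Matrix (α → ZMod 2) Λ ℂ)
    (ρ : Matrix (Λ × R) (Λ × R) ℂ)
    (P : (βX → ZMod 2) → (βZ → ZMod 2) → (Fin (bits N α βX βZ) → ZMod 2) → Prop)
    (k : (βX → ZMod 2) → (βZ → ZMod 2) → Matrix (Fin N → ZMod 2) Λ ℂ →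
      Matrix (Fin N → ZMod 2) Λ ℂ)
    (τ : HybridState N (bits N α βX βZ) R) : Prop :=
  ∃ (n n' m m' : Fin N → ZMod 2) (σX : βX → ZMod 2) (σZ : βZ → ZMod 2)
    (x : Fin (bits N α βX βZ) → ZMod 2)
    (ω : Matrix ((Fin N → ZMod 2) × R) ((Fin N → ZMod 2) × R) ℂ),
    (∀ i, n i ≠ 0 → i ∈ XS) ∧ (∀ i, n' i ≠ 0 → i ∈ ZS) ∧
    (∀ i, m i ≠ 0 → i ∈ XS) ∧ (∀ i, m' i ≠ 0 → i ∈ ZS) ∧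
    P σX σZ x ∧ τ = pureOn x ω ∧
    Noisy ((σX = HX *ᵥ b + (fun i => n' (e (.inr (.inl i)))) ∧
        σZ = HZ *ᵥ a + fun i => n (e (.inr (.inr i)))) ∧
      (σX = HX *ᵥ b' + (fun i => m' (e (.inr (.inl i)))) ∧
        σZ = HZ *ᵥ a' + fun i => m (e (.inr (.inr i))))) XS ZS
      (k σX σZ (coupled e HX HZ (weylAct a b Enc))) (k σX σZ (coupled e HX HZ (weylAct a' b' Enc)))
      ρ ω

/-- The corrupted circuit maps a corrupted code state to a corrupted code state whose error is the
corrected input error up to the propagated faults. -/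
theorem ecCircuit_runFaulty (e : α ⊕ (βX ⊕ βZ) ≃ Fin N) (sX : Schedule HX D) (sZ : Schedule HZ D)
    (decX : (βZ → ZMod 2) → (α → ZMod 2)) (decZ : (βX → ZMod 2) → (α → ZMod 2))
    {XS ZS : Set (Fin N)}
    (hXX : ∀ i ∈ edges HX, ctlX e i ∈ XS → tgtX e i ∈ XS)
    (hXZ : ∀ i ∈ edges HX, tgtX e i ∈ ZS → ctlX e i ∈ ZS)
    (hZX : ∀ i ∈ edges HZ, ctlZ e i ∈ XS → tgtZ e i ∈ XS)
    (hZZ : ∀ i ∈ edges HZ, tgtZ e i ∈ ZS → ctlZ e i ∈ ZS)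
    (F : PauliFault N (2 * D + 4)) (hFX : ∀ t, (F t).support ⊆ XS) (hFZ : ∀ t, (F t).support ⊆ ZS)
    {Enc : Matrix (α → ZMod 2) Λ ℂ} (hE : IsEncoding HX HZ Enc) {a b a' b' : α → ZMod 2}
    {ρ : Matrix (Λ × R) (Λ × R) ℂ} {z : ℂ} {σ : HybridState N (bits N α βX βZ) R}
    (hσ : partialTrace (dataEmb e) σ = z • sandwich (weylAct a b Enc) (weylAct a' b' Enc) ρ) :
    Measured e HX HZ XS ZS a b a' b' Enc ρ (fun _ _ _ => True)
      (fun σX σZ A => weylAct 0 (comb e (decZ σX) 0) (weylAct (comb e (decX σZ) 0) 0 A))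
      ((ecCircuit e sX sZ decX decZ).runFaulty F σ) := by
  have := foldl_finRange_inv (n := 2 * D + 4)
    (fun (τ : HybridState N (bits N α βX βZ) R) t => fun x => (F t).apply
      ((ecLayer e sX sZ t).act (classicalAct (ecClassical D e decX decZ t) τ) x))
    -- Here `n` counts completed timesteps. The first one is the reset, so `n - 1` coupling layers
    -- have been performed.
    (fun n τ => if n = 0 then τ = σ else if n ≤ 2 * D + 1 then
      ∃ ω, τ = pureOn (fun _ => 1) ω ∧ Noisy True XS ZS (idealAt e sX sZ (n - 1) (weylAct a b Enc))
        (idealAt e sX sZ (n - 1) (weylAct a' b' Enc)) ρ ω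
      else if n = 2 * D + 2 then
        Measured e HX HZ XS ZS a b a' b' Enc ρ (fun σX σZ x =>
          (∀ i, x (layerBit card_anc_le (.inl i)) = σX i) ∧
          (∀ i, x (layerBit card_anc_le (.inr i)) = σZ i)) (fun _ _ A => A) τ
      else if n = 2 * D + 3 then
        Measured e HX HZ XS ZS a b a' b' Enc ρ (fun σX _ x =>
          ∀ c, x (storeBit e c) = decZ σX c)
          (fun _ σZ A => weylAct (comb e (decX σZ) 0) 0 A) τ
      else Measured e HX HZ XS ZS a b a' b' Enc ρ (fun _ _ _ => True)
        (fun σX σZ A => weylAct 0 (comb e (decZ σX) 0) (weylAct (comb e (decX σZ) 0) 0 A)) τ)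
    σ (by simp) (by
      intro t τ hτ
      have htl := t.2
      rw [if_neg (Nat.succ_ne_zero _)]
      by_cases h0 : (t : ℕ) = 0
      · rw [if_pos h0] at hτ
        subst hτ
        rw [if_pos (by omega), h0]
        rw [partialTrace_eq] at hσ
        obtain ⟨z', hz'⟩ := exists_resetLayer_act e
          (card_anc_le (N := N) (α := α) (βX := βX) (βZ := βZ)) hσ
        have hcl : classicalAct (ecClassical D e decX decZ 0) τ
            = pureOn (fun _ => 1) (∑ x, τ x) := by
          have : ecClassical D e decX decZ 0 = fun _ _ => 1 := by
            funext x
            simp [ecClassical]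
          rw [this]
          exact classicalAct_const _ _
        have hl : ecLayer e sX sZ 0 = layerOf card_anc_le (resetGate e) (resetGate_disjoint e) := by
          simp [ecLayer]
        rw [hcl, hl, hz', PauliSuperop.apply_pureOn]
        refine ⟨_, rfl, Noisy.fault ?_ _ (hFX t) (hFZ t)⟩
        rw [zero_add, Nat.sub_self, idealAt_zero, idealAt_zero]
        exact noisy_self _ fun _ => trivial
      · rw [if_neg h0] at hτ
        by_cases h1 : (t : ℕ) ≤ 2 * D + 1
        · rw [if_pos h1] at hτ
          obtain ⟨ω, rfl, hω⟩ := hτ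
          have hcl : classicalAct (ecClassical D e decX decZ t) (pureOn (fun _ => 1) ω)
              = pureOn (fun _ => 1) ω := by
            rw [classicalAct_pureOn, ecClassical, if_pos h1]
          rw [hcl]
          by_cases h2 : (t : ℕ) ≤ 2 * D
          · rw [if_pos (by omega)]
            by_cases h3 : (t : ℕ) ≤ D
            · rw [ecLayer, if_neg h0, if_pos h3]
              rw [idealAt_of_le _ _ _ (by omega), idealAt_of_le _ _ _ (by omega)] at hω
              obtain ⟨ω', h4, h5⟩ := exists_cnotLayer_act
                (card_edgeX_le (N := N) (α := α) (βX := βX) (βZ := βZ)) (edges HX) (ctlX e)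
                (tgtX e) (ctlX_ne_tgtX e) sX.col
                (fun i hi j hj hij h => by
                  have := sX.col_ne i hi j hj hij h
                  exact ⟨by simpa [ctlX] using this.1, by simpa [tgtX] using this.2⟩)
                (t - 1) hXX hXZ hω
              rw [h4, PauliSuperop.apply_pureOn]
              refine ⟨_, rfl, Noisy.fault ?_ _ (hFX t) (hFZ t)⟩
              rw [idealAt_of_le _ _ _ (by omega), idealAt_of_le _ _ _ (by omega)]
              have : (t : ℕ) + 1 - 1 = t - 1 + 1 := by omega
              rw [this]
              exact h5
            · rw [ecLayer, if_neg h0, if_neg h3, if_pos h2]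
              rw [idealAt_of_ge _ _ _ (by omega), idealAt_of_ge _ _ _ (by omega)] at hω
              obtain ⟨ω', h4, h5⟩ := exists_cnotLayer_act
                (card_edgeZ_le (N := N) (α := α) (βX := βX) (βZ := βZ)) (edges HZ) (ctlZ e)
                (tgtZ e) (ctlZ_ne_tgtZ e) sZ.col
                (fun i hi j hj hij h => by
                  have := sZ.col_ne i hi j hj hij h
                  exact ⟨by simpa [ctlZ] using this.2, by simpa [tgtZ] using this.1⟩)
                (t - 1 - D) hZX hZZ hω
              rw [h4, PauliSuperop.apply_pureOn]
              refine ⟨_, rfl, Noisy.fault ?_ _ (hFX t) (hFZ t)⟩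
              rw [idealAt_of_ge _ _ _ (by omega), idealAt_of_ge _ _ _ (by omega)]
              have : (t : ℕ) + 1 - 1 - D = t - 1 - D + 1 := by omega
              rw [this]
              exact h5
          · have ht : (t : ℕ) = 2 * D + 1 := by omega
            rw [if_neg (by omega), if_pos (by omega)]
            have h1 : (t : ℕ) - 1 = 2 * D := by omega
            rw [h1, idealAt_final, idealAt_final] at hω
            obtain ⟨n, n', m, m', z, hn, hn', hm, hm', -, rfl⟩ := hω
            obtain ⟨x, z', hx, hxs, hzs⟩ := exists_measLayer_act e
              (card_anc_le (N := N) (α := α) (βX := βX) (βZ := βZ)) (fun _ => 1) ρ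
              (measure_coupled e hE a b n n') (measure_coupled e hE a' b' m m') z
            have hl : ecLayer e sX sZ t
                = layerOf card_anc_le (measGate e) (measGate_disjoint e) := by
              rw [ecLayer, if_neg h0, if_neg (by omega), if_neg h2, if_pos ht]
            rw [hl, hx, PauliSuperop.apply_pureOn]
            refine ⟨n, n', m, m', _, _, x, _, hn, hn', hm, hm',
              ⟨fun i => hxs (.inl i), fun i => hxs (.inr i)⟩, rfl,
              Noisy.fault ?_ _ (hFX t) (hFZ t)⟩
            -- The recorded syndrome is the left one by definition; a nonzero scalar forces it to be
            -- the right one as well.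
            refine ⟨n, n', m, m', z', hn, hn', hm, hm', fun hz => ⟨⟨rfl, rfl⟩, ?_, ?_⟩, rfl⟩
            · funext i
              exact congrFun (hzs hz) (.inl i)
            · funext i
              exact congrFun (hzs hz) (.inr i)
        · rw [if_neg h1] at hτ
          by_cases h2 : (t : ℕ) = 2 * D + 2
          · rw [if_pos h2] at hτ
            rw [if_neg (by omega), if_neg (by omega), if_pos (by omega)]
            obtain ⟨n, n', m, m', σX, σZ, x, ω, hn, hn', hm, hm', ⟨hxX, hxZ⟩, rfl, hω⟩ := hτ
            have hl : ecLayer e sX sZ t = pauliLayer e card_data_le .X := by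
              rw [ecLayer, if_neg h0, if_neg (by omega), if_neg (by omega), if_neg (by omega),
                if_pos h2]
            have hc : ∀ c, ecClassical D e decX decZ t x (layerBit card_data_le c) = decX σZ c := by
              intro c
              rw [ecClassical, if_neg h1, if_pos h2]
              have := (dataBits_injective e).extend_apply
                (Sum.elim (decX fun d => x (layerBit card_anc_le (.inr d)))
                  (decZ fun b => x (layerBit card_anc_le (.inl b)))) 0 (.inl c)
              simp only [Sum.elim_inl] at this
              rw [this]
              congr 1
              exact funext hxZ
            have hs : ∀ c, ecClassical D e decX decZ t x (storeBit e c) = decZ σX c := by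
              intro c
              rw [ecClassical, if_neg h1, if_pos h2]
              have := (dataBits_injective e).extend_apply
                (Sum.elim (decX fun d => x (layerBit card_anc_le (.inr d)))
                  (decZ fun b => x (layerBit card_anc_le (.inl b)))) 0 (.inr c)
              simp only [Sum.elim_inr] at this
              rw [this]
              congr 1
              exact funext hxX
            obtain ⟨ω', h4, h5⟩ := exists_pauliLayer_act e
              (card_data_le (N := N) (α := α) (βX := βX) (βZ := βZ)) .X (px := 1) (pz := 0)
              (fun a A => by rw [onQubit_X_mul, Pi.single_zero]) _ (decX σZ) hc hω
            rw [classicalAct_pureOn, hl, h4, PauliSuperop.apply_pureOn]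
            refine ⟨n, n', m, m', σX, σZ, _, _, hn, hn', hm, hm', hs, rfl,
              Noisy.fault ?_ _ (hFX t) (hFZ t)⟩
            have h0' : comb e (0 : α → ZMod 2) (0 : βX ⊕ βZ → ZMod 2) = 0 :=
              ext_of_equiv e (by simp) (by simp)
            rw [one_smul, zero_smul, h0'] at h5
            exact h5
          · have ht : (t : ℕ) = 2 * D + 3 := by omega
            rw [if_neg h2, if_pos ht] at hτ
            rw [if_neg (by omega), if_neg (by omega), if_neg (by omega)]
            obtain ⟨n, n', m, m', σX, σZ, x, ω, hn, hn', hm, hm', hs, rfl, hω⟩ := hτ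
            have hl : ecLayer e sX sZ t = pauliLayer e card_data_le .Z := by
              rw [ecLayer, if_neg h0, if_neg (by omega), if_neg (by omega), if_neg (by omega),
                if_neg h2]
            have hc : ∀ c, ecClassical D e decX decZ t x (layerBit card_data_le c) = decZ σX c := by
              intro c
              rw [ecClassical, if_neg h1, if_neg h2, (layerBit_injective _).extend_apply, hs]
            obtain ⟨ω', h4, h5⟩ := exists_pauliLayer_act e
              (card_data_le (N := N) (α := α) (βX := βX) (βZ := βZ)) .Z (px := 0) (pz := 1)
              (fun a A => by rw [onQubit_Z_mul, Pi.single_zero]) _ (decZ σX) hc hω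
            rw [classicalAct_pureOn, hl, h4, PauliSuperop.apply_pureOn]
            refine ⟨n, n', m, m', σX, σZ, _, _, hn, hn', hm, hm', trivial, rfl,
              Noisy.fault ?_ _ (hFX t) (hFZ t)⟩
            have h0' : comb e (0 : α → ZMod 2) (0 : βX ⊕ βZ → ZMod 2) = 0 :=
              ext_of_equiv e (by simp) (by simp)
            rw [one_smul, zero_smul, h0'] at h5
            exact h5)
  rw [if_neg (by omega), if_neg (by omega), if_neg (by omega), if_neg (by omega)] at this
  exact this

end Circuit

/-! ### Schedules -/

/-- Greedy choice: fewer than `D` related elements cannot exhaust `D` colours. -/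
theorem exists_greedy_colouring {ι : Type*} [Finite ι] (r : ι → ι → Prop)
    (hr : ∀ i j, r i j → r j i) {D : ℕ} (h : ∀ i, {j | r i j}.ncard < D) :
    ∃ col : ι → ℕ, (∀ i, col i < D) ∧ ∀ i j, r i j → i ≠ j → col i ≠ col j := by
  classical
  have := Fintype.ofFinite ι
  suffices H : ∀ s : Finset ι, ∃ col : ι → ℕ, (∀ i ∈ s, col i < D) ∧
      ∀ i ∈ s, ∀ j ∈ s, r i j → i ≠ j → col i ≠ col j by
    obtain ⟨col, h1, h2⟩ := H Finset.univ
    exact ⟨col, fun i => h1 i (by simp), fun i j => h2 i (by simp) j (by simp)⟩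
  intro s
  induction s using Finset.induction_on with
  | empty => exact ⟨fun _ => 0, by simp, by simp⟩
  | insert i s hi ih =>
    obtain ⟨col, h1, h2⟩ := ih
    obtain ⟨k, hkD, hk⟩ : ∃ k < D, k ∉ col '' {j | r i j} := by
      by_contra hcon
      push Not at hcon
      have hsub : (Set.Iio D : Set ℕ) ⊆ col '' {j | r i j} := fun k hk => hcon k hk
      have h3 := Set.ncard_le_ncard hsub (Set.toFinite _)
      have h4 := Set.ncard_image_le (f := col) (Set.toFinite {j | r i j})
      have h5 : (Set.Iio D : Set ℕ).ncard = D := by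
        rw [Set.ncard_eq_toFinset_card']; simp
      have := h i
      omega
    refine ⟨Function.update col i k, ?_, ?_⟩
    · intro j hj
      by_cases hji : j = i
      · subst hji; simpa using hkD
      · rw [Function.update_of_ne hji]
        exact h1 j (Finset.mem_of_mem_insert_of_ne hj hji)
    · intro j hj j' hj' hr' hne
      by_cases hji : j = i
      · subst hji
        rw [Function.update_self, Function.update_of_ne hne.symm]
        exact fun h => hk ⟨j', hr', h.symm⟩
      · by_cases hji' : j' = i
        · subst hji'
          rw [Function.update_self, Function.update_of_ne hne]
          exact fun h => hk ⟨j, hr _ _ hr', h⟩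
        · rw [Function.update_of_ne hji, Function.update_of_ne hji']
          exact h2 j (Finset.mem_of_mem_insert_of_ne hj hji) j'
            (Finset.mem_of_mem_insert_of_ne hj' hji') hr' hne

/-- Colour the edges of the incidence graph: an edge conflicts with the edges sharing its check or
its data qubit, at most `w` of each kind. -/
theorem exists_schedule {α β : Type*} [Fintype α] [Fintype β] [DecidableEq α]
    (H : Matrix β α (ZMod 2)) {w : ℕ} (hw : 1 ≤ w) (hrow : ∀ b, {c | H b c ≠ 0}.ncard ≤ w)
    (hcol : ∀ c, {b | H b c ≠ 0}.ncard ≤ w) : Nonempty (Schedule H (2 * w)) := by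
  classical
  obtain ⟨col, h1, h2⟩ := exists_greedy_colouring (D := 2 * w)
    (fun i j : β × α => i ∈ edges H ∧ j ∈ edges H ∧ i ≠ j ∧ (i.1 = j.1 ∨ i.2 = j.2))
    (fun i j h => ⟨h.2.1, h.1, h.2.2.1.symm, h.2.2.2.imp Eq.symm Eq.symm⟩) (by
      intro i
      by_cases hi : i ∈ edges H
      · have hi' : H i.1 i.2 ≠ 0 := by simpa [edges] using hi
        set S : Set (β × α) := (fun c => (i.1, c)) '' {c | H i.1 c ≠ 0} ∪
          (fun b => (b, i.2)) '' {b | H b i.2 ≠ 0} with hS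
        have hiS : i ∈ S := Or.inl ⟨i.2, hi', rfl⟩
        have hcard : S.ncard ≤ w + w := (Set.ncard_union_le _ _).trans (Nat.add_le_add
          ((Set.ncard_image_le (Set.toFinite _)).trans (hrow _))
          ((Set.ncard_image_le (Set.toFinite _)).trans (hcol _)))
        have hsub : {j | i ∈ edges H ∧ j ∈ edges H ∧ i ≠ j ∧ (i.1 = j.1 ∨ i.2 = j.2)} ⊆ S \ {i} := by
          rintro ⟨b, c⟩ ⟨-, hj, hne, hor⟩
          have hj' : H b c ≠ 0 := by simpa [edges] using hj
          refine ⟨?_, fun h => hne (Set.mem_singleton_iff.mp h).symm⟩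
          rcases hor with h | h
          · left
            dsimp at h
            subst h
            exact ⟨c, hj', rfl⟩
          · right
            dsimp at h
            subst h
            exact ⟨b, hj', rfl⟩
        have h3 := Set.ncard_le_ncard hsub (Set.toFinite _)
        -- Discarding the edge itself makes the number of conflicts strictly less than `2 * w`, as
        -- greedy colouring requires.
        have h4 := Set.ncard_sdiff_singleton_lt_of_mem hiS (Set.toFinite _)
        omega
      · have : {j | i ∈ edges H ∧ j ∈ edges H ∧ i ≠ j ∧ (i.1 = j.1 ∨ i.2 = j.2)} = ∅ := by
          ext j; simp [hi]
        rw [this, Set.ncard_empty]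
        omega)
  refine ⟨⟨col, fun i _ => h1 i, fun i hi j hj hij hc => ?_⟩⟩
  by_contra hn
  have : i.1 = j.1 ∨ i.2 = j.2 := by tauto
  exact h2 i j ⟨hi, hj, hij, this⟩ hij hc

/-! ### Checks of a based complex -/

section Checks

variable {X : Type*} [Fintype X]

/-- The rows of `δ` meeting the columns singled out by `p`. -/
abbrev CheckCell (δ : Matrix X X (ZMod 2)) (p : X → Prop) : Type _ :=
  {d : X // ∃ c, p c ∧ δ d c ≠ 0}

instance (δ : Matrix X X (ZMod 2)) (p : X → Prop) : Fintype (CheckCell δ p) := Fintype.ofFinite _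

instance (δ : Matrix X X (ZMod 2)) (p : X → Prop) : DecidableEq (CheckCell δ p) := Classical.decEq _

/-- The block of nonzero rows of `δ` on the columns singled out by `p`. -/
def checkMat (δ : Matrix X X (ZMod 2)) (p : X → Prop) :
    Matrix (CheckCell δ p) {x // p x} (ZMod 2) := fun d c => δ d.1 c.1

theorem sum_subtype_eq {A : Type*} [AddCommMonoid A] {p : X → Prop} [Fintype {x // p x}]
    (f : X → A) (hf : ∀ x, ¬ p x → f x = 0) : ∑ x : {x // p x}, f x = ∑ x, f x := by
  classical
  rw [← Finset.sum_subtype (Finset.univ.filter p) (by simp) f]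
  exact Finset.sum_filter_of_ne fun x _ hx => by
    by_contra h
    exact hx (hf x h)

/-- Extension by zero. -/
def extendZero {p : X → Prop} (v : {x // p x} → ZMod 2) : X → ZMod 2 := by
  classical exact fun x => if h : p x then v ⟨x, h⟩ else 0

theorem extendZero_apply {p : X → Prop} (v : {x // p x} → ZMod 2) (c : {x // p x}) :
    extendZero v c = v c := by
  simp [extendZero, c.2]

theorem extendZero_of_not {p : X → Prop} (v : {x // p x} → ZMod 2) {x : X} (h : ¬ p x) :
    extendZero v x = 0 := by
  simp [extendZero, h]

variable (δ : Matrix X X (ZMod 2)) (p : X → Prop) [Fintype {x // p x}]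

theorem sum_mul_subtype (v : {x // p x} → ZMod 2) (g : X → ZMod 2) :
    ∑ c : {x // p x}, g c * v c = ∑ x, g x * extendZero v x := by
  rw [← sum_subtype_eq (p := p) (fun x => g x * extendZero v x)
    fun x hx => by rw [extendZero_of_not v hx, mul_zero]]
  exact Finset.sum_congr rfl fun c _ => by rw [extendZero_apply]

/-- The span of the checks. -/
def checkSpan : Submodule (ZMod 2) ({x // p x} → ZMod 2) :=
  LinearMap.range (Matrix.mulVecLin (checkMat δ p)ᵀ)

/-- Rows vanishing on the columns `p` contribute nothing, so coefficients may range over all of `X`.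
This bridges the different index types of checks and cochains. -/
theorem mem_checkSpan_iff (y : {x // p x} → ZMod 2) :
    y ∈ checkSpan δ p ↔ ∃ g : X → ZMod 2, ∀ c, y c = ∑ x, δ x c * g x := by
  have key : ∀ (g : X → ZMod 2) (c : {x // p x}),
      ((checkMat δ p)ᵀ *ᵥ fun d : CheckCell δ p => g d) c = ∑ x, δ x c * g x := by
    intro g c
    refine sum_subtype_eq (p := fun d => ∃ c, p c ∧ δ d c ≠ 0) (fun x => δ x c * g x) fun x hx => ?_
    have : δ x c = 0 := by
      by_contra h
      exact hx ⟨c, c.2, h⟩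
    rw [this, zero_mul]
  constructor
  · rintro ⟨v, rfl⟩
    refine ⟨extendZero v, fun c => ?_⟩
    rw [← key]
    simp only [extendZero_apply]
    rfl
  · rintro ⟨g, hg⟩
    refine ⟨fun d => g d, funext fun c => ?_⟩
    rw [hg, ← key]
    rfl

end Checks

namespace BasedComplex

variable {r : ℕ} {X : Type*} [Fintype X]

/-- This is `δ² = 0`: a check touching level `j` has its whole coboundary there, so restricting the
middle sum to `p` loses nothing. -/
theorem checkSpan_le_ker (D : BasedComplex r X) {j : ℕ} {p : X → Prop} [Fintype {x // p x}]
    (hp : ∀ x, p x ↔ D.level x = j) :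
    ∀ y ∈ checkSpan D.δᵀ p, checkMat D.δ p *ᵥ y = 0 := by
  rintro y ⟨v, rfl⟩
  funext d
  change ∑ c : {x // p x}, D.δ d c * ∑ b : CheckCell D.δᵀ p, D.δ c b * v b = 0
  simp only [Finset.mul_sum]
  rw [Finset.sum_comm]
  refine Finset.sum_eq_zero fun b _ => ?_
  obtain ⟨c₀, hc₀, hbc₀⟩ := b.2
  have hb := D.level_of_δ _ _ hbc₀
  have h1 : ∑ c : {x // p x}, D.δ d c * (D.δ c b * v b)
      = ∑ x, D.δ d x * (D.δ x b * v b) := by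
    refine sum_subtype_eq (fun x => D.δ d x * (D.δ x b * v b)) fun x hx => ?_
    have : D.δ x b = 0 := by
      by_contra h
      have := D.level_of_δ _ _ h
      rw [hp] at hx hc₀
      omega
    rw [this, zero_mul, mul_zero]
  rw [h1]
  have h2 : (D.δ * D.δ) d b = 0 := by rw [D.δ_sq]; rfl
  rw [Matrix.mul_apply] at h2
  simp only [← mul_assoc, ← Finset.sum_mul]
  rw [h2, zero_mul]

/-- Rows omitted from the check matrix give no syndrome, so passing between checks and cochains
changes neither support nor weight. -/
theorem suppAt_checkMat (D : BasedComplex r X) {j : ℕ} (e : D.Cochain j) :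
    suppAt Subtype.val (checkMat D.δ (fun x => D.level x = j) *ᵥ e)
      = suppAt Subtype.val (D.cob j e) := by
  ext x
  constructor
  · rintro ⟨d, hd, rfl⟩
    obtain ⟨c, hc, hdc⟩ := d.2
    have := D.level_of_δ _ _ hdc
    exact ⟨⟨d, by omega⟩, hd, rfl⟩
  · rintro ⟨d, hd, rfl⟩
    have hd' : ∑ c : D.Cell j, D.δ d c * e c ≠ 0 := hd
    obtain ⟨c, -, hc⟩ := Finset.exists_ne_zero_of_sum_ne_zero hd'
    exact ⟨⟨d, c, c.2, left_ne_zero_of_mul hc⟩, hd, rfl⟩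

theorem hammingNorm_checkMat (D : BasedComplex r X) {j : ℕ} (e : D.Cochain j) :
    hammingNorm (checkMat D.δ (fun x => D.level x = j) *ᵥ e) = hammingNorm (D.cob j e) := by
  rw [← ncard_suppAt Subtype.val_injective, ← ncard_suppAt Subtype.val_injective, suppAt_checkMat]

theorem range_cobInto (D : BasedComplex r X) {j : ℕ} (hj : 1 ≤ j) :
    D.coboundaries j = checkSpan D.δᵀ (fun x => D.level x = j) := by
  ext y
  rw [mem_checkSpan_iff]
  constructor
  · rintro ⟨b, rfl⟩
    exact ⟨extendZero b, fun c => sum_mul_subtype _ b (D.δ c)⟩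
  · rintro ⟨g, hg⟩
    refine ⟨fun b => g b, funext fun c => ?_⟩
    rw [hg]
    refine sum_subtype_eq (p := fun x => D.level x = j - 1) (fun x => D.δ c x * g x) fun x hx => ?_
    have : D.δ c x = 0 := by
      by_contra h
      have h1 := D.level_of_δ _ _ h
      have h2 := c.2
      omega
    rw [this, zero_mul]

theorem ncard_incident_le (D : BasedComplex r X) {w : ℕ} (hw : D.HasLocality w) (x : X) :
    {y | D.δ y x ≠ 0 ∨ D.δ x y ≠ 0}.ncard ≤ w := by
  refine (Set.ncard_le_ncard ?_ (Set.toFinite _)).trans (hw x)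
  rintro y (h | h)
  · exact Or.inr (Relation.ReflTransGen.single h)
  · exact Or.inl (Relation.ReflTransGen.single h)

theorem ncard_subtype_le {q : X → Prop} {P : {x // q x} → Prop} {S : Set X}
    (h : ∀ x : {x // q x}, P x → (x : X) ∈ S) {w : ℕ} (hS : S.ncard ≤ w) :
    {x : {x // q x} | P x}.ncard ≤ w := by
  rw [← Set.ncard_image_of_injective _ Subtype.val_injective]
  refine (Set.ncard_le_ncard ?_ (Set.toFinite _)).trans hS
  rintro _ ⟨x, hx, rfl⟩
  exact h x hx

/-- The clique consists of the cells above the `c₀` supplied by the decoder. It also contains the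
coboundary of every cochain supported above `c₀`. The columns are given by a predicate `p` so that a
complex and its dual, whose levels are labelled differently, share one qubit type. -/
theorem flipProperty (D : BasedComplex r X) {j w m : ℕ} (hj : 1 ≤ j) {p : X → Prop}
    [inst : Fintype {x // p x}] (hp : ∀ x, p x ↔ D.level x = j) (hw : D.HasLocality w)
    (hdec : D.HasErrorFlipDecoder m j) {V : Type*} [Finite V] {G : SimpleGraph V} {S : X → Prop}
    {ι : {x // S x} → V} (hι : Function.Injective ι)
    (hS : ∀ x, p x → S x) (hS' : ∀ d : CheckCell D.δ p, S d)
    (hG : ∀ z : D.Cell 0, ∀ a b : {x // S x}, a ≠ b → D.Below z a → D.Below z b →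
      G.Adj (ι a) (ι b)) :
    FlipProperty G (fun c : {x // p x} => ι ⟨c, hS c c.2⟩)
      (fun d : CheckCell D.δ p => ι ⟨d, hS' d⟩) (checkMat D.δ p) (checkSpan D.δᵀ p) m w := by
  obtain rfl : p = fun x => D.level x = j := funext fun x => propext (hp x)
  obtain rfl : inst = instFintypeCell D j := Subsingleton.elim _ _
  intro e he hem
  obtain ⟨c₀, hc⟩ := hdec e he hem
  refine ⟨ι '' {x | D.Below c₀ x}, ?_, ?_, ?_⟩
  · rw [Set.ncard_image_of_injective _ hι]
    exact ncard_subtype_le (S := {c' | D.Below c' c₀ ∨ D.Below c₀ c'}) (fun x hx => Or.inr hx) (hw c₀)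
  · rintro _ ⟨a, ha, rfl⟩ _ ⟨b, hb, rfl⟩ hab
    exact hG c₀ a b (fun h => hab (h ▸ rfl)) ha hb
  · rcases hc with ⟨b, hb, hlt⟩ | ⟨a, ha, hlt⟩
    · refine Or.inl ⟨D.cobInto j b, ?_, ?_, hlt⟩
      · rw [← range_cobInto D hj]
        exact ⟨b, rfl⟩
      · rintro _ ⟨c, hc, rfl⟩
        have hc' : ∑ x : D.Cell (j - 1), D.δ c x * b x ≠ 0 := hc
        obtain ⟨x, -, hx⟩ := Finset.exists_ne_zero_of_sum_ne_zero hc'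
        exact ⟨_, (hb x (right_ne_zero_of_mul hx)).tail (left_ne_zero_of_mul hx), rfl⟩
    · refine Or.inr ⟨a, ?_, ?_, ?_⟩
      · rintro _ ⟨c, hc, rfl⟩
        exact ⟨_, ha c hc, rfl⟩
      · rintro _ ⟨d, hd, rfl⟩
        have hd' : ∑ c : D.Cell j, D.δ d c * a c ≠ 0 := hd
        obtain ⟨c, -, hc⟩ := Finset.exists_ne_zero_of_sum_ne_zero hd'
        exact ⟨_, (ha c (right_ne_zero_of_mul hc)).tail (left_ne_zero_of_mul hc), rfl⟩
      · rwa [hammingNorm_checkMat, hammingNorm_checkMat]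

/-- If `γ ≥ 1`, the measurement error may equal the syndrome of a single cell. The observed syndrome
is then zero, and its weight cannot be lowered. -/
theorem lt_one_of_syndromeFlip (D : BasedComplex r X) {j m : ℕ} {γ : ℝ} (hm : 1 ≤ m)
    (hdec : D.HasSyndromeFlipDecoder m γ j) {c d : X} (hc : D.level c = j) (hdc : D.δ d c ≠ 0) :
    γ < 1 := by
  classical
  by_contra hγ
  push Not at hγ
  set e : D.Cochain j := Pi.single ⟨c, hc⟩ 1 with he
  have hd : D.level d = j + 1 := by rw [D.level_of_δ _ _ hdc, hc]
  have hcob : D.cob j e ≠ 0 := by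
    intro h
    have h1 := congrFun h ⟨d, hd⟩
    have h2 : D.cob j e ⟨d, hd⟩ = D.δ d c := by
      change (D.block j (j + 1) *ᵥ Pi.single ⟨c, hc⟩ 1) _ = _
      rw [Matrix.mulVec_single_one]
      rfl
    rw [h2] at h1
    exact hdc h1
  have hnorm : hammingNorm e ≤ m := by
    refine le_trans ?_ hm
    rw [← ncard_suppAt Function.injective_id]
    refine (Set.ncard_le_ncard (t := {⟨c, hc⟩}) ?_ (Set.toFinite _)).trans (by simp)
    rintro _ ⟨c', hc', rfl⟩
    by_contra h
    exact hc' (by simpa [he] using Pi.single_eq_of_ne h 1)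
  obtain ⟨c₀, a, -, hlt⟩ := hdec e hcob hnorm (D.cob j e) (by
    have : (0 : ℝ) ≤ hammingNorm (D.cob j e) := by positivity
    nlinarith)
  rw [add_self_zmod (D.cob j e), hammingNorm_zero] at hlt
  omega

/-- Each column is constant on a cohomology class: it is supported on cocycles, and the span of the
`X`-checks is the space of coboundaries, which preserves the class. -/
theorem isEncoding (C : BasedComplex r X) {i k : ℕ} (hi : 1 ≤ i) (enc : C.CSSEncoding i k) :
    IsEncoding (checkMat C.δᵀ (fun x => C.level x = i)) (checkMat C.δ (fun x => C.level x = i))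
      (C.encodingIsometry enc) := by
  have hker : ∀ y : C.Cochain i,
      y ∈ C.cocycles i ↔ checkMat C.δ (fun x => C.level x = i) *ᵥ y = 0 := by
    intro y
    rw [cocycles, LinearMap.mem_ker, ← hammingNorm_eq_zero, ← hammingNorm_checkMat,
      hammingNorm_eq_zero]
  constructor
  · intro y x hy
    by_contra h
    refine hy (if_neg ?_)
    rintro ⟨h', -⟩
    exact h ((hker y).mp h')
  · intro y v x
    set l := (checkMat C.δᵀ (fun x => C.level x = i))ᵀ *ᵥ v with hl
    have hmem : l ∈ checkSpan C.δᵀ (fun x => C.level x = i) := ⟨v, rfl⟩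
    have hlc : l ∈ C.cocycles i := (hker l).mpr (C.checkSpan_le_ker (fun _ => Iff.rfl) l hmem)
    have hlb : l ∈ C.coboundaries i := by rw [range_cobInto C hi]; exact hmem
    have key : ∀ y, (∃ h : y ∈ C.cocycles i, (Submodule.Quotient.mk ⟨y, h⟩ : C.Cohomology i) = enc x) →
        ∃ h : y + l ∈ C.cocycles i,
          (Submodule.Quotient.mk ⟨y + l, h⟩ : C.Cohomology i) = enc x := by
      rintro y ⟨h, h'⟩
      refine ⟨Submodule.add_mem _ h hlc, ?_⟩
      rw [← h', Submodule.Quotient.eq]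
      change y + l - y ∈ C.coboundaries i
      rwa [add_sub_cancel_left]
    have hiff : (∃ h : y + l ∈ C.cocycles i,
        (Submodule.Quotient.mk ⟨y + l, h⟩ : C.Cohomology i) = enc x) ↔
        ∃ h : y ∈ C.cocycles i, (Submodule.Quotient.mk ⟨y, h⟩ : C.Cohomology i) = enc x := by
      refine ⟨fun h => ?_, key y⟩
      have h1 := key _ h
      have h2 : y + l + l = y := by rw [add_assoc, add_self_zmod, add_zero]
      simpa only [h2] using h1
    classical exact if_congr hiff rfl rfl

/-- Each check kept touches one of the chosen columns, and each column has at most `w` of them; zero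
rows would not be bounded this way. -/
theorem card_checkCell_le (δ : Matrix X X (ZMod 2)) (p : X → Prop) [Fintype {x // p x}] {w : ℕ}
    (hw : ∀ x, {y | δ y x ≠ 0}.ncard ≤ w) :
    Fintype.card (CheckCell δ p) ≤ Fintype.card {x // p x} * w := by
  classical
  have h1 : Fintype.card (CheckCell δ p) = {d : X | ∃ c, p c ∧ δ d c ≠ 0}.ncard := by
    rw [← Nat.card_eq_fintype_card]
    rfl
  rw [h1]
  have hsub : {d : X | ∃ c, p c ∧ δ d c ≠ 0}
      ⊆ ⋃ c ∈ (Finset.univ : Finset {x // p x}), {d | δ d c ≠ 0} := by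
    rintro d ⟨c, hc, hd⟩
    simp only [Finset.mem_univ, Set.iUnion_true, Set.mem_iUnion]
    exact ⟨⟨c, hc⟩, hd⟩
  refine (Set.ncard_le_ncard hsub (Set.toFinite _)).trans ?_
  refine (Finset.set_ncard_biUnion_le _ _).trans ?_
  refine (Finset.sum_le_card_nsmul _ (fun c : {x // p x} => {d | δ d c ≠ 0}.ncard) w fun c _ => hw c).trans ?_
  rw [smul_eq_mul, Finset.card_univ]

end BasedComplex

/-! ### The output of the error-correction circuit -/

section Output

variable {N : ℕ} {α βX βZ : Type*} [Fintype α] [Fintype βX] [Fintype βZ]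
  [DecidableEq α] [DecidableEq βX] [DecidableEq βZ]
  {HX : Matrix βX α (ZMod 2)} {HZ : Matrix βZ α (ZMod 2)} {D : ℕ}
  {R Λ : Type*} [Fintype R] [DecidableEq R] [Fintype Λ]

/-- Stabilizers act trivially on code states. -/
theorem IsEncoding.weylAct_eq {Enc : Matrix (α → ZMod 2) Λ ℂ} (hE : IsEncoding HX HZ Enc)
    {a b : α → ZMod 2} (ha : a ∈ LinearMap.range HXᵀ.mulVecLin)
    (hb : b ∈ LinearMap.range HZᵀ.mulVecLin) : weylAct a b Enc = Enc := by
  obtain ⟨v, rfl⟩ := ha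
  obtain ⟨v', rfl⟩ := hb
  funext u x
  simp only [weylAct, Matrix.mulVecLin_apply]
  by_cases h : Enc (u + HXᵀ *ᵥ v) x = 0
  · rw [h, mul_zero, ← hE.2 u v x, h]
  · rw [Matrix.mulVec_transpose, ← Matrix.dotProduct_mulVec, hE.1 _ _ h, dotProduct_zero,
      sgn_zero, one_mul, hE.2]

/-- Errors corrected up to stabilizers leave the residual errors and the late faults. -/
theorem IsEncoding.corrected {Enc : Matrix (α → ZMod 2) Λ ℂ} (hE : IsEncoding HX HZ Enc)
    {a b c d n n' f g : α → ZMod 2} (ha : a + c + f ∈ LinearMap.range HXᵀ.mulVecLin)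
    (hb : b + d + g ∈ LinearMap.range HZᵀ.mulVecLin) :
    ∃ z : ℂ, weylAct n n' (weylAct 0 d (weylAct c 0 (weylAct a b Enc)))
      = z • weylAct (n + f) (n' + g) Enc := by
  -- `Enc` may be replaced by its image under the stabilizer with exponents `a + c + f` and `b + d +
  -- g`. Composing with the claimed residual then cancels `f` and `g` and leaves the exponents of
  -- the left side up to a sign.
  have h := weylAct_weylAct (n + f) (n' + g) (a + c + f) (b + d + g) Enc
  rw [hE.weylAct_eq ha hb] at h
  have e1 : n + f + (a + c + f) = n + (0 + (c + a)) := by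
    have : n + f + (a + c + f) = n + (c + a) + (f + f) := by abel
    rw [this, add_self_zmod, add_zero, zero_add]
  have e2 : n' + g + (b + d + g) = n' + (d + (0 + b)) := by
    have : n' + g + (b + d + g) = n' + (d + b) + (g + g) := by abel
    rw [this, add_self_zmod, add_zero, zero_add]
  rw [e1, e2] at h
  rw [h]
  simp only [weylAct_weylAct, weylAct_smul, smul_smul]
  refine ⟨sgn (0 ⬝ᵥ a) * sgn (d ⬝ᵥ (c + a)) * sgn (n' ⬝ᵥ (0 + (c + a)))
    * sgn ((n' + g) ⬝ᵥ (a + c + f)), ?_⟩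
  rw [mul_assoc _ (sgn ((n' + g) ⬝ᵥ (a + c + f))), sgn_mul_self, mul_one]

/-- The decoder hypotheses are stated for every measurement error allowed by `XS` and `ZS`,
separately for the left and right input errors. A nonzero final state has the same recorded syndrome
on both sides, so each correction leaves a good residual there; what remains on the data is these
residuals plus propagated faults. -/
theorem ecCircuit_deviation (e : α ⊕ (βX ⊕ βZ) ≃ Fin N) (sX : Schedule HX D) (sZ : Schedule HZ D)
    (decX : (βZ → ZMod 2) → (α → ZMod 2)) (decZ : (βX → ZMod 2) → (α → ZMod 2))
    {XS ZS : Set (Fin N)}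
    (hXX : ∀ i ∈ edges HX, ctlX e i ∈ XS → tgtX e i ∈ XS)
    (hXZ : ∀ i ∈ edges HX, tgtX e i ∈ ZS → ctlX e i ∈ ZS)
    (hZX : ∀ i ∈ edges HZ, ctlZ e i ∈ XS → tgtZ e i ∈ XS)
    (hZZ : ∀ i ∈ edges HZ, tgtZ e i ∈ ZS → ctlZ e i ∈ ZS)
    (F : PauliFault N (2 * D + 4)) (hFX : ∀ t, (F t).support ⊆ XS) (hFZ : ∀ t, (F t).support ⊆ ZS)
    {Enc : Matrix (α → ZMod 2) Λ ℂ} (hE : IsEncoding HX HZ Enc) {a b a' b' : α → ZMod 2}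
    {ρ : Matrix (Λ × R) (Λ × R) ℂ} {z : ℂ} {σ : HybridState N (bits N α βX βZ) R}
    (hσ : partialTrace (dataEmb e) σ = z • sandwich (weylAct a b Enc) (weylAct a' b' Enc) ρ)
    {GoodX GoodZ : (α → ZMod 2) → Prop}
    (hX : ∀ f : βZ → ZMod 2, (∀ d, f d ≠ 0 → e (.inr (.inr d)) ∈ XS) → ∃ g, GoodX g ∧
      a + decX (HZ *ᵥ a + f) + g ∈ LinearMap.range HXᵀ.mulVecLin)
    (hX' : ∀ f : βZ → ZMod 2, (∀ d, f d ≠ 0 → e (.inr (.inr d)) ∈ XS) → ∃ g, GoodX g ∧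
      a' + decX (HZ *ᵥ a' + f) + g ∈ LinearMap.range HXᵀ.mulVecLin)
    (hZ : ∀ f : βX → ZMod 2, (∀ d, f d ≠ 0 → e (.inr (.inl d)) ∈ ZS) → ∃ g, GoodZ g ∧
      b + decZ (HX *ᵥ b + f) + g ∈ LinearMap.range HZᵀ.mulVecLin)
    (hZ' : ∀ f : βX → ZMod 2, (∀ d, f d ≠ 0 → e (.inr (.inl d)) ∈ ZS) → ∃ g, GoodZ g ∧
      b' + decZ (HX *ᵥ b' + f) + g ∈ LinearMap.range HZᵀ.mulVecLin) :
    ∃ (P : PauliSuperop α) (z' : ℂ) (f g f' g' : α → ZMod 2),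
      GoodX f ∧ GoodZ g ∧ GoodX f' ∧ GoodZ g' ∧
      (∀ c ∈ P.support, e (.inl c) ∈ XS ∪ ZS ∨ f c ≠ 0 ∨ g c ≠ 0 ∨ f' c ≠ 0 ∨ g' c ≠ 0) ∧
      partialTrace (dataEmb e) ((ecCircuit e sX sZ decX decZ).runFaulty F σ)
        = z' • P.apply (sandwich Enc Enc ρ) := by
  obtain ⟨k, k', l, l', σX, σZ, x, ω, hk, hk', hl, hl', -, hτ, n, n', m, m', z₁, hn, hn', hm, hm',
    hz₁, hω⟩ := ecCircuit_runFaulty e sX sZ decX decZ hXX hXZ hZX hZZ F hFX hFZ hE hσ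
  rw [hτ, partialTrace_eq, sum_pureOn, hω, dataTrace_smul]
  -- A zero state is a deviation with trivial Pauli and scalar 0; good vectors must still be
  -- exhibited and come from an arbitrary instance of the hypotheses.
  by_cases h0 : z₁ = 0
  · obtain ⟨f, hf, -⟩ := hX 0 (by simp)
    obtain ⟨g, hg, -⟩ := hZ 0 (by simp)
    refine ⟨⟨fun _ => .I, fun _ => .I⟩, 0, f, g, f, g, hf, hg, hf, hg, ?_, ?_⟩
    · rintro c (hc | hc) <;> exact absurd rfl hc
    · rw [h0, zero_smul, zero_smul]
  obtain ⟨⟨h1, h2⟩, h3, h4⟩ := hz₁ h0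
  obtain ⟨f, hf, hf1⟩ := hX _ fun d hd => hk _ hd
  obtain ⟨g, hg, hg1⟩ := hZ _ fun d hd => hk' _ hd
  obtain ⟨f', hf', hf1'⟩ := hX' _ fun d hd => hl _ hd
  obtain ⟨g', hg', hg1'⟩ := hZ' _ fun d hd => hl' _ hd
  rw [← h2] at hf1
  rw [← h1] at hg1
  rw [← h4] at hf1'
  rw [← h3] at hg1'
  have hfac : ∀ a b n n' : _, Factors e (weylAct n n' (weylAct 0 (comb e (decZ σX) 0)
      (weylAct (comb e (decX σZ) 0) 0 (coupled e HX HZ (weylAct a b Enc)))))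
      (weylAct (fun c => n (e (.inl c))) (fun c => n' (e (.inl c))) (weylAct 0 (decZ σX)
        (weylAct (decX σZ) 0 (weylAct a b Enc)))) := by
    intro a b n n'
    have := ((((coupled_factors e hE a b).weylAct (comb e (decX σZ) 0) 0).weylAct 0
      (comb e (decZ σX) 0)).weylAct n n')
    simp only [comb_inl] at this
    exact this
  obtain ⟨z₂, hz₂⟩ := dataTrace_sandwich (hfac a b n n') (hfac a' b' m m') ρ
  obtain ⟨z₃, hz₃⟩ := hE.corrected (n := fun c => n (e (.inl c))) (n' := fun c => n' (e (.inl c)))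
    hf1 hg1
  obtain ⟨z₄, hz₄⟩ := hE.corrected (n := fun c => m (e (.inl c))) (n' := fun c => m' (e (.inl c)))
    hf1' hg1'
  obtain ⟨P, z₅, hP, hz₅⟩ := exists_pauliSuperop (Λ := Λ) (R := R)
    ((fun c => n (e (.inl c))) + f) ((fun c => n' (e (.inl c))) + g)
    ((fun c => m (e (.inl c))) + f') ((fun c => m' (e (.inl c))) + g')
  refine ⟨P, z₁ * (z₂ * (z₃ * star z₄ * z₅)), f, g, f', g', hf, hg, hf', hg', ?_, ?_⟩
  · intro c hc
    rw [Set.mem_union]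
    have aux : ∀ (n : Fin N → ZMod 2) (f : α → ZMod 2) (S : Set (Fin N)), (∀ i, n i ≠ 0 → i ∈ S) →
        ((fun c => n (e (.inl c))) + f) c ≠ 0 → e (.inl c) ∈ S ∨ f c ≠ 0 := by
      intro n f S hn hc
      by_contra! h
      have : n (e (.inl c)) = 0 := by
        by_contra h'
        exact h.1 (hn _ h')
      exact hc (by rw [Pi.add_apply, this, h.2, add_zero])
    rcases hP hc with (h | h) | (h | h)
    · have := aux n f XS hn h; tauto
    · have := aux n' g ZS hn' h; tauto
    · have := aux m f' XS hm h; tauto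
    · have := aux m' g' ZS hm' h; tauto
  · rw [hz₂, hz₃, hz₄, sandwich_smul, hz₅, smul_smul, smul_smul, smul_smul]
    congr 1
    ring

end Output

/-! ### The error-correction gadget of a based complex -/

theorem IsAvoiding.neighbourhood {V : Type*} [Finite V] {G : SimpleGraph V} {η γ : ℝ} {S : Set V}
    {w : ℕ} (hγ : 0 < γ) (h : IsAvoiding (graphBadSets G η γ) S) (I : V → V → Prop)
    (hI : ∀ u v, I u v → u = v ∨ G.Adj u v) (hw : ∀ u, {v | I u v}.ncard ≤ w) :
    IsAvoiding (graphBadSets G η (2 * (w + 1) * γ)) (S ∪ {v | ∃ s ∈ S, I s v}) := by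
  have := h.of_dominated hγ (by omega) (dominated_neighbourhood I hI hw S)
  exact_mod_cast this

/-- A bad set of the disjoint union lies in a single timestep, so faults are sparse at each time
separately; uniting all times later costs a factor `T`. -/
theorem IsAvoiding.timestep {V : Type*} {E : Set (Set V)} {N T : ℕ} {site : Fin N → V}
    {F : PauliFault N T} (h : IsAvoiding (disjointCopies E T) (Prod.map site id '' F.support))
    (t : Fin T) : IsAvoiding E (site '' (F t).support) := by
  intro B hB hBS
  refine h (B ×ˢ {t}) ⟨t, B, hB, rfl⟩ ?_
  rintro ⟨v, t'⟩ ⟨hv, ht⟩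
  obtain rfl : t' = t := ht
  obtain ⟨a, ha, rfl⟩ := hBS hv
  exact ⟨(a, t'), ha, rfl⟩

/-- The polynomial is at most `5 w³`, whereas `γ ≤ 1 / (50 w³)`. The doubled density is that of the
sum of true and guessed error. -/
theorem threshold_mul_le {w T : ℕ} {γ : ℝ} (hw : 1 ≤ w) (hT : 1 ≤ T)
    (h : γ ≤ 1 / (50 * (w : ℝ) ^ 7 * (T : ℝ) * 2 ^ (T + 1))) :
    (γ + γ) * (1 + 2 * w + w ^ 2 + w ^ 3) ≤ 1 := by
  have hw' : (1 : ℝ) ≤ w := by exact_mod_cast hw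
  have hT' : (1 : ℝ) ≤ T := by exact_mod_cast hT
  have h2 : (1 : ℝ) ≤ 2 ^ (T + 1) := one_le_pow₀ (by norm_num)
  have h3 : (w : ℝ) ^ 3 ≤ (w : ℝ) ^ 7 := pow_le_pow_right₀ hw' (by norm_num)
  have h3' : (1 : ℝ) ≤ (w : ℝ) ^ 3 := one_le_pow₀ hw'
  have h1 : (w : ℝ) ^ 1 ≤ (w : ℝ) ^ 3 := pow_le_pow_right₀ hw' (by norm_num)
  have h1' : (w : ℝ) ^ 2 ≤ (w : ℝ) ^ 3 := pow_le_pow_right₀ hw' (by norm_num)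
  have hden : 50 * (w : ℝ) ^ 3 ≤ 50 * (w : ℝ) ^ 7 * (T : ℝ) * 2 ^ (T + 1) := by
    calc 50 * (w : ℝ) ^ 3 = 50 * (w : ℝ) ^ 3 * 1 * 1 := by ring
      _ ≤ _ := by gcongr
  have hγ : γ ≤ 1 / (50 * (w : ℝ) ^ 3) := h.trans (one_div_le_one_div_of_le (by positivity) hden)
  calc (γ + γ) * (1 + 2 * w + w ^ 2 + w ^ 3)
      ≤ (1 / (50 * (w : ℝ) ^ 3) + 1 / (50 * (w : ℝ) ^ 3)) * (5 * (w : ℝ) ^ 3) := by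
        gcongr
        rw [pow_one] at h1
        linarith
    _ ≤ 1 := by
        have : (w : ℝ) ^ 3 ≠ 0 := by positivity
        field_simp
        norm_num

/-- The left side is `(w + 1) T γ (2 + 64 (w + 1)²)`: spread faults plus four decoder residuals.
With `T = 4w + 4` one has `2^(T + 6) = 2^(4w + 10)`, which dominates because `w + 1 ≤ 2^w`, and
dividing by `γdec < 1` only helps. -/
theorem output_density_le {w : ℕ} {γ γdec : ℝ} (hγ : 0 < γ) (hdec : 0 < γdec) (hdec' : γdec < 1) :
    2 * ((w : ℝ) + 1) * ((2 * (2 * w) + 4 : ℕ) * γ) +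
      4 * (4 * ((w : ℝ) + 1) *
        (2 * ((w : ℝ) + 1) * (2 * ((w : ℝ) + 1) * ((2 * (2 * w) + 4 : ℕ) * γ))))
      ≤ ((w : ℝ) + 1) * (2 * (2 * w) + 4 : ℕ) * 2 ^ (2 * (2 * w) + 4 + 6) * γ / γdec := by
  have h1 : ((w : ℝ) + 1) ≤ 2 ^ w := by exact_mod_cast Nat.lt_two_pow_self (n := w)
  have h2 : ((w : ℝ) + 1) ^ 2 * 1024 ≤ 2 ^ (2 * (2 * w) + 4 + 6) := by
    have e : (2 : ℝ) ^ (2 * (2 * w) + 4 + 6) = ((2 : ℝ) ^ w) ^ 2 * 1024 * ((2 : ℝ) ^ w) ^ 2 := by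
      rw [← pow_mul, mul_right_comm, ← pow_add, show (1024 : ℝ) = 2 ^ 10 by norm_num, ← pow_add]
      congr 1
      ring
    have h3 : (1 : ℝ) ≤ ((2 : ℝ) ^ w) ^ 2 := one_le_pow₀ (one_le_pow₀ (by norm_num))
    rw [e]
    calc ((w : ℝ) + 1) ^ 2 * 1024 = ((w : ℝ) + 1) ^ 2 * 1024 * 1 := by ring
      _ ≤ _ := by gcongr
  have h0 : (1 : ℝ) ≤ ((w : ℝ) + 1) ^ 2 := one_le_pow₀ (by simp)
  set T : ℝ := ((2 * (2 * w) + 4 : ℕ) : ℝ) with hT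
  have hT0 : 0 ≤ T := Nat.cast_nonneg _
  have h4 : ((w : ℝ) + 1) * T * 2 ^ (2 * (2 * w) + 4 + 6) * γ
      ≤ ((w : ℝ) + 1) * T * 2 ^ (2 * (2 * w) + 4 + 6) * γ / γdec := by
    rw [le_div_iff₀ hdec]
    exact mul_le_of_le_one_right (by positivity) hdec'.le
  refine le_trans ?_ h4
  have h5 : 2 + 64 * ((w : ℝ) + 1) ^ 2 ≤ 2 ^ (2 * (2 * w) + 4 + 6) := by linarith
  calc _ = ((w : ℝ) + 1) * T * (2 + 64 * ((w : ℝ) + 1) ^ 2) * γ := by ring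
    _ ≤ _ := by gcongr

namespace BasedComplex

variable {r : ℕ} {X : Type*} [Fintype X]

theorem dual_below {C : BasedComplex r X} {a b : X} : C.dual.Below a b ↔ C.Below b a :=
  Relation.reflTransGen_swap

theorem HasLocality.dual {C : BasedComplex r X} {w : ℕ} (h : C.HasLocality w) :
    C.dual.HasLocality w := by
  intro c
  simp only [dual_below]
  simpa only [or_comm] using h c

theorem exists_decoder_of_flip (D : BasedComplex r X) {j w m : ℕ} (hj : 1 ≤ j) {p : X → Prop}
    [Fintype {x // p x}] (hp : ∀ x, p x ↔ D.level x = j) (hw : D.HasLocality w)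
    (hdec : D.HasErrorFlipDecoder m j) {V : Type*} [Finite V] {G : SimpleGraph V} {S : X → Prop}
    {ι : {x // S x} → V} (hι : Function.Injective ι)
    (hS : ∀ x, p x → S x) (hS' : ∀ d : CheckCell D.δ p, S d)
    (hG : ∀ z : D.Cell 0, ∀ a b : {x // S x}, a ≠ b → D.Below z a → D.Below z b →
      G.Adj (ι a) (ι b))
    (hadj : ∀ a b : {x // S x}, D.δ b a ≠ 0 → G.Adj (ι b) (ι a)) {ηin γin η γ : ℝ} (hη : ηin ≤ m)
    (hγin : (γin + γin) * (1 + 2 * w + w ^ 2 + w ^ 3) ≤ 1) (hγ : 0 < γ) :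
    ∃ dec : (CheckCell D.δ p → ZMod 2) → ({x // p x} → ZMod 2), ∀ e f,
      IsAvoiding (graphBadSets G ηin γin) (suppAt (fun c : {x // p x} => ι ⟨c, hS c c.2⟩) e) →
      IsAvoiding (graphBadSets G η γ) (suppAt (fun d : CheckCell D.δ p => ι ⟨d, hS' d⟩) f) →
      ∃ ρ, e + dec (checkMat D.δ p *ᵥ e + f) + ρ ∈ checkSpan D.δᵀ p ∧
        IsAvoiding (graphBadSets G η (4 * (w + 1) * γ))
          (suppAt (fun c : {x // p x} => ι ⟨c, hS c c.2⟩) ρ) := by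
  refine exists_decoder (fun a b h => ?_) (fun a b h => ?_) (fun d c h => hadj _ _ h)
    (D.checkSpan_le_ker hp) (fun c => ?_) (D.flipProperty hj hp hw hdec hι hS hS' hG) hη hγin hγ
  · exact Subtype.ext (congrArg (fun x : {x // S x} => x.1) (hι h))
  · exact Subtype.ext (congrArg (fun x : {x // S x} => x.1) (hι h))
  · exact ncard_subtype_le (S := {y | D.δ y c ≠ 0 ∨ D.δ c y ≠ 0}) (fun x hx => Or.inl hx)
      (D.ncard_incident_le hw c)

/-- Flip decoders of both complexes at a nonempty level have rate below one. -/
theorem lt_one_of_flipDecoder (C : BasedComplex r X) {i m : ℕ} {γ : ℝ} (hm : 1 ≤ m)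
    (h : C.HasFlipDecoder m γ i) (h' : C.dual.HasFlipDecoder m γ (r - i)) (c : C.Cell i) :
    γ < 1 := by
  have hne : (Pi.single c 1 : C.Cochain i) ≠ 0 := by simp
  have hnorm : hammingNorm (Pi.single c 1 : C.Cochain i) ≤ m := by
    refine le_trans ?_ hm
    rw [← ncard_suppAt Function.injective_id]
    refine (Set.ncard_le_ncard (t := {c}) ?_ (Set.toFinite _)).trans (by simp)
    rintro _ ⟨c', hc', rfl⟩
    by_contra h
    exact hc' (Pi.single_eq_of_ne h 1)
  obtain ⟨c₀, ⟨b, -, hb⟩ | ⟨a, -, ha⟩⟩ := h.1 _ hne hnorm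
  -- A reduction of a single cell by a coboundary exhibits a level-`i` cell with nonzero boundary,
  -- so the dual decoder bounds `γ`. In the other case the cell itself has a nonzero coboundary.
  · have hb0 : C.cobInto i b ≠ 0 := by
      intro h0
      rw [h0, add_zero] at hb
      exact lt_irrefl _ hb
    obtain ⟨y, hy⟩ := Function.ne_iff.mp hb0
    have hy' : ∑ x : C.Cell (i - 1), C.δ y x * b x ≠ 0 := hy
    obtain ⟨x, -, hx⟩ := Finset.exists_ne_zero_of_sum_ne_zero hy'
    exact C.dual.lt_one_of_syndromeFlip (c := y) (d := x) hm h'.2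
      (congrArg (fun l => r - l) y.2) (left_ne_zero_of_mul hx)
  · have ha0 : C.cob i (Pi.single c 1) ≠ 0 := by
      intro h0
      rw [h0, hammingNorm_zero] at ha
      exact Nat.not_lt_zero _ ha
    obtain ⟨y, hy⟩ := Function.ne_iff.mp ha0
    have hy' : ∑ x : C.Cell i, C.δ y x * (Pi.single c 1 : C.Cochain i) x ≠ 0 := hy
    obtain ⟨x, -, hx⟩ := Finset.exists_ne_zero_of_sum_ne_zero hy'
    exact C.lt_one_of_syndromeFlip (c := x) (d := y) hm h.2 x.2 (left_ne_zero_of_mul hx)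

variable (C : BasedComplex r X) (i : ℕ)

/-- The `Z`-checks of the code at level `i`, without the trivial ones. -/
abbrev CheckZ : Type _ := CheckCell C.δ (fun x => C.level x = i)

/-- The `X`-checks of the code at level `i`, without the trivial ones. -/
abbrev CheckX : Type _ := CheckCell C.δᵀ (fun x => C.level x = i)

variable {C i}

theorem level_checkZ (d : C.CheckZ i) : C.level d = i + 1 := by
  obtain ⟨c, hc, h⟩ := d.2
  rw [C.level_of_δ _ _ h, hc]

theorem level_checkX (d : C.CheckX i) : C.level d + 1 = i := by
  obtain ⟨c, hc, h⟩ := d.2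
  rw [← C.level_of_δ _ _ h, hc]

variable (C i)

/-- The basis element carrying a data or ancilla qubit. -/
def qubitVertex : C.Cell i ⊕ (C.CheckX i ⊕ C.CheckZ i) → C.LevelVertex {i - 1, i, i + 1} :=
  Sum.elim (fun c => ⟨c.1, by simp [c.2]⟩) (Sum.elim
    (fun d => ⟨d.1, by have := level_checkX d; left; omega⟩)
    (fun d => ⟨d.1, by have := level_checkZ d; right; right; exact this⟩))

theorem qubitVertex_injective : Function.Injective (C.qubitVertex i) := by
  refine Function.Injective.sumElim (fun a b h => Subtype.ext (congrArg (fun x => x.1) h))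
    (Function.Injective.sumElim (fun a b h => Subtype.ext (congrArg (fun x => x.1) h))
      (fun a b h => Subtype.ext (congrArg (fun x => x.1) h)) ?_) ?_
  · intro a b h
    have h' : C.level a = C.level b := congrArg (fun x => C.level x.1) h
    have := level_checkX a
    have := level_checkZ b
    omega
  · rintro a (b | b) h
    · have h' : C.level a = C.level b := congrArg (fun x => C.level x.1) h
      have := level_checkX b
      have := a.2
      omega
    · have h' : C.level a = C.level b := congrArg (fun x => C.level x.1) h
      have := level_checkZ b
      have := a.2
      omega

variable {C i}

/-- Incidence of the images of basis elements in an ambient vertex set. -/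
def Touch {V : Type*} {q : X → Prop} (C : BasedComplex r X) (ι : {x // q x} → V) (u v : V) : Prop :=
  ∃ x y, ι x = u ∧ ι y = v ∧ (C.δ y x ≠ 0 ∨ C.δ x y ≠ 0)

theorem ncard_touch_le {V : Type*} [Finite V] {q : X → Prop} {ι : {x // q x} → V}
    (hι : Function.Injective ι) {w : ℕ} (hw : C.HasLocality w) (u : V) :
    {v | C.Touch ι u v}.ncard ≤ w := by
  by_cases h : ∃ x, ι x = u
  · obtain ⟨x, rfl⟩ := h
    have hsub : {v | C.Touch ι (ι x) v} ⊆ ι '' {y | C.δ y x ≠ 0 ∨ C.δ x y ≠ 0} := by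
      rintro v ⟨x', y, hx, rfl, hxy⟩
      obtain rfl := hι hx
      exact ⟨y, hxy, rfl⟩
    refine (Set.ncard_le_ncard hsub (Set.toFinite _)).trans ?_
    rw [Set.ncard_image_of_injective _ hι]
    exact ncard_subtype_le (S := {y | C.δ y x ≠ 0 ∨ C.δ x y ≠ 0}) (fun _ h => h)
      (C.ncard_incident_le hw x)
  · have : {v | C.Touch ι u v} = ∅ := by
      ext v
      simp only [Set.mem_ofPred_eq, Set.mem_empty_iff_false, iff_false]
      rintro ⟨x, y, hx, -⟩
      exact h ⟨x, hx⟩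
    simp [this]

end BasedComplex

theorem card_qubits_le {r : ℕ} {X : Type*} [Fintype X] {C : BasedComplex r X} {i w : ℕ}
    (hw : C.HasLocality w) (hw1 : 1 ≤ w) :
    Fintype.card (C.Cell i ⊕ (C.CheckX i ⊕ C.CheckZ i)) ≤ 8 * (Fintype.card (C.Cell i) * w) := by
  have h1 : Fintype.card (C.CheckZ i) ≤ Fintype.card (C.Cell i) * w :=
    BasedComplex.card_checkCell_le C.δ (fun x => C.level x = i) (w := w) fun x =>
      (Set.ncard_le_ncard (fun y hy => Or.inl hy) (Set.toFinite _)).trans (C.ncard_incident_le hw x)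
  have h2 : Fintype.card (C.CheckX i) ≤ Fintype.card (C.Cell i) * w :=
    BasedComplex.card_checkCell_le C.δᵀ (fun x => C.level x = i) (w := w) fun x =>
      (Set.ncard_le_ncard (fun y hy => Or.inr hy) (Set.toFinite _)).trans (C.ncard_incident_le hw x)
  have h3 : Fintype.card (C.Cell i) ≤ Fintype.card (C.Cell i) * w := Nat.le_mul_of_pos_right _ hw1
  rw [Fintype.card_sum, Fintype.card_sum]
  omega

/-- Schedules for the checks of a local complex. -/
theorem exists_schedules {r : ℕ} {X : Type*} [Fintype X] {C : BasedComplex r X} {i w : ℕ}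
    (hw : C.HasLocality w) (hw1 : 1 ≤ w) :
    Nonempty (Schedule (checkMat C.δᵀ (fun x => C.level x = i)) (2 * w)) ∧
      Nonempty (Schedule (checkMat C.δ (fun x => C.level x = i)) (2 * w)) := by
  have h := fun x => C.ncard_incident_le hw x
  refine ⟨exists_schedule _ hw1 (fun b => ?_) (fun c => ?_),
    exists_schedule _ hw1 (fun b => ?_) (fun c => ?_)⟩
  · exact BasedComplex.ncard_subtype_le (S := {y | C.δ y b ≠ 0 ∨ C.δ b y ≠ 0})
      (fun x hx => Or.inl hx) (h b)
  · exact BasedComplex.ncard_subtype_le (S := {y | C.δ y c ≠ 0 ∨ C.δ c y ≠ 0})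
      (fun x hx => Or.inr hx) (h c)
  · exact BasedComplex.ncard_subtype_le (S := {y | C.δ y b ≠ 0 ∨ C.δ b y ≠ 0})
      (fun x hx => Or.inr hx) (h b)
  · exact BasedComplex.ncard_subtype_le (S := {y | C.δ y c ≠ 0 ∨ C.δ c y ≠ 0})
      (fun x hx => Or.inl hx) (h c)

end FaultTol

end

/-! ### Assembly of the gadget -/

theorem proposition8p1 :
    ∃ (K : ℕ) (T : ℕ → ℕ), (∀ w : ℕ, 1 ≤ w → 1 ≤ T w ∧ T w ≤ K * w) ∧
      ∀ (r i w m k : ℕ) (X : Type*) [Fintype X] (C : FaultTol.BasedComplex r X)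
        (γdec : ℝ) (enc : C.CSSEncoding i k)
        (V : Type*) [Finite V] (Grun : SimpleGraph V)
        (ι : C.LevelVertex {i - 1, i, i + 1} ↪ V)
        (ηin γin ηrun γrun : ℝ),
        1 ≤ i → i + 1 ≤ r →
        1 ≤ w → C.HasLocality w →
        0 < γdec → C.HasFlipDecoder m γdec i → C.dual.HasFlipDecoder m γdec (r - i) →
        (∀ a b, (C.connectivityGraph {i - 1, i, i + 1}).Adj a b → Grun.Adj (ι a) (ι b)) →
        (∀ a b, C.Incident a.1 b.1 → Grun.Adj (ι a) (ι b)) →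
        0 < ηrun → ηrun ≤ ηin → ηin ≤ m →
        0 < γrun → γrun ≤ γin →
        γin ≤ 1 / (50 * (w : ℝ) ^ 7 * (T w : ℝ) * 2 ^ (T w + 1)) →
        ∃ (N M : ℕ) (Q : FaultTol.AdaptiveCliffordCircuit N M (T w))
          (site : Fin N ↪ V) (pos : C.Cell i ↪ Fin N),
          N ≤ K * (Fintype.card (C.Cell i) * w) ∧
          FaultTol.IsPauliFaultTolerantGadget Q
            (FaultTol.disjointCopies (FaultTol.graphBadSets Grun ηrun γrun) (T w)) site
            (FaultTol.decoratedLevel C enc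
              ((FaultTol.cellToVertex C (by simp)).trans ι) Grun ηin γin) pos
            (FaultTol.decoratedLevel C enc
              ((FaultTol.cellToVertex C (by simp)).trans ι) Grun ηrun
              (((w : ℝ) + 1) * (T w : ℝ) * 2 ^ (T w + 6) * γrun / γdec)) pos
            LinearMap.id := by
  -- `T = 4w + 4 ≤ 8w`; the number of qubits is at most `3nw`, so 8 serves for both bounds.
  refine ⟨8, fun w => 2 * (2 * w) + 4, fun w hw => ⟨by dsimp only; omega, by dsimp only; omega⟩, ?_⟩
  intro r i w m k X _ C γdec enc V _ Grun ι ηin γin ηrun γrun hi hir hw1 hloc hγdec hflip hflip'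
    hconn hinc hηrun hηle hηm hγrun hγle hγin
  classical
  set p : X → Prop := fun x => C.level x = i with hp
  obtain ⟨⟨sX⟩, ⟨sZ⟩⟩ := FaultTol.exists_schedules (i := i) hloc hw1
  set T : ℕ := 2 * (2 * w) + 4 with hT
  have hT0 : (0 : ℝ) < T := by rw [hT]; positivity
  have hthr := FaultTol.threshold_mul_le (T := T) hw1 (by omega) hγin
  -- Densities of all faults together, of their first neighbourhood and of their second
  -- neighbourhood.
  set γ₀ : ℝ := T * γrun with hγ₀
  set γ₁ : ℝ := 2 * ((w : ℝ) + 1) * γ₀ with hγ₁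
  set γ₂ : ℝ := 2 * ((w : ℝ) + 1) * γ₁ with hγ₂
  have h0 : 0 < γ₀ := by positivity
  have h1 : 0 < γ₁ := by positivity
  have h2 : 0 < γ₂ := by positivity
  obtain ⟨decX, hdecX⟩ := C.exists_decoder_of_flip (p := p) hi (fun _ => Iff.rfl) hloc hflip.1
    (G := Grun) (S := fun x => C.level x ∈ ({i - 1, i, i + 1} : Set ℕ)) ι.injective
    (fun x hx => by simp [show C.level x = i from hx])
    (fun d => by rw [FaultTol.BasedComplex.level_checkZ d]; simp)
    (fun z a b hab ha hb => hconn a b ⟨hab, Or.inl ⟨z, ha, hb⟩⟩)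
    (fun a b h => (hinc a b h).symm) hηm hthr (η := ηrun) h2
  -- `Z`-errors are decoded in the dual complex, where cliques are the sets below a cell of level
  -- `r`; `i + 1 ≤ r` makes its level positive.
  obtain ⟨decZ, hdecZ⟩ := C.dual.exists_decoder_of_flip (p := p) (j := r - i) (by omega)
    (fun x => by
      have := C.level_le x
      change C.level x = i ↔ r - C.level x = r - i
      omega) hloc.dual hflip'.1
    (G := Grun) (S := fun x => C.level x ∈ ({i - 1, i, i + 1} : Set ℕ)) ι.injective
    (fun x hx => by simp [show C.level x = i from hx])
    (fun d => by
      have := FaultTol.BasedComplex.level_checkX (C := C) (i := i) d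
      left; omega)
    (fun z a b hab ha hb => hconn a b ⟨hab, Or.inr ⟨⟨z.1, by
      have h := z.2
      have := C.level_le z.1
      change r - C.level z.1 = 0 at h
      omega⟩, FaultTol.BasedComplex.dual_below.mp ha, FaultTol.BasedComplex.dual_below.mp hb⟩⟩)
    (fun a b h => hinc b a h) hηm hthr (η := ηrun) h2
  set e := Fintype.equivFin (C.Cell i ⊕ (C.CheckX i ⊕ C.CheckZ i)) with he
  set site : Fin (Fintype.card (C.Cell i ⊕ (C.CheckX i ⊕ C.CheckZ i))) ↪ V :=
    ⟨fun a => ι (C.qubitVertex i (e.symm a)),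
      ι.injective.comp ((C.qubitVertex_injective i).comp e.symm.injective)⟩ with hsite
  have hsite_e : ∀ x, site (e x) = ι (C.qubitVertex i x) := fun x => by simp [hsite]
  refine ⟨_, _, FaultTol.ecCircuit e sX sZ decX decZ, site, FaultTol.dataEmb e,
    FaultTol.card_qubits_le hloc hw1, fun c => hsite_e _, fun c => hsite_e _, ?_⟩
  intro l (ρ : Matrix ((Fin k → ZMod 2) × (Fin l → ZMod 2)) ((Fin k → ZMod 2) × (Fin l → ZMod 2)) ℂ)
    _ _ σ hσ F hF
  obtain ⟨P, z, hP, hPσ⟩ := hσ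
  set S : Set V := ⋃ t ∈ (Finset.univ : Finset (Fin T)), site '' (F t).support with hS
  have hS0 : FaultTol.IsAvoiding (FaultTol.graphBadSets Grun ηrun γ₀) S := by
    have := FaultTol.isAvoiding_biUnion (G := Grun) (η := ηrun) (γ := γrun)
      (S := fun t => site '' (F t).support) (Finset.univ : Finset (Fin T))
      (fun t _ => hF.timestep t) ⟨⟨0, by dsimp only; omega⟩, Finset.mem_univ _⟩
    rwa [Finset.card_univ, Fintype.card_fin] at this
  have hI : ∀ u v, C.Touch ι u v → u = v ∨ Grun.Adj u v := by
    rintro _ _ ⟨x, y, rfl, rfl, h | h⟩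
    · exact Or.inr (hinc x y h)
    · exact Or.inr (hinc y x h).symm
  have hIw := FaultTol.BasedComplex.ncard_touch_le ι.injective hloc
  set N₁ : Set V := S ∪ {v | ∃ s ∈ S, C.Touch ι s v} with hN₁
  have hS1 := hS0.neighbourhood h0 (C.Touch ι) hI hIw
  set N₂ : Set V := N₁ ∪ {v | ∃ s ∈ N₁, C.Touch ι s v} with hN₂
  have hS2 := hS1.neighbourhood h1 (C.Touch ι) hI hIw
  have hSN1 : S ⊆ N₁ := Set.subset_union_left
  have hN12 : N₁ ⊆ N₂ := Set.subset_union_left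
  -- `X`-noise flows from `X`-ancillas to data to `Z`-ancillas, so these carry `S`, `N₁` and `N₂`
  -- respectively; for `Z`-noise the order is reversed. Both parts of the noise on the data lie in
  -- `N₁`.
  set XS := e '' {x | Sum.elim (fun _ => ι (C.qubitVertex i x) ∈ N₁) (Sum.elim
    (fun _ => ι (C.qubitVertex i x) ∈ S) (fun _ => ι (C.qubitVertex i x) ∈ N₂)) x} with hXS
  set ZS := e '' {x | Sum.elim (fun _ => ι (C.qubitVertex i x) ∈ N₁) (Sum.elim
    (fun _ => ι (C.qubitVertex i x) ∈ N₂) (fun _ => ι (C.qubitVertex i x) ∈ S)) x} with hZS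
  have hmX : ∀ x, e x ∈ XS ↔ Sum.elim (fun _ => ι (C.qubitVertex i x) ∈ N₁) (Sum.elim
      (fun _ => ι (C.qubitVertex i x) ∈ S) (fun _ => ι (C.qubitVertex i x) ∈ N₂)) x :=
    fun x => e.injective.mem_set_image
  have hmZ : ∀ x, e x ∈ ZS ↔ Sum.elim (fun _ => ι (C.qubitVertex i x) ∈ N₁) (Sum.elim
      (fun _ => ι (C.qubitVertex i x) ∈ N₂) (fun _ => ι (C.qubitVertex i x) ∈ S)) x :=
    fun x => e.injective.mem_set_image
  have hFS : ∀ t a, a ∈ (F t).support → site a ∈ S := fun t a ha =>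
    Set.mem_biUnion (Finset.mem_coe.mpr (Finset.mem_univ t)) ⟨a, ha, rfl⟩
  have hFX : ∀ t, (F t).support ⊆ XS := by
    intro t a ha
    have h := hFS t a ha
    obtain ⟨x, rfl⟩ := e.surjective a
    rw [hsite_e] at h
    rw [hmX]
    rcases x with c | d | d
    · exact hSN1 h
    · exact h
    · exact hN12 (hSN1 h)
  have hFZ : ∀ t, (F t).support ⊆ ZS := by
    intro t a ha
    have h := hFS t a ha
    obtain ⟨x, rfl⟩ := e.surjective a
    rw [hsite_e] at h
    rw [hmZ]
    rcases x with c | d | d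
    · exact hSN1 h
    · exact hN12 (hSN1 h)
    · exact h
  have hE := C.isEncoding hi enc
  have hedge : ∀ {β : Type _} [Fintype β] (H : Matrix β (C.Cell i) (ZMod 2)) (j : β × C.Cell i),
      j ∈ FaultTol.edges H → H j.1 j.2 ≠ 0 := by
    intro β _ H j hj
    exact (Finset.mem_filter.mp hj).2
  have hσ' : FaultTol.partialTrace (FaultTol.dataEmb e) σ = z • FaultTol.PauliSuperop.apply P
      (FaultTol.sandwich (C.encodingIsometry enc) (C.encodingIsometry enc) ρ) := hPσ
  rw [FaultTol.PauliSuperop.apply_sandwich, FaultTol.pauliMat_mul, FaultTol.pauliMat_mul,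
    FaultTol.sandwich_smul, smul_smul] at hσ'
  have hin : ∀ b : C.Cell i → ZMod 2, (∀ c, b c ≠ 0 → c ∈ P.support) →
      FaultTol.IsAvoiding (FaultTol.graphBadSets Grun ηin γin)
        (FaultTol.suppAt (fun c : C.Cell i => ι ⟨c, by simp [c.2]⟩) b) := by
    intro b hb
    refine FaultTol.IsAvoiding.anti hP ?_
    rintro _ ⟨c, hc, rfl⟩
    exact ⟨c, hb c hc, rfl⟩
  have hl : ∀ c, P.left c ≠ .I → c ∈ P.support := fun c h => Or.inl h
  have hr : ∀ c, P.right c ≠ .I → c ∈ P.support := fun c h => Or.inr h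
  have hx : ∀ Q : FaultTol.Pauli, Q.xBit ≠ 0 → Q ≠ .I := by
    rintro Q h rfl; exact h rfl
  have hz : ∀ Q : FaultTol.Pauli, Q.zBit ≠ 0 → Q ≠ .I := by
    rintro Q h rfl; exact h rfl
  have hfX : ∀ f : C.CheckZ i → ZMod 2, (∀ d, f d ≠ 0 → e (.inr (.inr d)) ∈ XS) →
      FaultTol.IsAvoiding (FaultTol.graphBadSets Grun ηrun γ₂) (FaultTol.suppAt
        (fun d : C.CheckZ i => ι (C.qubitVertex i (.inr (.inr d)))) f) := by
    intro f hf
    refine FaultTol.IsAvoiding.anti hS2 ?_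
    rintro _ ⟨d, hd, rfl⟩
    exact (hmX _).mp (hf d hd)
  have hfZ : ∀ f : C.CheckX i → ZMod 2, (∀ d, f d ≠ 0 → e (.inr (.inl d)) ∈ ZS) →
      FaultTol.IsAvoiding (FaultTol.graphBadSets Grun ηrun γ₂) (FaultTol.suppAt
        (fun d : C.CheckX i => ι (C.qubitVertex i (.inr (.inl d)))) f) := by
    intro f hf
    refine FaultTol.IsAvoiding.anti hS2 ?_
    rintro _ ⟨d, hd, rfl⟩
    exact (hmZ _).mp (hf d hd)
  let Good : (C.Cell i → ZMod 2) → Prop := fun f =>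
    FaultTol.IsAvoiding (FaultTol.graphBadSets Grun ηrun (4 * ((w : ℝ) + 1) * γ₂))
      (FaultTol.suppAt (fun c : C.Cell i => ι (C.qubitVertex i (.inl c))) f)
  have hdX : ∀ a : C.Cell i → ZMod 2, (∀ c, a c ≠ 0 → c ∈ P.support) →
      ∀ f : C.CheckZ i → ZMod 2, (∀ d, f d ≠ 0 → e (.inr (.inr d)) ∈ XS) → ∃ g, Good g ∧
        a + decX (FaultTol.checkMat C.δ p *ᵥ a + f) + g ∈
          LinearMap.range (FaultTol.checkMat C.δᵀ p)ᵀ.mulVecLin := by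
    intro a ha f hf
    obtain ⟨g, hg, hg'⟩ := hdecX a f (hin a ha) (hfX f hf)
    exact ⟨g, hg', hg⟩
  have hdZ : ∀ a : C.Cell i → ZMod 2, (∀ c, a c ≠ 0 → c ∈ P.support) →
      ∀ f : C.CheckX i → ZMod 2, (∀ d, f d ≠ 0 → e (.inr (.inl d)) ∈ ZS) → ∃ g, Good g ∧
        a + decZ (FaultTol.checkMat C.δᵀ p *ᵥ a + f) + g ∈
          LinearMap.range (FaultTol.checkMat C.δ p)ᵀ.mulVecLin := by
    intro a ha f hf
    obtain ⟨g, hg, hg'⟩ := hdecZ a f (hin a ha) (hfZ f hf)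
    exact ⟨g, hg', hg⟩
  obtain ⟨P', z', f, g, f', g', hf, hg, hf', hg', hsupp, hout⟩ :=
    FaultTol.ecCircuit_deviation e sX sZ decX decZ (XS := XS) (ZS := ZS)
      (by
        intro j hj h
        exact (hmX (.inl j.2)).mpr (Or.inr ⟨_, (hmX (.inr (.inl j.1))).mp h, _, _, rfl, rfl,
          Or.inl (hedge _ j hj)⟩))
      (by
        intro j hj h
        exact (hmZ (.inr (.inl j.1))).mpr (Or.inr ⟨_, (hmZ (.inl j.2)).mp h, _, _, rfl, rfl,
          Or.inr (hedge _ j hj)⟩))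
      (by
        intro j hj h
        exact (hmX (.inr (.inr j.1))).mpr (Or.inr ⟨_, (hmX (.inl j.2)).mp h, _, _, rfl, rfl,
          Or.inl (hedge _ j hj)⟩))
      (by
        intro j hj h
        exact (hmZ (.inl j.2)).mpr (Or.inr ⟨_, (hmZ (.inr (.inr j.1))).mp h, _, _, rfl, rfl,
          Or.inr (hedge _ j hj)⟩))
      F hFX hFZ hE hσ' (GoodX := Good) (GoodZ := Good)
      (hdX _ fun c h => hl c (hx _ h)) (hdX _ fun c h => hr c (hx _ h))
      (hdZ _ fun c h => hl c (hz _ h)) (hdZ _ fun c h => hr c (hz _ h))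
  refine ⟨P', z', ?_, hout⟩
  -- The output error consists of faults spread over the data and four residuals: `X` and `Z` parts
  -- on the left and on the right.
  have hunion := hS1.union ((hf.union hg).union (hf'.union hg'))
  have hsub : (fun c : C.Cell i => ι (C.qubitVertex i (.inl c))) '' P'.support ⊆ N₁ ∪
      ((FaultTol.suppAt (fun c => ι (C.qubitVertex i (.inl c))) f ∪
        FaultTol.suppAt (fun c => ι (C.qubitVertex i (.inl c))) g) ∪
      (FaultTol.suppAt (fun c => ι (C.qubitVertex i (.inl c))) f' ∪
        FaultTol.suppAt (fun c => ι (C.qubitVertex i (.inl c))) g')) := by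
    rintro _ ⟨c, hc, rfl⟩
    rcases hsupp c hc with h | h | h | h | h
    · left
      rcases h with h | h
      · exact (hmX _).mp h
      · exact (hmZ _).mp h
    · exact Or.inr (Or.inl (Or.inl ⟨c, h, rfl⟩))
    · exact Or.inr (Or.inl (Or.inr ⟨c, h, rfl⟩))
    · exact Or.inr (Or.inr (Or.inl ⟨c, h, rfl⟩))
    · exact Or.inr (Or.inr (Or.inr ⟨c, h, rfl⟩))
  -- The bound `γdec < 1` needs a cell of level `i`; without data qubits the output error is empty.
  by_cases hn : Nonempty (C.Cell i)
  · have hm1 : 1 ≤ m := by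
      by_contra hm
      have : (m : ℝ) = 0 := by
        have : m = 0 := by omega
        exact_mod_cast this
      linarith
    have hlt := C.lt_one_of_flipDecoder hm1 hflip hflip' hn.some
    refine (FaultTol.IsAvoiding.anti hunion hsub).mono ?_
    have := FaultTol.output_density_le (w := w) hγrun hγdec hlt
    refine le_trans (le_of_eq ?_) this
    rw [hγ₂, hγ₁, hγ₀]
    ring
  · have : P'.support = ∅ := Set.eq_empty_of_forall_notMem fun c => (hn ⟨c⟩).elim
    rw [this, Set.image_empty]
    exact FaultTol.IsAvoiding.empty (by positivity)
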